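/- An oblivious algebraic branching program (ABP) over a field $\mathbb F$ is a layered directed graph with one source (the only node of the first layer) and one sink (the only node of the last layer), whose edges go from each layer to the next, such that all the edges between layers $\ell-1$ and $\ell$ are labelled by univariate polynomials in a single variable $x_{i_\ell}$. It computes the sum, over all source-to-sink paths, of the product of the labels on the path. Its width is the maximal number of nodes in a layer, its degree is the maximal degree of a label, and its reading order is the sequence $(i_1,\dots,i_L)$; it is read-$k$ if every variable occurs at most $k$ times in the reading order. Running times are those of uniform deterministic programs on a random access machine over $\mathbb F$: in one step, two field elements are added, subtracted, multiplied or divided, a field element is compared with $0$, two natural numbers are added, subtracted or compared, a memory cell is accessed, or the $j$-th entry of a fixed listing of elements of $\mathbb F$ is fetched. **Theorem.** There are an absolute constant $C$ and two programs, not depending on the field or on the parameters, with the following property. Let $n,k\ge 1$ and $w,d\ge 0$ be integers, and put $$B=\bigl((n+w+d+2)^{C}\bigr)^{\,n^{1-1/2^{k-1}}\cdot \exp(k^2)\cdot (\log (n+2))^{C}}.$$ Let $\mathbb F$ be any field with at least $(n+w+d+2)^{Ck}$ elements, where the first $(n+w+d+2)^{Ck}$ entries of the listing are distinct. 1. (White-box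 identity test.) Given the parameters $n, w, d, k$ and a read-$k$ oblivious ABP in $n$ variables over $\mathbb F$, of width at most $w$ and degree at most $d$, by its reading order, its layer sizes and the coefficients of its labels, the first program decides in at most $B$ steps whether the polynomial that the ABP computes is identically zero. 2. (Hitting set from the order alone.) Given only $n,w,d,k$ and a read-$k$ reading order $\sigma=(i_1,\dots,i_L)$, the second program outputs in at most $B$ steps a list of at most $B$ points of $\mathbb F^n$ such that every nonzero polynomial computed by an oblivious ABP over $\mathbb F$ with reading order $\sigma$, width at most $w$ and degree at most $d$ is nonzero at one of these points. -/

import Mathlib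

/-! ### Oblivious algebraic branching programs -/

/-- An oblivious algebraic branching program over `F` in the variables `x_0, …, x_{n-1}`, of width at
most `w` and degree at most `d`, with `L` levels of edges, in which all labels of the edges between
node layers `ℓ` and `ℓ + 1` are univariate polynomials in the variable `x_{σ ℓ}`.
A missing edge is an edge with label `0`. -/
structure ObliviousABP (F : Type*) [Field F] {n L : ℕ} (w d : ℕ) (σ : Fin L → Fin n) where
  /-- the number of nodes of each of the layers `0, …, L` -/
  size : Fin (L + 1) → ℕ
  size_le : ∀ i, size i ≤ w
  /-- the source is the only node of the first layer -/
  size_first : size 0 = 1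
  /-- the sink is the only node of the last layer -/
  size_last : size (Fin.last L) = 1
  /-- the edge labels -/
  label : (l : Fin L) → Fin (size l.castSucc) → Fin (size l.succ) → Polynomial F
  degree_le : ∀ l a b, (label l a b).natDegree ≤ d

namespace ObliviousABP

variable {F : Type*} [Field F] {n L w d : ℕ} {σ : Fin L → Fin n}

/-- The polynomial computed by the program: the sum, over all source-to-sink paths, of the product of
the labels along the path. -/
noncomputable def poly (A : ObliviousABP F w d σ) : MvPolynomial (Fin n) F :=
  ∑ p : ((i : Fin (L + 1)) → Fin (A.size i)),
    ∏ l : Fin L,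
      Polynomial.aeval (MvPolynomial.X (σ l) : MvPolynomial (Fin n) F)
        (A.label l (p l.castSucc) (p l.succ))

open Classical in
/-- The coefficient of degree `j` of the label of the edge from node `a` of layer `l` to node `b` of
layer `l + 1`, and `0` if there is no such edge. -/
noncomputable def coeffAt (A : ObliviousABP F w d σ) (l a b j : ℕ) : F :=
  if h : ∃ hl : l < L, a < A.size (Fin.castSucc ⟨l, hl⟩) ∧ b < A.size (Fin.succ ⟨l, hl⟩) then
    (A.label ⟨l, h.1⟩ ⟨a, h.2.1⟩ ⟨b, h.2.2⟩).coeff j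
  else 0

/-- The number of nodes of layer `i`, and `0` if there is no such layer. -/
def sizeAt (A : ObliviousABP F w d σ) (i : ℕ) : ℕ :=
  if h : i < L + 1 then A.size ⟨i, h⟩ else 0

end ObliviousABP

/-- The reading order `σ` is read-`k`: every variable is read in at most `k` levels. -/
def IsReadK {n L : ℕ} (k : ℕ) (σ : Fin L → Fin n) : Prop :=
  ∀ i : Fin n, (Finset.univ.filter fun l => σ l = i).card ≤ k

/-! ### The machine model

Structured programs for a random access machine over a field `F`, which has registers and arrays that
hold natural numbers and registers and arrays that hold field elements. Numbers can be added,
subtracted (truncated at `0`), compared and used as array indices; there is no multiplication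
of numbers in one step, so numbers have at most linearly many bits in the running time. Field elements
can be added, subtracted, multiplied, inverted (with `0⁻¹ = 0`) and tested for being `0`; the only
other source of field elements is a listing `enum : ℕ → F`, from which an element is fetched
by its index. The program text does not depend on the field. -/

/-- Memory contents. In `mem a i` and `fmem a i`, `a` is the name of an array and `i` an index. -/
structure Store (F : Type*) where
  reg : ℕ → ℕ
  mem : ℕ → ℕ → ℕ
  freg : ℕ → F
  fmem : ℕ → ℕ → F

/-- Expressions for natural numbers. -/
inductive NExp : Type
  | lit (c : ℕ) : NExp
  | var (r : ℕ) : NExp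
  | get (a : ℕ) (i : NExp) : NExp
  | add (e₁ e₂ : NExp) : NExp
  | sub (e₁ e₂ : NExp) : NExp

/-- Expressions for field elements; `elem i` is the `i`-th entry of the listing of field elements. -/
inductive FExp : Type
  | zero : FExp
  | one : FExp
  | elem (i : NExp) : FExp
  | var (r : ℕ) : FExp
  | get (a : ℕ) (i : NExp) : FExp
  | add (e₁ e₂ : FExp) : FExp
  | sub (e₁ e₂ : FExp) : FExp
  | mul (e₁ e₂ : FExp) : FExp
  | inv (e : FExp) : FExp

/-- Tests: comparison of two numbers, and equality of a field element to `0`. -/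
inductive Test : Type
  | lt (e₁ e₂ : NExp) : Test
  | isZero (e : FExp) : Test

/-- Programs. -/
inductive Prog : Type
  | skip : Prog
  | setReg (r : ℕ) (e : NExp) : Prog
  | setMem (a : ℕ) (i e : NExp) : Prog
  | setFReg (r : ℕ) (e : FExp) : Prog
  | setFMem (a : ℕ) (i : NExp) (e : FExp) : Prog
  | seq (p q : Prog) : Prog
  | ite (b : Test) (p q : Prog) : Prog
  | loop (b : Test) (p : Prog) : Prog

/-- The value of an expression for natural numbers. -/
def NExp.val {F : Type*} (s : Store F) : NExp → ℕ
  | .lit c => c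
  | .var r => s.reg r
  | .get a i => s.mem a (i.val s)
  | .add e₁ e₂ => e₁.val s + e₂.val s
  | .sub e₁ e₂ => e₁.val s - e₂.val s

/-- The number of steps in which an expression is evaluated: one for each operation and access. -/
def NExp.cost : NExp → ℕ
  | .lit _ => 1
  | .var _ => 1
  | .get _ i => i.cost + 1
  | .add e₁ e₂ => e₁.cost + e₂.cost + 1
  | .sub e₁ e₂ => e₁.cost + e₂.cost + 1

/-- The value of an expression for field elements, given the listing `enum` of field elements. -/
def FExp.val {F : Type*} [Field F] (enum : ℕ → F) (s : Store F) : FExp → F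
  | .zero => 0
  | .one => 1
  | .elem i => enum (i.val s)
  | .var r => s.freg r
  | .get a i => s.fmem a (i.val s)
  | .add e₁ e₂ => e₁.val enum s + e₂.val enum s
  | .sub e₁ e₂ => e₁.val enum s - e₂.val enum s
  | .mul e₁ e₂ => e₁.val enum s * e₂.val enum s
  | .inv e => (e.val enum s)⁻¹

/-- The number of steps in which an expression is evaluated: one for each operation and access. -/
def FExp.cost : FExp → ℕ
  | .zero => 1
  | .one => 1
  | .elem i => i.cost + 1
  | .var _ => 1
  | .get _ i => i.cost + 1
  | .add e₁ e₂ => e₁.cost + e₂.cost + 1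
  | .sub e₁ e₂ => e₁.cost + e₂.cost + 1
  | .mul e₁ e₂ => e₁.cost + e₂.cost + 1
  | .inv e => e.cost + 1

/-- The test succeeds. -/
def Test.Holds {F : Type*} [Field F] (enum : ℕ → F) (s : Store F) : Test → Prop
  | .lt e₁ e₂ => e₁.val s < e₂.val s
  | .isZero e => e.val enum s = 0

/-- The number of steps of a test. -/
def Test.cost : Test → ℕ
  | .lt e₁ e₂ => e₁.cost + e₂.cost + 1
  | .isZero e => e.cost + 1

/-- `Runs enum p s t c`: the program `p`, started on the store `s`, halts with the store `t` after
exactly `c` steps. -/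
inductive Runs {F : Type*} [Field F] (enum : ℕ → F) : Prog → Store F → Store F → ℕ → Prop
  | skip (s : Store F) : Runs enum .skip s s 1
  | setReg (r : ℕ) (e : NExp) (s : Store F) :
      Runs enum (.setReg r e) s { s with reg := Function.update s.reg r (e.val s) } (e.cost + 1)
  | setMem (a : ℕ) (i e : NExp) (s : Store F) :
      Runs enum (.setMem a i e) s
        { s with
          mem := Function.update s.mem a (Function.update (s.mem a) (i.val s) (e.val s)) }
        (i.cost + e.cost + 1)
  | setFReg (r : ℕ) (e : FExp) (s : Store F) :
      Runs enum (.setFReg r e) s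
        { s with freg := Function.update s.freg r (e.val enum s) } (e.cost + 1)
  | setFMem (a : ℕ) (i : NExp) (e : FExp) (s : Store F) :
      Runs enum (.setFMem a i e) s
        { s with
          fmem := Function.update s.fmem a
            (Function.update (s.fmem a) (i.val s) (e.val enum s)) }
        (i.cost + e.cost + 1)
  | seq {p q : Prog} {s t u : Store F} {c c' : ℕ} :
      Runs enum p s t c → Runs enum q t u c' → Runs enum (.seq p q) s u (c + c')
  | ite_true {b : Test} {p q : Prog} {s t : Store F} {c : ℕ} :
      b.Holds enum s → Runs enum p s t c → Runs enum (.ite b p q) s t (b.cost + c)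
  | ite_false {b : Test} {p q : Prog} {s t : Store F} {c : ℕ} :
      ¬ b.Holds enum s → Runs enum q s t c → Runs enum (.ite b p q) s t (b.cost + c)
  | loop_true {b : Test} {p : Prog} {s t u : Store F} {c c' : ℕ} :
      b.Holds enum s → Runs enum p s t c → Runs enum (.loop b p) t u c' →
        Runs enum (.loop b p) s u (b.cost + c + c')
  | loop_false {b : Test} {p : Prog} {s : Store F} :
      ¬ b.Holds enum s → Runs enum (.loop b p) s s b.cost

/-! ### Inputs and outputs -/

/-- The input that consists of a reading order and the parameters: the registers `0, …, 4` hold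
`n, w, d, k, L`, and array `0` holds the order `σ 0, …, σ (L - 1)`. Everything else is `0`. -/
def orderStore (F : Type*) [Field F] {n L : ℕ} (w d k : ℕ) (σ : Fin L → Fin n) : Store F where
  reg r := if r = 0 then n else if r = 1 then w else if r = 2 then d else if r = 3 then k
    else if r = 4 then L else 0
  mem a i := if a = 0 then (if h : i < L then (σ ⟨i, h⟩ : ℕ) else 0) else 0
  freg _ := 0
  fmem _ _ := 0

/-- The input that describes a whole program: in addition to the reading order and the parameters,
array `1` holds the sizes of the layers, and field array `0` holds the coefficients of all the labels,
the one with indices `(l, a, b, j)` (see `ObliviousABP.coeffAt`) at the position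
`((l * w + a) * w + b) * (d + 1) + j`. -/
noncomputable def abpStore {F : Type*} [Field F] {n L w d : ℕ} {σ : Fin L → Fin n} (k : ℕ)
    (A : ObliviousABP F w d σ) : Store F where
  reg := (orderStore F w d k σ).reg
  mem a i := if a = 1 then A.sizeAt i else (orderStore F w d k σ).mem a i
  freg _ := 0
  fmem a m := if a = 0 then
      A.coeffAt (m / (d + 1) / w / w) (m / (d + 1) / w % w) (m / (d + 1) % w) (m % (d + 1))
    else 0

/-- Reading a list of points of `F ^ n` from field array `0`: the point number `j`. -/
def outputPoint {F : Type*} (n : ℕ) (t : Store F) (j : ℕ) : Fin n → F :=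
  fun i => t.fmem 0 (j * n + i)

/-! ### The bounds -/

/-- `poly(n, w, d) ^ (n ^ (1 - 1 / 2 ^ (k - 1)) * exp (k ^ 2) * polylog n)`, where `C` is the constant
in `poly` and in `polylog`. -/
noncomputable def readKBound (C k n w d : ℕ) : ℝ :=
  (((n : ℝ) + w + d + 2) ^ C) ^
    ((n : ℝ) ^ (1 - 1 / (2 : ℝ) ^ (k - 1)) * Real.exp ((k : ℝ) ^ 2) * Real.log ((n : ℝ) + 2) ^ C)

/-- The number of different field elements that must be available, `poly(n, w, d) ^ k`. -/
def fieldBound (C k n w d : ℕ) : ℕ :=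
  (n + w + d + 2) ^ (C * k)

/-! Both programs run through a generator: a few seeds, each from a set of `E` field elements,
determine a point, and for every nonzero program with the given order some choice of the seeds gives
a point where it does not vanish.

Suppose that the variables outside a set `Y` are frozen at constants, and that `Y` is ordered so
that every initial segment is read in few blocks: among the successive reads of variables in `Y`,
membership in the segment changes at most `K` times. Cutting the product of the layer matrices at
these changes shows that the restrictions of the computed polynomial to an initial segment span a
space of dimension at most `w ^ K`. An interval is a difference of two initial segments, so `w ^ (2
* K)` bounds the dimension for intervals (`ObliviousABP.restrSpace_le_span`, `switchRun_interval`).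
Low dimension on intervals is all that a generator of the kind used for read-once programs needs. It
is built along the binary tree of dyadic intervals of `Y`. If one curve hits each half of an
interval, then its values at `α, α ^ 2, ..., α ^ R` suffice for both halves, for all but few `α`;
this is a generalized Vandermonde determinant (`exists_condenser`). A new curve interpolates the `R
* R` pairs of such values. Thus a level costs one seed, shared by all its intervals, and about `log
|Y|` seeds serve `Y` (`exists_seeds`).

In a read-`k` order, every set of `m` variables contains such a `Y` with about `m ^ (1 / 2 ^ (k -
1))` elements. Applying the Erdős–Szekeres theorem `k - 1` times makes every read monotone with
respect to the first one. One further halving for each pair of reads makes the crossing of the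
intervals between the two reads transitive (`exists_regular`). Ordered by first reads, the initial
segments of the resulting set are read in at most `2 * k + 2` blocks (`Regular.switchRun_le`).
Removing such sets one after another leaves at most `2 ^ (k * k + 1) * n ^ (1 - 1 / 2 ^ (k - 1))`
classes, by a potential argument (`classes_potential_step`). Starting from any point where the
polynomial is not zero, the classes are moved to generator points one at a time
(`exists_seeds_genPoint`). The number of points is `E` to the total number of seeds.

The classes need not be found cleverly. All lists of at most about `√n` variables are tried, and the
number of blocks is checked directly. For `k ≥ 2` the cap on the length does no harm, and the number
of lists is within the bound; for `k = 1` all variables form one class. The programs are verified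
with a small Hoare logic in which costs are recorded as powers of one large number `X`. -/

/-! ### Condensing a space of univariate polynomials -/

open Polynomial in
/-- A finite-dimensional space of polynomials has a basis of pairwise different degrees. -/
theorem exists_strictMono_natDegree {F : Type*} [Field F] (s : ℕ) :
    ∀ (U : Submodule F F[X]), FiniteDimensional F U → Module.finrank F U = s →
      ∃ b : Fin s → F[X], (∀ i, b i ∈ U) ∧ (∀ i, b i ≠ 0) ∧ StrictMono (fun i => (b i).natDegree) ∧
        U ≤ Submodule.span F (Set.range b) := by
  induction s with
  | zero =>
    intro U _ hU
    have hbot : U = ⊥ := Submodule.finrank_eq_zero.mp hU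
    exact ⟨Fin.elim0, fun i => i.elim0, fun i => i.elim0, fun i => i.elim0, by simp [hbot]⟩
  | succ s ih =>
    intro U hfd hU
    obtain ⟨D, hD⟩ : ∃ D, ∀ p ∈ U, p.natDegree ≤ D := by
      obtain ⟨T, hT⟩ := (Module.Finite.iff_fg.mp hfd)
      refine ⟨T.sup natDegree, fun p hp => ?_⟩
      rw [← hT] at hp
      have : Submodule.span F (T : Set F[X]) ≤ degreeLE F (T.sup natDegree : ℕ) := by
        rw [Submodule.span_le]
        intro q hq
        rw [SetLike.mem_coe, mem_degreeLE]
        exact natDegree_le_iff_degree_le.mp (Finset.le_sup (f := natDegree) hq)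
      exact natDegree_le_iff_degree_le.mpr (mem_degreeLE.mp (this hp))
    have hne : ∃ p ∈ U, p ≠ 0 := by
      by_contra! h
      have : U = ⊥ := by rw [eq_bot_iff]; intro p hp; simpa using h p hp
      rw [this, finrank_bot] at hU
      omega
    classical
    -- Minimizing `D - p.natDegree` picks an element `g` of maximal degree, which becomes the last
    -- element of the basis.
    have hex : ∃ m, ∃ p ∈ U, p ≠ 0 ∧ D - p.natDegree = m := by
      obtain ⟨p, hp, h0⟩ := hne
      exact ⟨_, p, hp, h0, rfl⟩
    obtain ⟨g, hgU, hg0, hgm⟩ := Nat.find_spec hex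
    have hmax : ∀ p ∈ U, p.natDegree ≤ g.natDegree := by
      intro p hp
      by_cases h0 : p = 0
      · simp [h0]
      · have := Nat.find_min' hex ⟨p, hp, h0, rfl⟩
        have h1 := hD p hp
        have h2 := hD g hgU
        omega
    set e := g.natDegree with he
    -- A hyperplane of `U`; as `e` is the maximal degree in `U`, its nonzero elements have degree
    -- less than `e`.
    let V : Submodule F F[X] := U ⊓ LinearMap.ker (lcoeff F e)
    have hVU : V ≤ U := inf_le_left
    have : FiniteDimensional F V := Submodule.finiteDimensional_of_le hVU
    have hUV : U ≤ V ⊔ Submodule.span F {g} := by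
      intro p hp
      have hlc : g.coeff e ≠ 0 := by rw [he]; exact leadingCoeff_ne_zero.mpr hg0
      rw [Submodule.mem_sup]
      refine ⟨p - (p.coeff e / g.coeff e) • g, ⟨?_, ?_⟩, (p.coeff e / g.coeff e) • g, ?_, by abel⟩
      · exact U.sub_mem hp (U.smul_mem _ hgU)
      · simp [lcoeff_apply, hlc]
      · exact Submodule.smul_mem _ _ (Submodule.mem_span_singleton_self g)
    have hVlt : V < U := by
      refine lt_of_le_of_ne hVU fun h => ?_
      have : g ∈ V := h ▸ hgU
      have h2 : g.coeff e = 0 := by simpa [lcoeff_apply] using this.2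
      exact leadingCoeff_ne_zero.mpr hg0 h2
    have hfin : Module.finrank F V = s := by
      have h1 := Submodule.finrank_lt_finrank_of_lt hVlt
      have h2 : Module.finrank F U ≤ Module.finrank F ↥(V ⊔ Submodule.span F {g}) :=
        Submodule.finrank_mono hUV
      have h3 := Submodule.finrank_add_le_finrank_add_finrank V (Submodule.span F {g})
      rw [finrank_span_singleton hg0] at h3
      omega
    obtain ⟨b, hbV, hb0, hbm, hbs⟩ := ih V inferInstance hfin
    refine ⟨Fin.snoc b g, ?_, ?_, ?_, ?_⟩
    · intro i
      refine Fin.lastCases ?_ (fun i => ?_) i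
      · simpa using hgU
      · simpa using hVU (hbV i)
    · intro i
      refine Fin.lastCases ?_ (fun i => ?_) i
      · simpa using hg0
      · simpa using hb0 i
    · have hlt : ∀ i, (b i).natDegree < e := by
        intro i
        refine lt_of_le_of_ne (hmax _ (hVU (hbV i))) fun h => ?_
        have h2 : (b i).coeff e = 0 := by simpa [lcoeff_apply] using (hbV i).2
        rw [← h] at h2
        exact leadingCoeff_ne_zero.mpr (hb0 i) h2
      intro i j
      refine Fin.lastCases ?_ (fun i => ?_) i <;> refine Fin.lastCases ?_ (fun j => ?_) j
      · intro h; exact absurd h (lt_irrefl _)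
      · intro h; exact absurd h (not_lt.mpr (Fin.le_last _))
      · intro _; simpa using hlt i
      · intro h; simpa using hbm (Fin.castSucc_lt_castSucc_iff.mp h)
    · refine hUV.trans (sup_le (hbs.trans (Submodule.span_mono ?_)) ?_)
      · rintro _ ⟨i, rfl⟩
        exact ⟨i.castSucc, by simp⟩
      · rw [Submodule.span_singleton_le_iff_mem]
        exact Submodule.subset_span ⟨Fin.last s, by simp⟩

open Polynomial in
/-- The generalized Vandermonde determinant of polynomials of different degrees is not zero. -/
theorem det_expand_ne_zero {F : Type*} [Field F] {s : ℕ} (b : Fin s → F[X]) (h0 : ∀ i, b i ≠ 0)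
    (hb : StrictMono fun i => (b i).natDegree) :
    (Matrix.of fun i j : Fin s => expand F ((j : ℕ) + 1) (b i)).det ≠ 0 := by
  intro hdet
  -- The degree of the diagonal product. Degrees and exponents both increase, so by the
  -- rearrangement inequality every other permutation contributes a product of smaller degree, and
  -- the coefficient at `N` is a product of leading coefficients.
  set N := ∑ i : Fin s, (b i).natDegree * ((i : ℕ) + 1) with hN
  have hprod : ∀ τ : Equiv.Perm (Fin s),
      (∏ i, expand F (((τ i : Fin s) : ℕ) + 1) (b i)).natDegree =
        ∑ i, (b i).natDegree * ((τ i : ℕ) + 1) := by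
    intro τ
    rw [natDegree_prod]
    · exact Finset.sum_congr rfl fun i _ => natDegree_expand _ _
    · intro i _
      exact (expand_ne_zero (Nat.succ_pos _)).mpr (h0 i)
  have hcoeff := congrArg (fun p => coeff p N) hdet
  rw [← Matrix.det_transpose, Matrix.det_apply'] at hcoeff
  simp only [finsetSum_coeff, coeff_zero] at hcoeff
  rw [Finset.sum_eq_single (1 : Equiv.Perm (Fin s))] at hcoeff
  · have h1 := hprod 1
    simp only [Equiv.Perm.coe_one, id_eq] at h1
    rw [← hN] at h1
    simp only [Equiv.Perm.sign_one, Units.val_one, Int.cast_one, one_mul,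
      Equiv.Perm.coe_one, id_eq, Matrix.transpose_apply, Matrix.of_apply] at hcoeff
    rw [← h1, coeff_natDegree, leadingCoeff_prod, Finset.prod_eq_zero_iff] at hcoeff
    obtain ⟨i, _, hi⟩ := hcoeff
    rw [leadingCoeff_eq_zero, expand_eq_zero (Nat.succ_pos _)] at hi
    exact h0 i hi
  · intro τ _ hτ
    have hlt : ∑ i, (b i).natDegree * ((τ i : ℕ) + 1) < N := by
      have hmono : Monovary (fun i : Fin s => (b i).natDegree) (fun i : Fin s => (i : ℕ) + 1) := by
        intro i j hij
        exact (hb.monotone (by have : (i : ℕ) < j := by simpa using hij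
                               exact Fin.le_def.mpr this.le))
      -- Equality in the rearrangement inequality would force `τ` to be monotone, and the identity
      -- is the only monotone permutation of `Fin s`.
      refine (hmono.sum_mul_comp_perm_lt_sum_mul_iff).mpr fun hm => hτ ?_
      have hsm : StrictMono τ := by
        have hmo : Monotone τ := by
          intro i j hij
          rcases hij.eq_or_lt with rfl | hlt
          · exact le_rfl
          · by_contra! hlt2
            have := hm (show ((fun i : Fin s => (i : ℕ) + 1) ∘ τ) j <
              ((fun i : Fin s => (i : ℕ) + 1) ∘ τ) i by simpa using hlt2)
            exact absurd (hb hlt) (not_lt.mpr this)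
        exact hmo.strictMono_of_injective τ.injective
      ext i
      have := (hsm.orderIsoOfSurjective _ τ.surjective)
      have h2 : (StrictMono.orderIsoOfSurjective τ hsm τ.surjective) = OrderIso.refl _ :=
        Subsingleton.elim _ _
      have h3 := congrArg (fun f => f i) h2
      simpa using congrArg Fin.val h3
    have hz : (∏ i, expand F (((τ i : Fin s) : ℕ) + 1) (b i)).coeff N = 0 :=
      coeff_eq_zero_of_natDegree_lt (by rw [hprod]; exact hlt)
    simp only [Matrix.transpose_apply, Matrix.of_apply]
    rcases Int.units_eq_one_or (Equiv.Perm.sign τ) with h | h <;> rw [h] <;> simp [hz]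
  · simp

open Polynomial in
/-- For all but few `α`, the powers `α, α ^ 2, …, α ^ R` meet the support of every nonzero polynomial
of a given space of dimension at most `R`. -/
theorem exists_condenser {F : Type*} [Field F] (U : Submodule F F[X]) [FiniteDimensional F U]
    {R D : ℕ} (hR : Module.finrank F U ≤ R) (hD : ∀ p ∈ U, p.natDegree ≤ D) :
    ∃ Δ : F[X], Δ ≠ 0 ∧ Δ.natDegree ≤ R * (R * D) ∧ ∀ α, Δ.eval α ≠ 0 →
      ∀ g ∈ U, g ≠ 0 → ∃ l < R, g.eval (α ^ (l + 1)) ≠ 0 := by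
  obtain ⟨b, hbU, hb0, hbm, hbs⟩ := exists_strictMono_natDegree _ U inferInstance rfl
  -- `Δ` is the determinant with the entries `b i (X ^ (j + 1))`: at most `R` factors in each
  -- product, each of degree at most `R * D`.
  refine ⟨_, det_expand_ne_zero b hb0 hbm, ?_, ?_⟩
  · rw [Matrix.det_apply']
    refine natDegree_sum_le_of_forall_le _ _ fun τ _ => ?_
    have h1 : (∏ i, (Matrix.of fun i j : Fin _ => expand F ((j : ℕ) + 1) (b i)) (τ i) i).natDegree
        ≤ R * (R * D) := by
      refine (natDegree_prod_le _ _).trans ?_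
      calc ∑ i, ((Matrix.of fun i j : Fin _ => expand F ((j : ℕ) + 1) (b i)) (τ i) i).natDegree
          ≤ ∑ _i : Fin (Module.finrank F U), R * D := by
            refine Finset.sum_le_sum fun i _ => ?_
            rw [Matrix.of_apply, natDegree_expand, mul_comm]
            exact Nat.mul_le_mul (by have := i.2; omega) (hD _ (hbU _))
        _ ≤ R * (R * D) := by
            rw [Finset.sum_const, Finset.card_univ, Fintype.card_fin, smul_eq_mul]
            exact Nat.mul_le_mul_right _ hR
    rcases Int.units_eq_one_or (Equiv.Perm.sign τ) with h | h <;> rw [h] <;> simpa using h1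
  · intro α hα g hg hg0
    by_contra! hz
    obtain ⟨c, hc⟩ := (Submodule.mem_span_range_iff_exists_fun F).mp (hbs hg)
    set M : Matrix (Fin (Module.finrank F U)) (Fin (Module.finrank F U)) F :=
      Matrix.of fun i j => (b i).eval (α ^ ((j : ℕ) + 1)) with hM
    have hdet : M.det ≠ 0 := by
      have : M = (evalRingHom α).mapMatrix
          (Matrix.of fun i j : Fin (Module.finrank F U) => expand F ((j : ℕ) + 1) (b i)) := by
        ext i j
        simp [hM, expand_eval]
      rw [this, ← RingHom.map_det]
      exact hα
    -- If `g` vanished at all these powers, its coefficient vector would be in the left kernel of an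
    -- invertible matrix.
    have hv : Matrix.vecMul c M = 0 := by
      ext j
      have := hz j (lt_of_lt_of_le j.2 hR)
      rw [← hc, eval_finsetSum] at this
      simpa [Matrix.vecMul, dotProduct, hM, eval_smul] using this
    have hc0 := Matrix.eq_zero_of_vecMul_eq_zero hdet hv
    apply hg0
    rw [← hc]
    simp [hc0]


/-! ### The generator for sets whose intervals have small restriction spaces -/

section Generator

open Polynomial

variable {F : Type*} [Field F] {V : Type*} [DecidableEq V]

/-- The Lagrange basis polynomial number `i` for the nodes `β 0, …, β (N - 1)`. -/
noncomputable def lagr (β : ℕ → F) (N i : ℕ) : F[X] :=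
  ∏ j ∈ (Finset.range N).erase i, (X - C (β j)) * C ((β i - β j)⁻¹)

theorem eval_lagr (β : ℕ → F) (N i : ℕ) (u : F) :
    (lagr β N i).eval u = ∏ j ∈ (Finset.range N).erase i, (u - β j) * (β i - β j)⁻¹ := by
  simp [lagr, eval_prod]

theorem eval_lagr_node {β : ℕ → F} {N i j : ℕ} (hβ : Set.InjOn β (Set.Iio N)) (hi : i < N)
    (hj : j < N) : (lagr β N i).eval (β j) = if i = j then 1 else 0 := by
  rw [eval_lagr]
  split_ifs with h
  · subst h
    refine Finset.prod_eq_one fun l hl => ?_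
    rw [Finset.mem_erase, Finset.mem_range] at hl
    exact mul_inv_cancel₀ (sub_ne_zero.mpr fun h => hl.1 (hβ hl.2 hi h.symm))
  · exact Finset.prod_eq_zero (Finset.mem_erase.mpr ⟨Ne.symm h, Finset.mem_range.mpr hj⟩) (by simp)

theorem natDegree_lagr_le (β : ℕ → F) (N i : ℕ) : (lagr β N i).natDegree ≤ N := by
  refine (natDegree_prod_le _ _).trans ?_
  calc _ ≤ ∑ _j ∈ (Finset.range N).erase i, 1 := by
        refine Finset.sum_le_sum fun j _ => ?_
        exact (natDegree_mul_C_le _ _).trans (natDegree_X_sub_C_le _)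
    _ ≤ N := by
        rw [Finset.sum_const, smul_eq_mul, mul_one]
        exact (Finset.card_erase_le).trans (by simp)

/-- The coordinate with index `a` of the generator curve of level `j`. -/
noncomputable def curve (β : ℕ → F) (R : ℕ) (α : ℕ → F) : ℕ → ℕ → F[X]
  | 0, _ => X
  -- The node number `i = l * R + m` encodes a pair of exponents. Bit `j` of the position tells the
  -- half of the dyadic interval, and hence whether `l` or `m` is used, so the two halves get
  -- independent points of the previous curve.
  | j + 1, a => ∑ i ∈ Finset.range (R * R), lagr β (R * R) i *
      C ((curve β R α j a).eval (α j ^ ((if a / 2 ^ j % 2 = 0 then i / R else i % R) + 1)))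

theorem natDegree_curve_le (β : ℕ → F) {R : ℕ} (hR : 1 ≤ R) (α : ℕ → F) (j a : ℕ) :
    (curve β R α j a).natDegree ≤ R * R := by
  cases j with
  | zero => exact natDegree_X_le.trans (Nat.mul_pos hR hR)
  | succ j =>
    refine natDegree_sum_le_of_forall_le _ _ fun i _ => ?_
    exact (natDegree_mul_C_le _ _).trans (natDegree_lagr_le _ _ _)

/-- The curve of level `j` uses only the seeds before `j`, so later seeds can be chosen without
spoiling earlier choices. -/
theorem curve_congr (β : ℕ → F) (R : ℕ) {α α' : ℕ → F} (j a : ℕ) (h : ∀ i < j, α i = α' i) :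
    curve β R α j a = curve β R α' j a := by
  induction j with
  | zero => rfl
  | succ j ih =>
    simp only [curve]
    rw [ih fun i hi => h i (by omega), h j (by omega)]

theorem eval_curve_succ_node {β : ℕ → F} {R : ℕ} (hβ : Set.InjOn β (Set.Iio (R * R))) (α : ℕ → F)
    (j a : ℕ) {l m : ℕ} (hl : l < R) (hm : m < R) :
    (curve β R α (j + 1) a).eval (β (l * R + m)) =
      (curve β R α j a).eval (α j ^ ((if a / 2 ^ j % 2 = 0 then l else m) + 1)) := by
  have hlt : l * R + m < R * R := by nlinarith
  simp only [curve, eval_finsetSum, eval_mul, eval_C]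
  rw [Finset.sum_eq_single (l * R + m)]
  · rw [eval_lagr_node hβ hlt hlt, if_pos rfl, one_mul]
    rw [show (l * R + m) / R = l by
      rw [mul_comm, Nat.mul_add_div (by omega), Nat.div_eq_of_lt hm, add_zero],
      show (l * R + m) % R = m by rw [mul_comm, Nat.mul_add_mod, Nat.mod_eq_of_lt hm]]
  · intro i hi hne
    rw [eval_lagr_node hβ (Finset.mem_range.mp hi) hlt, if_neg hne, zero_mul]
  · intro h
    exact absurd (Finset.mem_range.mpr hlt) h

/-- The substitution of constants for the variables outside `S`. -/
noncomputable def fixOff (S : Finset V) (c : V → F) : V → MvPolynomial V F :=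
  fun v => if v ∈ S then MvPolynomial.X v else MvPolynomial.C (c v)

/-- The space spanned by the restrictions of `f` to the variables in `S`, where the variables outside
of `Y` have the fixed values `c₀`. -/
noncomputable def restrSpace (Y : Finset V) (c₀ : V → F) (f : MvPolynomial V F) (S : Finset V) :
    Submodule F (MvPolynomial V F) :=
  Submodule.span F (Set.range fun c : V → F =>
    MvPolynomial.aeval (fixOff S (Y.piecewise c c₀)) f)

theorem aeval_aeval_eq {A : Type*} [CommRing A] [Algebra F A] (Γ : V → A)
    (Δ : V → MvPolynomial V F) (f : MvPolynomial V F) :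
    MvPolynomial.aeval Γ (MvPolynomial.aeval Δ f) =
      MvPolynomial.aeval (fun v => MvPolynomial.aeval Γ (Δ v)) f := by
  induction f using MvPolynomial.induction_on with
  | C a => simp
  | add p q hp hq => rw [map_add, map_add, hp, hq, map_add]
  | mul_X p v hp => rw [map_mul, map_mul, hp, map_mul, MvPolynomial.aeval_X, MvPolynomial.aeval_X]

theorem eval_aeval_fixOff (S : Finset V) (c y : V → F) (g : MvPolynomial V F) :
    MvPolynomial.eval y (MvPolynomial.aeval (fixOff S c) g) =
      MvPolynomial.eval (S.piecewise y c) g := by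
  rw [← MvPolynomial.coe_aeval_eq_eval, ← MvPolynomial.coe_aeval_eq_eval, RingHom.coe_coe,
    RingHom.coe_coe, aeval_aeval_eq]
  congr 2
  funext v
  by_cases h : v ∈ S <;> simp [fixOff, h]

/-- The variables outside `S` no longer occur in `g`, so further fixing amounts to restricting `f`
at the assignment that takes `x` on `S` and the old constants elsewhere. -/
theorem aeval_fixOff_mem {Y S S' : Finset V} (hS : S ⊆ Y) (hS' : S' ⊆ S) {c₀ : V → F}
    {f g : MvPolynomial V F} (hg : g ∈ restrSpace Y c₀ f S) (x : V → F) :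
    MvPolynomial.aeval (fixOff S' x) g ∈ restrSpace Y c₀ f S' := by
  rw [restrSpace] at hg
  induction hg using Submodule.span_induction with
  | mem g hg =>
    obtain ⟨c, rfl⟩ := hg
    refine Submodule.subset_span ⟨S.piecewise x c, ?_⟩
    simp only []
    rw [aeval_aeval_eq]
    congr 2
    funext v
    by_cases h' : v ∈ S'
    · simp [fixOff, h', hS' h']
    · by_cases h : v ∈ S
      · simp [fixOff, h', h, hS h]
      · by_cases hY : v ∈ Y <;> simp [fixOff, h', h, hY]
  | zero => rw [map_zero]; exact zero_mem _
  | add a b _ _ ha hb => rw [map_add]; exact add_mem ha hb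
  | smul r a _ ha => rw [map_smul]; exact Submodule.smul_mem _ _ ha

theorem eval_congr_of_mem_restrSpace {Y S : Finset V} {c₀ : V → F} {f g : MvPolynomial V F}
    (hg : g ∈ restrSpace Y c₀ f S) {x y : V → F} (h : ∀ v ∈ S, x v = y v) :
    MvPolynomial.eval x g = MvPolynomial.eval y g := by
  rw [restrSpace] at hg
  induction hg using Submodule.span_induction with
  | mem g hg =>
    obtain ⟨c, rfl⟩ := hg
    simp only [eval_aeval_fixOff]
    congr 2
    ext v
    by_cases hv : v ∈ S <;> simp [hv, h]
  | zero => simp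
  | add a b _ _ ha hb => simp [ha, hb]
  | smul r a _ ha => simp [MvPolynomial.smul_eval, ha]

theorem eval_aeval_curve (Γ : V → F[X]) (u : F) (g : MvPolynomial V F) :
    (MvPolynomial.aeval Γ g).eval u = MvPolynomial.eval (fun v => (Γ v).eval u) g := by
  induction g using MvPolynomial.induction_on with
  | C a => simp
  | add p q hp hq => simp [hp, hq]
  | mul_X p v hp => simp [hp]

theorem natDegree_aeval_le_of_mem {Y S : Finset V} {c₀ : V → F} {f g : MvPolynomial V F}
    {δ N : ℕ} (hf : f.totalDegree ≤ δ)
    (hg : g ∈ restrSpace Y c₀ f S) {Γ : V → F[X]} (hΓ : ∀ v, (Γ v).natDegree ≤ N) :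
    (MvPolynomial.aeval Γ g).natDegree ≤ δ * N := by
  rw [restrSpace] at hg
  induction hg using Submodule.span_induction with
  | mem g hg =>
    obtain ⟨c, rfl⟩ := hg
    rw [aeval_aeval_eq]
    refine MvPolynomial.aeval_natDegree_le _ hf _ fun v => ?_
    by_cases h : v ∈ S
    · simpa [fixOff, h] using hΓ v
    · simp [fixOff, h]
  | zero => simp
  | add a b _ _ ha hb =>
    rw [map_add]
    exact (natDegree_add_le _ _).trans (max_le ha hb)
  | smul r a _ ha =>
    rw [map_smul]
    exact (natDegree_smul_le _ _).trans ha

/-- The variables in `Y` whose position belongs to the dyadic interval number `c` of level `j`. -/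
def dyadic (Y : Finset V) (ps : V → ℕ) (j c : ℕ) : Finset V := Y.filter fun v => ps v / 2 ^ j = c

theorem exists_index_eval_ne_zero {β : ℕ → F} {E : ℕ} (hβ : Set.InjOn β (Set.Iio E)) {p : F[X]}
    (hp : p ≠ 0) (hE : p.natDegree < E) : ∃ i < E, p.eval (β i) ≠ 0 := by
  classical
  by_contra! h
  have hsub : (Finset.range E).image β ⊆ p.roots.toFinset := by
    intro y hy
    obtain ⟨i, hi, rfl⟩ := Finset.mem_image.mp hy
    rw [Multiset.mem_toFinset, mem_roots hp]
    exact h i (Finset.mem_range.mp hi)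
  have h1 := Finset.card_le_card hsub
  rw [Finset.card_image_of_injOn (by simpa [Set.Iio_def] using hβ), Finset.card_range] at h1
  have h2 := (Multiset.toFinset_card_le p.roots).trans (card_roots' p)
  omega

/-- Induction along the binary tree of dyadic intervals. One seed serves all intervals of a level:
each of them excludes only the roots of its condenser polynomial, and the product of these
polynomials still has degree less than `E`. Nonvanishing is stated at points, so that the two halves
of an interval can be replaced one after the other. -/
theorem exists_seeds_level {β : ℕ → F} {E R J δ : ℕ} (hβ : Set.InjOn β (Set.Iio E)) (hR : 1 ≤ R)
    (hRE : R * R ≤ E) (hE : 2 ^ J * (R * (R * (δ * (R * R)))) < E) {Y : Finset V} {ps : V → ℕ}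
    (hps : Set.InjOn ps Y) {c₀ : V → F} {f : MvPolynomial V F} (hf : f.totalDegree ≤ δ)
    (hrank : ∀ j c, ∃ T : Finset (MvPolynomial V F), T.card ≤ R ∧
      restrSpace Y c₀ f (dyadic Y ps j c) ≤ Submodule.span F (T : Set (MvPolynomial V F)))
    (j : ℕ) (hj : j ≤ J) :
    ∃ e : ℕ → ℕ, (∀ i, e i < E) ∧ ∀ c < 2 ^ (J - j), ∀ g ∈ restrSpace Y c₀ f (dyadic Y ps j c),
      ∀ x, MvPolynomial.eval x g ≠ 0 →
        ∃ u, MvPolynomial.eval (fun v => (curve β R (fun i => β (e i)) j (ps v)).eval u) g ≠ 0 := by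
  classical
  induction j with
  | zero =>
    refine ⟨fun _ => 0, fun _ => (Nat.zero_le _).trans_lt hE, fun c _ g hg x hx => ?_⟩
    -- An interval of level `0` has at most one variable, and the identity curve takes the required
    -- value `x v`.
    by_cases h : ∃ v, v ∈ dyadic Y ps 0 c
    · obtain ⟨v, hv⟩ := h
      refine ⟨x v, ?_⟩
      rw [eval_congr_of_mem_restrSpace hg (y := x)]
      · exact hx
      · intro v' hv'
        simp only [dyadic, pow_zero, Nat.div_one, Finset.mem_filter] at hv hv'
        have : v' = v := hps hv'.1 hv.1 (hv'.2.trans hv.2.symm)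
        simp [curve, this]
    · refine ⟨0, ?_⟩
      rw [eval_congr_of_mem_restrSpace hg (y := x)]
      · exact hx
      · exact fun v hv => absurd ⟨v, hv⟩ h
  | succ j ih =>
    obtain ⟨e, heE, he⟩ := ih (by omega)
    set Γ : V → F[X] := fun v => curve β R (fun i => β (e i)) j (ps v) with hΓ
    have hΓd : ∀ v, (Γ v).natDegree ≤ R * R := fun v => natDegree_curve_le _ hR _ _ _
    have hcond : ∀ c, ∃ Δ : F[X], Δ ≠ 0 ∧ Δ.natDegree ≤ R * (R * (δ * (R * R))) ∧
        ∀ α, Δ.eval α ≠ 0 → ∀ g ∈ restrSpace Y c₀ f (dyadic Y ps j c),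
          MvPolynomial.aeval Γ g ≠ 0 → ∃ l < R, (MvPolynomial.aeval Γ g).eval (α ^ (l + 1)) ≠ 0 := by
      intro c
      obtain ⟨T, hT, hTs⟩ := hrank j c
      -- Substituting the curve is linear, so the univariate images still span a space of dimension
      -- at most `R`, now with degrees at most `δ * (R * R)`.
      set U := (restrSpace Y c₀ f (dyadic Y ps j c)).map (MvPolynomial.aeval Γ).toLinearMap with hU
      have hUle : U ≤ Submodule.span F
          ((T.image (MvPolynomial.aeval Γ : MvPolynomial V F →ₐ[F] F[X]) : Finset F[X]) :
            Set F[X]) := by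
        rw [hU, Finset.coe_image]
        refine (Submodule.map_mono hTs).trans ?_
        rw [Submodule.map_span]
        exact le_rfl
      have : FiniteDimensional F U := Submodule.finiteDimensional_of_le hUle
      have hfr : Module.finrank F U ≤ R :=
        (Submodule.finrank_mono hUle).trans
          ((finrank_span_finset_le_card _).trans (Finset.card_image_le.trans hT))
      have hdeg : ∀ p ∈ U, p.natDegree ≤ δ * (R * R) := by
        rintro _ ⟨g, hg, rfl⟩
        exact natDegree_aeval_le_of_mem hf hg hΓd
      obtain ⟨Δ, h0, hd, hα⟩ := exists_condenser U hfr hdeg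
      exact ⟨Δ, h0, hd, fun α h g hg => hα α h _ ⟨g, hg, rfl⟩⟩
    choose Δ hΔ0 hΔd hΔ using hcond
    -- A common seed that is a root of none of the condenser polynomials of this level.
    obtain ⟨i₀, hi₀, hev⟩ := exists_index_eval_ne_zero hβ
      (p := ∏ c ∈ Finset.range (2 ^ J), Δ c) (Finset.prod_ne_zero_iff.mpr fun c _ => hΔ0 c) (by
        refine lt_of_le_of_lt ((natDegree_prod_le _ _).trans ?_) hE
        refine (Finset.sum_le_sum fun c _ => hΔd c).trans ?_
        simp)
    rw [eval_prod, Finset.prod_ne_zero_iff] at hev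
    refine ⟨Function.update e j i₀, fun i => ?_, fun c hc g hg x hx => ?_⟩
    · by_cases h : i = j
      · simp [h, hi₀]
      · simpa [h] using heE i
    have hcJ : 2 ^ (J - j) = 2 * 2 ^ (J - (j + 1)) := by
      rw [← pow_succ']
      congr 1
      omega
    have hpowle : 2 ^ (J - j) ≤ 2 ^ J := Nat.pow_le_pow_right (by norm_num) (by omega)
    set S := dyadic Y ps (j + 1) c with hS
    set S₁ := dyadic Y ps j (2 * c) with hS₁
    set S₂ := dyadic Y ps j (2 * c + 1) with hS₂
    have hSY : S ⊆ Y := Finset.filter_subset _ _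
    have hdiv : ∀ v, ps v / 2 ^ (j + 1) = ps v / 2 ^ j / 2 := fun v => by
      rw [pow_succ, Nat.div_div_eq_div_mul]
    have hS₁S : S₁ ⊆ S := by
      intro v hv
      simp only [hS, hS₁, dyadic, Finset.mem_filter] at hv ⊢
      exact ⟨hv.1, by rw [hdiv, hv.2]; omega⟩
    have hS₂S : S₂ ⊆ S := by
      intro v hv
      simp only [hS, hS₂, dyadic, Finset.mem_filter] at hv ⊢
      exact ⟨hv.1, by rw [hdiv, hv.2]; omega⟩
    have hbit₁ : ∀ v ∈ S₁, ps v / 2 ^ j % 2 = 0 := by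
      intro v hv
      simp only [hS₁, dyadic, Finset.mem_filter] at hv
      omega
    have hbit₂ : ∀ v ∈ S₂, ps v / 2 ^ j % 2 = 1 := by
      intro v hv
      simp only [hS₂, dyadic, Finset.mem_filter] at hv
      omega
    have hcover : ∀ v ∈ S, v ∈ S₁ ∨ v ∈ S₂ := by
      intro v hv
      simp only [hS, hS₁, hS₂, dyadic, Finset.mem_filter] at hv ⊢
      have := hdiv v
      rcases Nat.mod_two_eq_zero_or_one (ps v / 2 ^ j) with h | h
      · exact Or.inl ⟨hv.1, by omega⟩
      · exact Or.inr ⟨hv.1, by omega⟩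
    -- a seed that works for one node of level `j`
    have key : ∀ c' < 2 ^ (J - j), ∀ g' ∈ restrSpace Y c₀ f (dyadic Y ps j c'), ∀ y,
        MvPolynomial.eval y g' ≠ 0 → ∃ l < R,
          MvPolynomial.eval (fun v => (Γ v).eval (β i₀ ^ (l + 1))) g' ≠ 0 := by
      intro c' hc' g' hg' y hy
      obtain ⟨u, hu⟩ := he c' hc' g' hg' y hy
      have hne : MvPolynomial.aeval Γ g' ≠ 0 := by
        intro h0
        apply hu
        rw [← eval_aeval_curve, h0, eval_zero]
      obtain ⟨l, hl, hle⟩ := hΔ c' (β i₀) (hev c' (Finset.mem_range.mpr (by omega))) g' hg' hne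
      exact ⟨l, hl, by rwa [eval_aeval_curve] at hle⟩
    -- The left half is moved to the curve while everything else stays at `x`. Then the left half is
    -- frozen at its new values and the right half is moved.
    have hg₁ := aeval_fixOff_mem hSY hS₁S hg x
    obtain ⟨l, hl, h₁⟩ := key (2 * c) (by omega) _ hg₁ x (by
      rwa [eval_aeval_fixOff, Finset.piecewise_same])
    rw [eval_aeval_fixOff] at h₁
    set z : V → F := S₁.piecewise (fun v => (Γ v).eval (β i₀ ^ (l + 1))) x with hz
    have hg₂ := aeval_fixOff_mem hSY hS₂S hg z
    obtain ⟨m, hm, h₂⟩ := key (2 * c + 1) (by omega) _ hg₂ z (by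
      rwa [eval_aeval_fixOff, Finset.piecewise_same])
    rw [eval_aeval_fixOff] at h₂
    -- The node that encodes the pair of exponents found for the two halves.
    refine ⟨β (l * R + m), ?_⟩
    rw [eval_congr_of_mem_restrSpace hg (y := _)]
    · exact h₂
    · intro v hv
      rw [eval_curve_succ_node (hβ.mono (Set.Iio_subset_Iio hRE)) _ _ _ hl hm]
      rw [Function.update_self]
      have hcc : curve β R (fun i => β (Function.update e j i₀ i)) j (ps v) = Γ v :=
        curve_congr _ _ _ _ fun i hi => by rw [Function.update_of_ne (by omega)]
      rw [hcc]
      by_cases hv₂ : v ∈ S₂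
      · simp [hv₂, hbit₂ v hv₂]
      · have hv₁ : v ∈ S₁ := (hcover v hv).resolve_right hv₂
        simp [hv₂, hv₁, hz, hbit₁ v hv₁]

/-- The generator curve of level `J` hits `f`, with the variables outside of `Y` fixed. -/
theorem exists_seeds {β : ℕ → F} {E R J δ : ℕ} (hβ : Set.InjOn β (Set.Iio E)) (hR : 1 ≤ R)
    (hRE : R * R ≤ E) (hE : 2 ^ J * (R * (R * (δ * (R * R)))) < E) {Y : Finset V} {ps : V → ℕ}
    (hps : Set.InjOn ps Y) (hpJ : ∀ v ∈ Y, ps v < 2 ^ J) {c₀ : V → F} {f : MvPolynomial V F}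
    (hf : f.totalDegree ≤ δ)
    (hrank : ∀ j c, ∃ T : Finset (MvPolynomial V F), T.card ≤ R ∧
      restrSpace Y c₀ f (dyadic Y ps j c) ≤ Submodule.span F (T : Set (MvPolynomial V F)))
    (hc₀ : MvPolynomial.eval c₀ f ≠ 0) :
    ∃ e : ℕ → ℕ, (∀ i, e i < E) ∧ MvPolynomial.eval (Y.piecewise
      (fun v => (curve β R (fun i => β (e i)) J (ps v)).eval (β (e J))) c₀) f ≠ 0 := by
  obtain ⟨e, heE, he⟩ := exists_seeds_level hβ hR hRE hE hps hf hrank J le_rfl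
  have hY : dyadic Y ps J 0 = Y := by
    refine Finset.filter_true_of_mem fun v hv => ?_
    exact Nat.div_eq_of_lt (hpJ v hv)
  have hg : MvPolynomial.aeval (fixOff Y c₀) f ∈ restrSpace Y c₀ f (dyadic Y ps J 0) := by
    refine Submodule.subset_span ⟨c₀, ?_⟩
    simp only [hY, Finset.piecewise_same]
  obtain ⟨u, hu⟩ := he 0 (by positivity) _ hg c₀ (by
    rwa [eval_aeval_fixOff, Finset.piecewise_same])
  set Γ : V → F[X] := fun v => curve β R (fun i => β (e i)) J (ps v) with hΓ
  have hne : MvPolynomial.aeval Γ (MvPolynomial.aeval (fixOff Y c₀) f) ≠ 0 := by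
    intro h0
    apply hu
    rw [← eval_aeval_curve, h0, eval_zero]
  have hdeg := natDegree_aeval_le_of_mem hf hg (Γ := Γ) fun v => natDegree_curve_le _ hR _ _ _
  -- The parameter on the curve is also chosen from the listing and stored as seed `J`, which the
  -- curve of level `J` itself does not use.
  obtain ⟨i₀, hi₀, h⟩ := exists_index_eval_ne_zero hβ hne (by
    refine lt_of_le_of_lt (hdeg.trans ?_) hE
    have h1 : 1 ≤ 2 ^ J * (R * R) := Nat.mul_pos (by positivity) (Nat.mul_pos hR hR)
    nlinarith [Nat.mul_le_mul_right (δ * (R * R)) h1])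
  refine ⟨Function.update e J i₀, fun i => ?_, ?_⟩
  · by_cases hi : i = J
    · simp [hi, hi₀]
    · simpa [hi] using heE i
  · rw [eval_aeval_curve, eval_aeval_fixOff] at h
    convert h using 4
    funext v
    rw [Function.update_self, hΓ, curve_congr β R (α' := fun i => β (e i)) J (ps v) fun i hi => by
      rw [Function.update_of_ne hi.ne]]

end Generator


/-! ### Branching programs as matrix products -/

/-- The number of changes in the sequence of the truth values of `P` at the nonzero ones among
`tag 0, …, tag (l - 1)`, where a value `false` is put in front, together with the last truth value. -/
def switchRun (P : ℕ → Bool) (tag : ℕ → ℕ) : ℕ → Bool × ℕ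
  | 0 => (false, 0)
  | l + 1 =>
    if tag l = 0 then switchRun P tag l
    else if P (tag l) = (switchRun P tag l).1 then switchRun P tag l
    else (P (tag l), (switchRun P tag l).2 + 1)

/-- The last node of the path is split off. The weight `g` on the end node is what the induction
needs; summing over all `a < w` is harmless since edges out of missing nodes are zero. -/
theorem sum_paths {B : Type*} [CommRing B] (sz : ℕ → ℕ) (w : ℕ) (e : ℕ → ℕ → ℕ → B)
    (Z : ℕ → ℕ → B) (h0 : ∀ b < sz 0, Z 0 b = 1)
    (hZ : ∀ l b, Z (l + 1) b = ∑ a ∈ Finset.range w, Z l a * e l a b) (hsz : ∀ l, sz l ≤ w)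
    (he : ∀ l a b, sz l ≤ a → e l a b = 0) (l : ℕ) (g : ℕ → B) :
    ∑ p : ((i : Fin (l + 1)) → Fin (sz i)),
        (∏ i : Fin l, e i (p i.castSucc) (p i.succ)) * g (p (Fin.last l)) =
      ∑ b ∈ Finset.range (sz l), Z l b * g b := by
  induction l generalizing g with
  | zero =>
    rw [← Fin.sum_univ_eq_sum_range (fun b => Z 0 b * g b)]
    refine Fintype.sum_equiv (Equiv.piUnique (fun i : Fin 1 => Fin (sz i))) _ _ fun p => ?_
    simp only [Finset.univ_eq_empty, Finset.prod_empty]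
    rw [h0 _ (Fin.is_lt _)]
    rfl
  | succ l ih =>
    rw [← (Fin.snocEquiv fun i : Fin (l + 1 + 1) => Fin (sz i)).sum_comp]
    rw [Fintype.sum_prod_type]
    rw [← Fin.sum_univ_eq_sum_range (fun b => Z (l + 1) b * g b)]
    refine Finset.sum_congr rfl fun b _ => ?_
    have h1 : Z (l + 1) b = ∑ a ∈ Finset.range (sz l), Z l a * e l a b := by
      rw [hZ]
      symm
      refine Finset.sum_subset (Finset.range_mono (hsz l)) fun a _ ha => ?_
      rw [he l a b (by simpa using ha), mul_zero]
    rw [h1, ← ih, Finset.sum_mul]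
    refine Finset.sum_congr rfl fun p _ => ?_
    rw [Fin.prod_univ_castSucc]
    have hc : ∀ i : Fin (l + 1), (Fin.snocEquiv fun i : Fin (l + 1 + 1) => Fin (sz i)) (b, p)
        i.castSucc = p i := fun i =>
      Fin.snoc_castSucc (α := fun i : Fin (l + 1 + 1) => Fin (sz i)) b p i
    have hl : (Fin.snocEquiv fun i : Fin (l + 1 + 1) => Fin (sz i)) (b, p) (Fin.last (l + 1)) = b :=
      Fin.snoc_last (α := fun i : Fin (l + 1 + 1) => Fin (sz i)) b p
    have hs : ∀ i : Fin l, (Fin.snocEquiv fun i : Fin (l + 1 + 1) => Fin (sz i)) (b, p)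
        i.castSucc.succ = p i.succ := fun i =>
      Fin.snoc_castSucc (α := fun i : Fin (l + 1 + 1) => Fin (sz i)) b p i.succ
    have hl' : (Fin.snocEquiv fun i : Fin (l + 1 + 1) => Fin (sz i)) (b, p) (Fin.last l).succ = b :=
      hl
    simp only [hc, hl, hs, hl']
    rfl

namespace ObliviousABP

variable {F : Type*} [Field F] {n L w d : ℕ} {σ : Fin L → Fin n}

/-- The value at `x` of the label of the edge from node `a` of layer `l` to node `b` of layer `l + 1`,
and `0` if there is no such edge. -/
noncomputable def entry (A : ObliviousABP F w d σ) {B : Type*} [CommRing B] [Algebra F B]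
    (x : Fin n → B) (l a b : ℕ) : B :=
  if h : l < L then
    ∑ j ∈ Finset.range (d + 1), algebraMap F B (A.coeffAt l a b j) * x (σ ⟨l, h⟩) ^ j
  else 0

/-- The sum over the paths from the source to node `b` of layer `l`. -/
noncomputable def rowvec (A : ObliviousABP F w d σ) {B : Type*} [CommRing B] [Algebra F B]
    (x : Fin n → B) : ℕ → ℕ → B
  | 0, b => if b = 0 then 1 else 0
  | l + 1, b => ∑ a ∈ Finset.range w, rowvec A x l a * entry A x l a b

theorem entry_map (A : ObliviousABP F w d σ) {B B' : Type*} [CommRing B] [Algebra F B]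
    [CommRing B'] [Algebra F B'] (φ : B →ₐ[F] B') (x : Fin n → B) (l a b : ℕ) :
    φ (A.entry x l a b) = A.entry (fun v => φ (x v)) l a b := by
  unfold entry
  split_ifs <;> simp

/-- The recursion commutes with substitution. Hence the same row vectors describe the polynomial,
its restrictions and its values. -/
theorem rowvec_map (A : ObliviousABP F w d σ) {B B' : Type*} [CommRing B] [Algebra F B]
    [CommRing B'] [Algebra F B'] (φ : B →ₐ[F] B') (x : Fin n → B) (l b : ℕ) :
    φ (A.rowvec x l b) = A.rowvec (fun v => φ (x v)) l b := by
  induction l generalizing b with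
  | zero => simp only [rowvec]; split_ifs <;> simp
  | succ l ih => simp [rowvec, ih, entry_map]

theorem entry_eq_aeval (A : ObliviousABP F w d σ) {B : Type*} [CommRing B] [Algebra F B]
    (x : Fin n → B) (l : Fin L) (a : Fin (A.size l.castSucc)) (b : Fin (A.size l.succ)) :
    A.entry x l a b = Polynomial.aeval (x (σ l)) (A.label l a b) := by
  rw [entry, dif_pos l.2, Polynomial.aeval_eq_sum_range' (Nat.lt_succ_of_le (A.degree_le l a b))]
  refine Finset.sum_congr rfl fun j _ => ?_
  rw [coeffAt, dif_pos ⟨l.2, a.2, b.2⟩, Algebra.smul_def]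

theorem entry_eq_zero (A : ObliviousABP F w d σ) {B : Type*} [CommRing B] [Algebra F B]
    (x : Fin n → B) (l a b : ℕ) (h : A.sizeAt l ≤ a) : A.entry x l a b = 0 := by
  unfold entry
  split_ifs with hl
  · refine Finset.sum_eq_zero fun j _ => ?_
    rw [coeffAt, dif_neg, map_zero, zero_mul]
    rintro ⟨hl', ha, _⟩
    rw [sizeAt, dif_pos (by omega)] at h
    exact absurd ha (not_lt.mpr h)
  · rfl

theorem poly_eq_rowvec (A : ObliviousABP F w d σ) : A.poly = A.rowvec MvPolynomial.X L 0 := by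
  have hs0 : A.sizeAt 0 = 1 := by
    rw [sizeAt, dif_pos (by omega)]
    exact A.size_first
  have hsL : A.sizeAt L = 1 := by
    rw [sizeAt, dif_pos (by omega)]
    exact A.size_last
  have hsz : ∀ l, A.sizeAt l ≤ w := by
    intro l
    unfold sizeAt
    split_ifs
    · exact A.size_le _
    · exact Nat.zero_le _
  have key := sum_paths A.sizeAt w (A.entry (B := MvPolynomial (Fin n) F) MvPolynomial.X)
    (A.rowvec MvPolynomial.X) (fun b hb => by
      have : b = 0 := by omega
      simp [rowvec, this]) (fun l b => rfl) hsz
    (fun l a b h => A.entry_eq_zero _ l a b h) L (fun _ => 1)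
  rw [hsL] at key
  simp only [mul_one, Finset.sum_range_one] at key
  rw [← key, poly]
  have hsi : ∀ i : Fin (L + 1), A.size i = A.sizeAt i := fun i => by
    rw [sizeAt, dif_pos i.2]
  refine Fintype.sum_equiv (Equiv.piCongrRight fun i => finCongr (hsi i)) _ _ fun p => ?_
  refine Finset.prod_congr rfl fun l _ => ?_
  simp only [Equiv.piCongrRight_apply, Pi.map_apply, finCongr_apply, Fin.val_cast]
  rw [entry_eq_aeval]

theorem aeval_poly (A : ObliviousABP F w d σ) {B : Type*} [CommRing B] [Algebra F B]
    (x : Fin n → B) : MvPolynomial.aeval x A.poly = A.rowvec x L 0 := by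
  rw [poly_eq_rowvec, rowvec_map]
  simp

theorem eval_poly (A : ObliviousABP F w d σ) (x : Fin n → F) :
    MvPolynomial.eval x A.poly = A.rowvec x L 0 := by
  rw [← MvPolynomial.coe_aeval_eq_eval, RingHom.coe_coe, aeval_poly]

end ObliviousABP


namespace ObliviousABP

variable {F : Type*} [Field F] {n L w d : ℕ} {σ : Fin L → Fin n}

theorem totalDegree_rowvec_le (A : ObliviousABP F w d σ) (l b : ℕ) :
    (A.rowvec (MvPolynomial.X : Fin n → MvPolynomial (Fin n) F) l b).totalDegree ≤ l * d := by
  induction l generalizing b with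
  | zero => simp only [rowvec]; split_ifs <;> simp
  | succ l ih =>
    rw [rowvec]
    refine MvPolynomial.totalDegree_finsetSum_le fun a _ => ?_
    refine (MvPolynomial.totalDegree_mul _ _).trans ?_
    rw [Nat.succ_mul]
    refine Nat.add_le_add (ih a) ?_
    unfold entry
    split_ifs with h
    · refine MvPolynomial.totalDegree_finsetSum_le fun j hj => ?_
      refine (MvPolynomial.totalDegree_mul _ _).trans ?_
      rw [MvPolynomial.algebraMap_eq, MvPolynomial.totalDegree_C, zero_add]
      refine (MvPolynomial.totalDegree_pow _ _).trans ?_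
      rw [MvPolynomial.totalDegree_X, mul_one]
      have := Finset.mem_range.mp hj
      omega
    · simp

theorem totalDegree_poly_le (A : ObliviousABP F w d σ) : A.poly.totalDegree ≤ L * d := by
  rw [poly_eq_rowvec]
  exact A.totalDegree_rowvec_le L 0

end ObliviousABP

/-- A nonzero polynomial of small degree has a point where it is not zero. -/
theorem exists_eval_ne_zero_of_totalDegree_lt {F : Type*} [Field F] {n : ℕ}
    {p : MvPolynomial (Fin n) F} (hp : p ≠ 0) {β : ℕ → F} {E : ℕ} (hβ : Set.InjOn β (Set.Iio E))
    (h : p.totalDegree < E) : ∃ c, MvPolynomial.eval c p ≠ 0 := by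
  classical
  by_contra! hz
  refine hp (MvPolynomial.eq_zero_of_eval_zero_at_prod_finset p
    (fun _ => (Finset.range E).image β) (fun i => ?_) fun x _ => hz x)
  rw [Finset.card_image_of_injOn (by simpa [Set.Iio_def] using hβ), Finset.card_range]
  exact (MvPolynomial.degreeOf_le_totalDegree p i).trans_lt h

/-! ### Few blocks give small restriction spaces -/

section Factorization

open MvPolynomial

variable {F : Type*} [Field F] {V : Type*}

/-- The family of rows `r c` factors through `N` polynomials that do not depend on `c`; the
dependence on the column is on the side of the polynomials. -/
def KeepFactor (w N : ℕ) (K : Set (V → F)) (r : (V → F) → ℕ → MvPolynomial V F) : Prop :=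
  ∃ (ι : Type) (_ : Fintype ι) (φ : ι → ℕ → MvPolynomial V F) (ψ : ι → (V → F) → F),
    Fintype.card ι ≤ N ∧ ∀ c ∈ K, ∀ b < w, r c b = ∑ i, φ i b * C (ψ i c)

/-- The family of rows `r c` factors through `N` polynomials that do not depend on `c`; the
dependence on the column is on the side of the constants. -/
def ConstFactor (w N : ℕ) (K : Set (V → F)) (r : (V → F) → ℕ → MvPolynomial V F) : Prop :=
  ∃ (ι : Type) (_ : Fintype ι) (φ : ι → MvPolynomial V F) (ψ : ι → ℕ → (V → F) → F),
    Fintype.card ι ≤ N ∧ ∀ c ∈ K, ∀ b < w, r c b = ∑ i, φ i * C (ψ i b c)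

variable {w N : ℕ} {K : Set (V → F)} {r : (V → F) → ℕ → MvPolynomial V F}

/-- A layer matrix that does not depend on `c` acts on the polynomial factors alone. Dually, in
`ConstFactor.step`, a matrix of constants acts on the scalar factors alone. -/
theorem KeepFactor.step (h : KeepFactor w N K r) (M : ℕ → ℕ → MvPolynomial V F)
    {e : (V → F) → ℕ → ℕ → MvPolynomial V F} (he : ∀ c ∈ K, ∀ a b, e c a b = M a b) :
    KeepFactor w N K fun c b => ∑ a ∈ Finset.range w, r c a * e c a b := by
  obtain ⟨ι, _, φ, ψ, hN, h⟩ := h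
  refine ⟨ι, inferInstance, fun i b => ∑ a ∈ Finset.range w, φ i a * M a b, ψ, hN,
    fun c hc b _ => ?_⟩
  simp only [Finset.sum_mul]
  rw [Finset.sum_comm]
  refine Finset.sum_congr rfl fun a ha => ?_
  rw [h c hc a (Finset.mem_range.mp ha), he c hc, Finset.sum_mul]
  exact Finset.sum_congr rfl fun i _ => by ring

theorem ConstFactor.step (h : ConstFactor w N K r) (κ : (V → F) → ℕ → ℕ → F)
    {e : (V → F) → ℕ → ℕ → MvPolynomial V F} (he : ∀ c ∈ K, ∀ a b, e c a b = C (κ c a b)) :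
    ConstFactor w N K fun c b => ∑ a ∈ Finset.range w, r c a * e c a b := by
  obtain ⟨ι, _, φ, ψ, hN, h⟩ := h
  refine ⟨ι, inferInstance, φ, fun i b c => ∑ a ∈ Finset.range w, ψ i a c * κ c a b, hN,
    fun c hc b _ => ?_⟩
  simp only [map_sum, Finset.mul_sum]
  rw [Finset.sum_comm]
  refine Finset.sum_congr rfl fun a ha => ?_
  rw [h c hc a (Finset.mem_range.mp ha), he c hc, Finset.sum_mul]
  exact Finset.sum_congr rfl fun i _ => by rw [C_mul]; ring

/-- Making the column a part of the summation index allows it to change sides, at the price of a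
factor `w`. -/
theorem KeepFactor.toConst (h : KeepFactor w N K r) : ConstFactor w (N * w) K r := by
  obtain ⟨ι, _, φ, ψ, hN, h⟩ := h
  refine ⟨ι × Fin w, inferInstance, fun i => φ i.1 i.2,
    fun i b c => if (i.2 : ℕ) = b then ψ i.1 c else 0, ?_, fun c hc b hb => ?_⟩
  · rw [Fintype.card_prod, Fintype.card_fin]
    exact Nat.mul_le_mul_right _ hN
  · rw [h c hc b hb, Fintype.sum_prod_type]
    refine Finset.sum_congr rfl fun i _ => ?_
    rw [Finset.sum_eq_single ⟨b, hb⟩]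
    · simp
    · intro b' _ hb'
      have : (b' : ℕ) ≠ b := fun h => hb' (Fin.ext h)
      simp [this]
    · simp

theorem ConstFactor.toKeep (h : ConstFactor w N K r) : KeepFactor w (N * w) K r := by
  obtain ⟨ι, _, φ, ψ, hN, h⟩ := h
  refine ⟨ι × Fin w, inferInstance, fun i b => if (i.2 : ℕ) = b then φ i.1 else 0,
    fun i c => ψ i.1 i.2 c, ?_, fun c hc b hb => ?_⟩
  · rw [Fintype.card_prod, Fintype.card_fin]
    exact Nat.mul_le_mul_right _ hN
  · rw [h c hc b hb, Fintype.sum_prod_type]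
    refine Finset.sum_congr rfl fun i _ => ?_
    rw [Finset.sum_eq_single ⟨b, hb⟩]
    · simp
    · intro b' _ hb'
      have : (b' : ℕ) ≠ b := fun h => hb' (Fin.ext h)
      simp [this]
    · simp

end Factorization

namespace ObliviousABP

variable {F : Type*} [Field F] {n L w d : ℕ} {σ : Fin L → Fin n}

theorem entry_congr (A : ObliviousABP F w d σ) {B : Type*} [CommRing B] [Algebra F B]
    {x y : Fin n → B} (l : ℕ) (a b : ℕ) (h : ∀ hl : l < L, x (σ ⟨l, hl⟩) = y (σ ⟨l, hl⟩)) :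
    A.entry x l a b = A.entry y l a b := by
  unfold entry
  split_ifs with hl
  · rw [h hl]
  · rfl

/-- The number of factors needed to separate the variables in `S` from the other variables is bounded
in terms of the number of switches. -/
theorem factor_rowvec (A : ObliviousABP F w d σ) (Y S : Finset (Fin n)) (hSY : S ⊆ Y)
    (c₀ : Fin n → F) (tag : ℕ → ℕ) (P : ℕ → Bool)
    (htag : ∀ (l : ℕ) (hl : l < L), tag l = 0 ↔ σ ⟨l, hl⟩ ∉ Y)
    (hP : ∀ (l : ℕ) (hl : l < L), tag l ≠ 0 → (P (tag l) = true ↔ σ ⟨l, hl⟩ ∈ S)) (l : ℕ)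
    (hl : l ≤ L) :
    if (switchRun P tag l).1 then
      KeepFactor w (w ^ (switchRun P tag l).2) {c | ∀ v ∉ Y, c v = c₀ v}
        fun c b => A.rowvec (fixOff S c) l b
    else
      ConstFactor w (w ^ (switchRun P tag l).2) {c | ∀ v ∉ Y, c v = c₀ v}
        fun c b => A.rowvec (fixOff S c) l b := by
  induction l with
  | zero =>
    -- The unit row vector needs one factor; the initial truth value `false` corresponds to
    -- `ConstFactor`.
    simp only [switchRun, Bool.false_eq_true, if_false, pow_zero]
    refine ⟨Unit, inferInstance, fun _ => 1, fun _ b _ => if b = 0 then 1 else 0, by simp, ?_⟩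
    intro c _ b _
    simp only [rowvec]
    split_ifs <;> simp
  | succ l ih =>
    have hl' : l < L := hl
    specialize ih hl'.le
    set K : Set (Fin n → F) := {c | ∀ v ∉ Y, c v = c₀ v} with hK
    have hconst : σ ⟨l, hl'⟩ ∉ S → ∀ c ∈ K, ∀ a b,
        A.entry (fixOff S c) l a b = MvPolynomial.C (A.entry c l a b) := by
      intro hv c _ a b
      have := A.entry_map (Algebra.ofId F (MvPolynomial (Fin n) F)) c l a b
      rw [Algebra.ofId_apply, MvPolynomial.algebraMap_eq] at this
      rw [this]
      refine A.entry_congr l a b fun _ => ?_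
      simp only [fixOff, hv, if_false]
      rfl
    -- Outside `Y` the assignment `c` agrees with `c₀`. Layers that read such variables are thus
    -- constant as well as independent of `c`, and preserve both kinds of factorization, which is
    -- why switches ignore them.
    have hkeep : (σ ⟨l, hl'⟩ ∈ S ∨ σ ⟨l, hl'⟩ ∉ Y) → ∀ c ∈ K, ∀ a b,
        A.entry (fixOff S c) l a b = A.entry (fixOff S c₀) l a b := by
      intro hv c hc a b
      refine A.entry_congr l a b fun _ => ?_
      rcases hv with hv | hv
      · simp [fixOff, hv]
      · simp [fixOff, hc _ hv]
    have stepK : ∀ N, (σ ⟨l, hl'⟩ ∈ S ∨ σ ⟨l, hl'⟩ ∉ Y) →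
        KeepFactor w N K (fun c b => A.rowvec (fixOff S c) l b) →
        KeepFactor w N K (fun c b => A.rowvec (fixOff S c) (l + 1) b) :=
      fun N hv h => h.step _ (hkeep hv)
    have stepC : ∀ N, σ ⟨l, hl'⟩ ∉ S →
        ConstFactor w N K (fun c b => A.rowvec (fixOff S c) l b) →
        ConstFactor w N K (fun c b => A.rowvec (fixOff S c) (l + 1) b) :=
      fun N hv h => h.step (fun c => A.entry c l) (hconst hv)
    rw [switchRun]
    by_cases h0 : tag l = 0
    · have hv := (htag l hl').mp h0
      rw [if_pos h0]
      split_ifs at ih ⊢ with hm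
      · exact stepK _ (Or.inr hv) ih
      · exact stepC _ (fun h => hv (hSY h)) ih
    · rw [if_neg h0]
      have hPl := hP l hl' h0
      by_cases heq : P (tag l) = (switchRun P tag l).1
      · rw [if_pos heq]
        rw [heq] at hPl
        split_ifs at ih ⊢ with hm
        · exact stepK _ (Or.inl (hPl.mp hm)) ih
        · exact stepC _ (fun h => hm (hPl.mpr h)) ih
      · rw [if_neg heq]
        -- A change between the two kinds of factorization is paid for by one more factor `w`.
        simp only [pow_succ]
        split_ifs at ih ⊢ with hm hm' hm'
        · exact absurd (hm.trans hm'.symm) heq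
        · exact stepK _ (Or.inl (hPl.mp hm)) ih.toKeep
        · exact stepC _ (fun h => hm (hPl.mpr h)) ih.toConst
        · exact absurd ((Bool.eq_false_iff.mpr hm).trans (Bool.eq_false_iff.mpr hm').symm) heq

/-- The dimension of the space of restrictions is bounded in terms of the number of switches. -/
theorem restrSpace_le_span (A : ObliviousABP F w d σ) (Y S : Finset (Fin n)) (hSY : S ⊆ Y)
    (c₀ : Fin n → F) (tag : ℕ → ℕ) (P : ℕ → Bool)
    (htag : ∀ (l : ℕ) (hl : l < L), tag l = 0 ↔ σ ⟨l, hl⟩ ∉ Y)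
    (hP : ∀ (l : ℕ) (hl : l < L), tag l ≠ 0 → (P (tag l) = true ↔ σ ⟨l, hl⟩ ∈ S)) :
    ∃ T : Finset (MvPolynomial (Fin n) F), T.card ≤ w ^ (switchRun P tag L).2 ∧
      restrSpace Y c₀ A.poly S ≤ Submodule.span F (T : Set (MvPolynomial (Fin n) F)) := by
  classical
  have hw : 0 < w := by
    have := A.size_le 0
    rw [A.size_first] at this
    omega
  have h := A.factor_rowvec Y S hSY c₀ tag P htag hP L le_rfl
  obtain ⟨ι, _, φ, ψ, hN, hφ⟩ : ∃ (ι : Type) (_ : Fintype ι) (φ : ι → MvPolynomial (Fin n) F)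
      (ψ : ι → (Fin n → F) → F), Fintype.card ι ≤ w ^ (switchRun P tag L).2 ∧
        ∀ c ∈ {c : Fin n → F | ∀ v ∉ Y, c v = c₀ v},
          A.rowvec (fixOff S c) L 0 = ∑ i, φ i * MvPolynomial.C (ψ i c) := by
    split_ifs at h
    · obtain ⟨ι, hι, φ, ψ, hN, hφ⟩ := h
      exact ⟨ι, hι, fun i => φ i 0, ψ, hN, fun c hc => hφ c hc 0 hw⟩
    · obtain ⟨ι, hι, φ, ψ, hN, hφ⟩ := h
      exact ⟨ι, hι, φ, fun i => ψ i 0, hN, fun c hc => hφ c hc 0 hw⟩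
  refine ⟨Finset.univ.image φ, Finset.card_image_le.trans (by simpa using hN), ?_⟩
  rw [restrSpace, Submodule.span_le]
  rintro _ ⟨c, rfl⟩
  simp only [SetLike.mem_coe]
  -- The assignment `Y.piecewise c c₀` agrees with `c₀` off `Y`, so each restriction is a
  -- combination of the fixed polynomials `φ i` with scalar coefficients.
  rw [aeval_poly, hφ _ (fun v hv => by simp [hv])]
  refine Submodule.sum_mem _ fun i _ => ?_
  rw [mul_comm, ← MvPolynomial.smul_eq_C_mul]
  exact Submodule.smul_mem _ _ (Submodule.subset_span (by simp))

end ObliviousABP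


/-! ### From initial segments to classes of variables -/

/-- Membership in the interval is `t ≤ b` without `t ≤ a`, and it can change only when one of these
two truth values changes. A bound for initial segments thus suffices for all dyadic intervals. -/
theorem switchRun_interval (tag : ℕ → ℕ) {a b : ℕ} (hab : a ≤ b) (l : ℕ) :
    ((switchRun (fun t => decide (a < t ∧ t ≤ b)) tag l).1 =
      ((switchRun (fun t => decide (t ≤ b)) tag l).1 &&
        !(switchRun (fun t => decide (t ≤ a)) tag l).1)) ∧
    (switchRun (fun t => decide (a < t ∧ t ≤ b)) tag l).2 ≤
      (switchRun (fun t => decide (t ≤ a)) tag l).2 +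
        (switchRun (fun t => decide (t ≤ b)) tag l).2 := by
  induction l with
  | zero => simp [switchRun]
  | succ l ih =>
    obtain ⟨h1, h2⟩ := ih
    simp only [switchRun]
    by_cases h0 : tag l = 0
    · simp only [h0, if_true]
      exact ⟨h1, h2⟩
    · simp only [h0, if_false, h1]
      generalize (switchRun (fun t => decide (t ≤ a)) tag l) = sa at *
      generalize (switchRun (fun t => decide (t ≤ b)) tag l) = sb at *
      generalize (switchRun (fun t => decide (a < t ∧ t ≤ b)) tag l) = sc at *
      obtain ⟨ma, ca⟩ := sa
      obtain ⟨mb, cb⟩ := sb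
      obtain ⟨mc, cc⟩ := sc
      simp only at h1 h2 ⊢
      rcases lt_or_ge a (tag l) with ha | ha <;> rcases le_or_gt (tag l) b with hb | hb
      · simp only [ha, hb, not_le.mpr ha]
        cases ma <;> cases mb <;> simp_all <;> omega
      · simp only [ha, not_le.mpr hb, not_le.mpr ha]
        cases ma <;> cases mb <;> simp_all <;> omega
      · simp only [hb, not_lt.mpr ha, ha]
        cases ma <;> cases mb <;> simp_all <;> omega
      · omega

/-- If the truth values are a function of monotone labels that are at most `N`, then they change
at most `N + 1` times. -/
theorem switchRun_le_of_monotone_label (P : ℕ → Bool) (tag : ℕ → ℕ) (Λ : ℕ → ℕ) (h : ℕ → Bool)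
    (L : ℕ) (N : ℕ) (hΛ : ∀ i j, i < j → j < L → tag i ≠ 0 → tag j ≠ 0 → Λ i ≤ Λ j)
    (hN : ∀ i < L, tag i ≠ 0 → Λ i ≤ N) (hP : ∀ i < L, tag i ≠ 0 → P (tag i) = h (Λ i)) :
    (switchRun P tag L).2 ≤ N + 1 := by
  -- The last tagged level `i` determines the current truth value, and `Λ i + 1` bounds the changes
  -- so far. The summand `1` pays for a possible change away from the initial `false`.
  have key : ∀ l ≤ L, ((switchRun P tag l = (false, 0) ∧ ∀ i < l, tag i = 0) ∨
      ∃ i < l, tag i ≠ 0 ∧ (∀ j < l, tag j ≠ 0 → j ≤ i) ∧ (switchRun P tag l).1 = h (Λ i) ∧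
        (switchRun P tag l).2 ≤ Λ i + 1) := by
    intro l
    induction l with
    | zero => intro _; exact Or.inl ⟨rfl, by simp⟩
    | succ l ih =>
      intro hl
      rw [switchRun]
      by_cases h0 : tag l = 0
      · rw [if_pos h0]
        rcases ih (by omega) with ⟨h1, h2⟩ | ⟨i, hi, hti, hmax, h1, h2⟩
        · exact Or.inl ⟨h1, fun i hi => by
            rcases Nat.lt_succ_iff_lt_or_eq.mp hi with h | h
            · exact h2 i h
            · rw [h, h0]⟩
        · exact Or.inr ⟨i, by omega, hti, fun j hj hj0 => by
            rcases Nat.lt_succ_iff_lt_or_eq.mp hj with h | h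
            · exact hmax j h hj0
            · exact absurd (h ▸ h0) hj0, h1, h2⟩
      · rw [if_neg h0]
        right
        refine ⟨l, by omega, h0, fun j hj _ => by omega, ?_⟩
        have hPl := hP l (by omega) h0
        rcases ih (by omega) with ⟨h1, h2⟩ | ⟨i, hi, hti, hmax, h1, h2⟩
        · rw [h1]
          split_ifs with heq
          · exact ⟨by rw [← hPl]; exact heq.symm, by simp⟩
          · exact ⟨hPl, by simp⟩
        · have hle := hΛ i l hi (by omega) hti h0
          split_ifs with heq
          · exact ⟨by rw [← heq, hPl], by omega⟩
          · refine ⟨hPl, ?_⟩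
            have hne : Λ i ≠ Λ l := by
              intro he
              apply heq
              rw [hPl, h1, he]
            simp only
            omega
  rcases key L le_rfl with ⟨h1, _⟩ | ⟨i, hi, hti, _, _, h2⟩
  · rw [h1]
    omega
  · have := hN i hi hti
    omega

/-- The positions of the variables that are read, where `0` means that a variable is to be ignored. -/
def readTag {n L : ℕ} (σ : Fin L → Fin n) (pos : ℕ → ℕ) (l : ℕ) : ℕ :=
  if h : l < L then pos (σ ⟨l, h⟩) else 0

/-- The positions are different, and every initial segment is read in few blocks. -/
def ValidPos {n L : ℕ} (σ : Fin L → Fin n) (K : ℕ) (pos : ℕ → ℕ) : Prop :=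
  (∀ u < n, ∀ v < n, pos u ≠ 0 → pos u = pos v → u = v) ∧
    ∀ q, (switchRun (fun t => decide (t ≤ q)) (readTag σ pos) L).2 ≤ K

/-- The positions in the class number `r` of a partition of the variables, counted from `1`. -/
def classPos (rd ps : ℕ → ℕ) (r v : ℕ) : ℕ := if rd v = r then ps v + 1 else 0

/-- The coordinate `v` of the point that the generator gives for the seeds `e`. -/
noncomputable def genPoint {F : Type*} [Field F] (β : ℕ → F) (R J : ℕ) (rd ps : ℕ → ℕ)
    (e : ℕ → ℕ → ℕ) (v : ℕ) : F :=
  (curve β R (fun i => β (e (rd v) i)) J (ps v)).eval (β (e (rd v) J))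

/-- A dyadic interval of a class is a difference of two initial segments, each read with at most `K`
changes. Its restriction space has dimension at most `w ^ (2 * K) ≤ R`, and the generator applies
while the other classes stay frozen at `c₀`. -/
theorem exists_seeds_class {F : Type*} [Field F] {n L w d : ℕ} {σ : Fin L → Fin n}
    (A : ObliviousABP F w d σ) {β : ℕ → F} {E R J K : ℕ} (hβ : Set.InjOn β (Set.Iio E))
    (hR : w ^ (2 * K) ≤ R) (hRE : R * R ≤ E)
    (hE : 2 ^ J * (R * (R * (L * d * (R * R)))) < E) {rd ps : ℕ → ℕ}
    (hps : ∀ v < n, ps v < 2 ^ J) (r : ℕ) (hv : ValidPos σ K (classPos rd ps r)) {c₀ : Fin n → F}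
    (hc₀ : MvPolynomial.eval c₀ A.poly ≠ 0) :
    ∃ e : ℕ → ℕ, (∀ i, e i < E) ∧ MvPolynomial.eval (fun v : Fin n => if rd v = r then
      (curve β R (fun i => β (e i)) J (ps v)).eval (β (e J)) else c₀ v) A.poly ≠ 0 := by
  have hw : 0 < w := by
    have := A.size_le 0
    rw [A.size_first] at this
    omega
  have hR1 : 1 ≤ R := (Nat.one_le_pow _ _ hw).trans hR
  set Y : Finset (Fin n) := Finset.univ.filter fun v => rd v = r with hY
  have hmem : ∀ v : Fin n, v ∈ Y ↔ rd v = r := by simp [hY]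
  obtain ⟨e, heE, he⟩ := exists_seeds (V := Fin n) (Y := Y) (ps := fun v => ps v) (c₀ := c₀)
    hβ hR1 hRE hE (fun u hu v hv' h => by
      have hu' := (hmem u).mp hu
      have hv'' := (hmem v).mp hv'
      refine Fin.ext (hv.1 u u.2 v v.2 ?_ ?_) <;> simp only [classPos, hu', hv'', if_true]
      · omega
      · simpa using h) (fun v _ => hps v v.2) A.totalDegree_poly_le (fun j c => by
    have hSY : dyadic Y (fun v : Fin n => ps v) j c ⊆ Y := Finset.filter_subset _ _
    have hab : c * 2 ^ j ≤ (c + 1) * 2 ^ j := Nat.mul_le_mul_right _ (by omega)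
    obtain ⟨T, hT, hTs⟩ := A.restrSpace_le_span Y _ hSY c₀ (readTag σ (classPos rd ps r))
      -- Positions start at `0` but tags at `1`, since tag `0` marks ignored variables. This shift
      -- explains the interval open on the left and closed on the right.
      (fun t => decide (c * 2 ^ j < t ∧ t ≤ (c + 1) * 2 ^ j)) (fun l hl => by
        rw [hmem, readTag, dif_pos hl, classPos]
        split_ifs with h <;> simp [h]) (fun l hl h0 => by
        rw [readTag, dif_pos hl, classPos] at h0 ⊢
        split_ifs at h0 ⊢ with h
        · rw [dyadic, Finset.mem_filter, hmem, Nat.div_eq_iff (by positivity), decide_eq_true_iff]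
          have hpos : 0 < 2 ^ j := by positivity
          rw [Nat.add_mul, one_mul]
          constructor
          · rintro ⟨h1, h2⟩
            exact ⟨h, by omega, by omega⟩
          · rintro ⟨_, h1, h2⟩
            exact ⟨by omega, by omega⟩
        · exact absurd rfl h0)
    refine ⟨T, hT.trans (le_trans ?_ hR), hTs⟩
    refine Nat.pow_le_pow_right hw ?_
    have h1 := (switchRun_interval (readTag σ (classPos rd ps r)) hab L).2
    have h2 := hv.2 (c * 2 ^ j)
    have h3 := hv.2 ((c + 1) * 2 ^ j)
    omega) hc₀
  refine ⟨e, heE, ?_⟩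
  convert he using 4 with v
  by_cases h : rd v = r
  · simp [hmem, h]
  · simp [hmem, h]

/-- The generator hits all programs with the given reading order. -/
theorem exists_seeds_genPoint {F : Type*} [Field F] {n L w d : ℕ} {σ : Fin L → Fin n}
    (A : ObliviousABP F w d σ) {β : ℕ → F} {E R J K ρ : ℕ} (hβ : Set.InjOn β (Set.Iio E))
    (hR : w ^ (2 * K) ≤ R) (hRE : R * R ≤ E)
    (hE : 2 ^ J * (R * (R * (L * d * (R * R)))) < E) (hE' : L * d < E) {rd ps : ℕ → ℕ}
    (hps : ∀ v < n, ps v < 2 ^ J) (hrd : ∀ v < n, rd v < ρ)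
    (hv : ∀ r < ρ, ValidPos σ K (classPos rd ps r)) (hA : A.poly ≠ 0) :
    ∃ e : ℕ → ℕ → ℕ, (∀ r i, e r i < E) ∧
      MvPolynomial.eval (fun v : Fin n => genPoint β R J rd ps e v) A.poly ≠ 0 := by
  obtain ⟨c₀, hc₀⟩ := exists_eval_ne_zero_of_totalDegree_lt hA hβ
    (A.totalDegree_poly_le.trans_lt hE')
  -- Hybrid argument: the classes below `r` already carry generator values, the others still carry
  -- `c₀`.
  have key : ∀ r ≤ ρ, ∃ e : ℕ → ℕ → ℕ, (∀ r i, e r i < E) ∧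
      MvPolynomial.eval (fun v : Fin n => if rd v < r then genPoint β R J rd ps e v else c₀ v)
        A.poly ≠ 0 := by
    intro r
    induction r with
    | zero => exact fun _ => ⟨fun _ _ => 0, fun _ _ => (Nat.zero_le _).trans_lt hE, by simpa⟩
    | succ r ih =>
      intro hr
      obtain ⟨e, heE, he⟩ := ih (by omega)
      obtain ⟨e', he'E, he'⟩ := exists_seeds_class A hβ hR hRE hE hps r (hv r (by omega)) he
      refine ⟨Function.update e r e', fun s i => ?_, ?_⟩
      · by_cases h : s = r
        · simp [h, he'E]
        · simp [h, heE]
      · convert he' using 4 with v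
        by_cases h : rd v = r
        · simp [h, genPoint]
        · by_cases h2 : rd v < r
          · simp [h, h2, genPoint, show rd v < r + 1 by omega]
          · simp [h, h2, show ¬ rd v < r + 1 by omega]
  obtain ⟨e, heE, he⟩ := key ρ le_rfl
  refine ⟨e, heE, ?_⟩
  convert he using 4 with v
  simp [hrd v v.2]

/-- Reading the seeds as digits lets a single counter enumerate all choices. -/
theorem exists_code {E : ℕ} (T : ℕ) (dg : ℕ → ℕ) (h : ∀ i, dg i < E) :
    ∃ c < E ^ T, ∀ i < T, c / E ^ i % E = dg i := by
  have hE : 0 < E := (Nat.zero_le _).trans_lt (h 0)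
  induction T with
  | zero => exact ⟨0, by simp, by simp⟩
  | succ T ih =>
    obtain ⟨c, hc, hci⟩ := ih
    refine ⟨c + dg T * E ^ T, ?_, fun i hi => ?_⟩
    · rw [pow_succ]
      have := h T
      nlinarith [Nat.mul_le_mul_right (E ^ T) (show dg T + 1 ≤ E from this)]
    · rcases Nat.lt_succ_iff_lt_or_eq.mp hi with h' | rfl
      · rw [← hci i h']
        obtain ⟨m, rfl⟩ := Nat.exists_eq_add_of_lt h'
        rw [show dg (i + m + 1) * E ^ (i + m + 1) = E ^ i * (E * (dg (i + m + 1) * E ^ m)) by ring,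
          Nat.add_mul_div_left _ _ (by positivity), Nat.add_mul_mod_self_left]
      · rw [mul_comm, Nat.add_mul_div_left _ _ (by positivity), Nat.div_eq_of_lt hc, zero_add,
          Nat.mod_eq_of_lt (h i)]


/-! ### Large regularly interleaving sets -/

section Chains

variable {V : Type*}

/-- This is the height in a finite order: the supremum over smaller elements of their height plus
one. The function `o`, which increases along `lt`, organizes the recursion. -/
theorem exists_chainRank (X : Finset V) (lt : V → V → Prop) (o : V → ℕ)
    (ho : ∀ u v, lt u v → o u < o v) :
    ∃ c : V → ℕ, ∀ v ∈ X, (∀ u ∈ X, lt u v → c u < c v) ∧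
      (c v ≠ 0 → ∃ u ∈ X, lt u v ∧ c u + 1 = c v) := by
  classical
  have key : ∀ m, ∃ c : V → ℕ, ∀ v ∈ X, o v < m → (∀ u ∈ X, lt u v → c u < c v) ∧
      (c v ≠ 0 → ∃ u ∈ X, lt u v ∧ c u + 1 = c v) := by
    intro m
    induction m with
    | zero => exact ⟨fun _ => 0, by simp⟩
    | succ m ih =>
      obtain ⟨c, hc⟩ := ih
      refine ⟨fun v => if o v < m then c v else (X.filter fun u => lt u v).sup fun u => c u + 1,
        fun v hv hvm => ?_⟩
      have hlow : ∀ u, lt u v → o u < m := fun u hu => by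
        have := ho u v hu
        omega
      by_cases h : o v < m
      · obtain ⟨h1, h2⟩ := hc v hv h
        simp only [h, if_true]
        refine ⟨fun u hu huv => by simpa [hlow u huv] using h1 u hu huv, fun h0 => ?_⟩
        obtain ⟨u, hu, huv, hcu⟩ := h2 h0
        exact ⟨u, hu, huv, by simpa [hlow u huv] using hcu⟩
      · simp only [h, if_false]
        constructor
        · intro u hu huv
          simp only [hlow u huv, if_true]
          exact Nat.lt_of_succ_le
            (Finset.le_sup (f := fun u => c u + 1) (Finset.mem_filter.mpr ⟨hu, huv⟩))
        · intro h0
          have hne : (X.filter fun u => lt u v).Nonempty := by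
            by_contra hne
            rw [Finset.not_nonempty_iff_eq_empty] at hne
            rw [hne] at h0
            exact h0 rfl
          obtain ⟨u, hu, hsup⟩ := Finset.exists_mem_eq_sup _ hne fun u => c u + 1
          rw [Finset.mem_filter] at hu
          exact ⟨u, hu.1, hu.2, by simp only [hlow u hu.2, if_true]; exact hsup.symm⟩
  obtain ⟨c, hc⟩ := key (X.sup o + 1)
  exact ⟨c, fun v hv => hc v hv (Nat.lt_succ_of_le (Finset.le_sup hv))⟩

/-- Descending repeatedly to an element whose height is smaller by one traces out a chain. -/
theorem exists_chain_of_rank {X : Finset V} {lt : V → V → Prop}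
    (htrans : ∀ u v w, lt u v → lt v w → lt u w) (hirr : ∀ u, ¬ lt u u) {c : V → ℕ}
    (hc : ∀ v ∈ X, c v ≠ 0 → ∃ u ∈ X, lt u v ∧ c u + 1 = c v) (m : ℕ) :
    ∀ v ∈ X, c v = m → ∃ Y ⊆ X, Y.card = m + 1 ∧ (∀ a ∈ Y, a = v ∨ lt a v) ∧
      ∀ a ∈ Y, ∀ b ∈ Y, a ≠ b → lt a b ∨ lt b a := by
  classical
  induction m with
  | zero =>
    intro v hv _
    refine ⟨{v}, by simpa using hv, by simp, by simp, ?_⟩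
    intro a ha b hb hab
    rw [Finset.mem_singleton] at ha hb
    exact absurd (ha.trans hb.symm) hab
  | succ m ih =>
    intro v hv hcv
    obtain ⟨u, hu, huv, hcu⟩ := hc v hv (by omega)
    obtain ⟨Y, hYX, hcard, hmax, hch⟩ := ih u hu (by omega)
    have hav : ∀ a ∈ Y, lt a v := by
      intro a ha
      rcases hmax a ha with rfl | h
      · exact huv
      · exact htrans _ _ _ h huv
    have hvY : v ∉ Y := fun h => hirr v (hav v h)
    refine ⟨insert v Y, Finset.insert_subset hv hYX, by rw [Finset.card_insert_of_notMem hvY, hcard],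
      ?_, ?_⟩
    · intro a ha
      rcases Finset.mem_insert.mp ha with h | h
      · exact Or.inl h
      · exact Or.inr (hav a h)
    · intro a ha b hb hab
      rcases Finset.mem_insert.mp ha with h | h <;> rcases Finset.mem_insert.mp hb with h' | h'
      · exact absurd (h.trans h'.symm) hab
      · exact Or.inr (h ▸ hav b h')
      · exact Or.inl (h' ▸ hav a h)
      · exact hch a h b h' hab

/-- The Erdős–Szekeres theorem. -/
theorem exists_monotone_or_antitone (X : Finset V) (o p : V → ℕ) (hp : Set.InjOn p X) :
    ∃ Y ⊆ X, X.card ≤ Y.card ^ 2 ∧ ((∀ u ∈ Y, ∀ v ∈ Y, o u < o v → p u < p v) ∨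
      ∀ u ∈ Y, ∀ v ∈ Y, o u < o v → p v < p u) := by
  classical
  rcases X.eq_empty_or_nonempty with rfl | hne
  · exact ⟨∅, le_rfl, by simp, by simp⟩
  -- Heights in the product order. A large height gives an increasing chain. Otherwise some set of
  -- constant height is large, and on it `p` must decrease when `o` increases.
  obtain ⟨c, hc⟩ := exists_chainRank X (fun u v => o u < o v ∧ p u < p v) o fun u v h => h.1
  obtain ⟨v, hv, hmax⟩ := Finset.exists_max_image X c hne
  set s := c v + 1 with hs
  by_cases hcard : X.card ≤ s ^ 2
  · obtain ⟨Y, hYX, hY, _, hch⟩ := exists_chain_of_rank (X := X)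
      (lt := fun u v => o u < o v ∧ p u < p v)
      (fun u v w h1 h2 => ⟨h1.1.trans h2.1, h1.2.trans h2.2⟩) (fun u h => lt_irrefl _ h.1)
      (fun v hv => (hc v hv).2) _ v hv rfl
    refine ⟨Y, hYX, by rwa [hY], Or.inl fun a ha b hb hab => ?_⟩
    rcases hch a ha b hb (fun h => by rw [h] at hab; exact lt_irrefl _ hab) with h | h
    · exact h.2
    · exact absurd h.1 (by omega)
  · push Not at hcard
    have hfib := Finset.card_eq_sum_card_fiberwise (s := X) (t := Finset.range s) (f := c)
      (fun a ha => by
        have := hmax a ha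
        simp only [Finset.coe_range, Set.mem_Iio]
        omega)
    obtain ⟨m', hm', hm2⟩ : ∃ m' ∈ Finset.range s, X.card ≤ s * (X.filter fun a => c a = m').card := by
      obtain ⟨m', hm', h⟩ := Finset.exists_max_image (Finset.range s)
        (fun m => (X.filter fun a => c a = m).card) ⟨0, by simp [hs]⟩
      refine ⟨m', hm', ?_⟩
      rw [hfib]
      exact (Finset.sum_le_card_nsmul _ _ _ h).trans (by simp)
    refine ⟨X.filter fun a => c a = m', Finset.filter_subset _ _, ?_, Or.inr ?_⟩
    · have hlt : s < (X.filter fun a => c a = m').card := by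
        by_contra! h
        nlinarith [Nat.mul_le_mul_left s h]
      nlinarith [Nat.mul_le_mul_right (X.filter fun a => c a = m').card hlt.le]
    · intro a ha b hb hab
      rw [Finset.mem_filter] at ha hb
      by_contra! h
      have hne : p a ≠ p b := fun h => by
        rw [hp ha.1 hb.1 h] at hab
        exact lt_irrefl _ hab
      have := (hc b hb.1).1 a ha.1 ⟨hab, lt_of_le_of_ne h hne⟩
      omega

/-- For the intervals from `o u` to `q u`: intersection is a transitive relation. -/
def TransCross (o q : V → ℕ) (Y : Finset V) : Prop :=
  ∀ u ∈ Y, ∀ v ∈ Y, ∀ w ∈ Y, o u < o v → o v < o w → o v < q u → o w < q v → o w < q u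

theorem TransCross.mono {o q : V → ℕ} {Y Y' : Finset V} (h : TransCross o q Y) (hY : Y' ⊆ Y) :
    TransCross o q Y' :=
  fun u hu v hv w hw => h u (hY hu) v (hY hv) w (hY hw)

/-- For nested intervals the condition is automatic. If both ends increase, take heights for the
order "ends before the other begins": they are monotone, and crossing intervals have heights
differing by at most one. Among heights of one parity, crossing intervals have equal height, and
intervals of equal height always cross. The larger parity class contains half of the set. -/
theorem exists_transCross (X : Finset V) (o q : V → ℕ) (ho : Set.InjOn o X)
    (hoq : ∀ v ∈ X, o v < q v)
    (hmono : (∀ u ∈ X, ∀ v ∈ X, o u < o v → q u < q v) ∨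
      ∀ u ∈ X, ∀ v ∈ X, o u < o v → q v < q u) :
    ∃ Y ⊆ X, X.card ≤ 2 * Y.card ∧ TransCross o q Y := by
  classical
  rcases hmono with hmono | hanti
  · obtain ⟨c, hc⟩ := exists_chainRank X (fun u v => o u < o v ∧ q u ≤ o v) o fun u v h => h.1
    have hcm : ∀ u ∈ X, ∀ v ∈ X, o u < o v → c u ≤ c v := by
      intro u hu v hv huv
      by_cases h0 : c u = 0
      · omega
      · obtain ⟨x, hx, hxu, hcx⟩ := (hc u hu).2 h0
        have := (hc v hv).1 x hx ⟨by omega, by omega⟩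
        omega
    have hfar : ∀ a ∈ X, ∀ b ∈ X, c a + 2 ≤ c b → ¬ o b < q a := by
      intro a ha b hb hab hcross
      obtain ⟨x, hx, hxb, hcx⟩ := (hc b hb).2 (by omega)
      have hax : o a < o x := by
        by_contra! h
        rcases h.eq_or_lt with h | h
        · rw [ho hx ha h] at hcx
          omega
        · have := hcm x hx a ha h
          omega
      have := hmono a ha x hx hax
      omega
    have htr : ∀ r, TransCross o q (X.filter fun v => c v % 2 = r) := by
      intro r u hu v hv w hw huv hvw h1 h2
      rw [Finset.mem_filter] at hu hv hw
      by_contra! h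
      have h3 := (hc w hw.1).1 u hu.1 ⟨huv.trans hvw, h⟩
      have h4 := hcm u hu.1 v hv.1 huv
      have h5 := hcm v hv.1 w hw.1 hvw
      by_cases h6 : c u + 2 ≤ c v
      · exact hfar u hu.1 v hv.1 h6 h1
      · exact hfar v hv.1 w hw.1 (by omega) h2
    have hsum := Finset.card_filter_add_card_filter_not (s := X) (fun v => c v % 2 = 0)
    have heq : (X.filter fun v => ¬ c v % 2 = 0) = X.filter fun v => c v % 2 = 1 :=
      Finset.filter_congr fun v _ => by omega
    rw [heq] at hsum
    rcases le_total (X.filter fun v => c v % 2 = 0).card (X.filter fun v => c v % 2 = 1).card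
      with h | h
    · exact ⟨_, Finset.filter_subset _ _, by omega, htr 1⟩
    · exact ⟨_, Finset.filter_subset _ _, by omega, htr 0⟩
  · refine ⟨X, le_rfl, by omega, fun u hu v hv w hw huv hvw _ _ => ?_⟩
    have := hoq w hw
    have := hanti u hu w hw (huv.trans hvw)
    omega

/-- The read number `i` of the variables in `Y` is in the order of the first reads, or in the
opposite order. -/
def MonoRead (p : ℕ → V → ℕ) (Y : Finset V) (i : ℕ) : Prop :=
  (∀ u ∈ Y, ∀ v ∈ Y, p 0 u < p 0 v → p i u < p i v) ∨
    ∀ u ∈ Y, ∀ v ∈ Y, p 0 u < p 0 v → p i v < p i u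

theorem MonoRead.mono {p : ℕ → V → ℕ} {Y Y' : Finset V} {i : ℕ} (h : MonoRead p Y i)
    (hY : Y' ⊆ Y) : MonoRead p Y' i :=
  h.imp (fun h u hu v hv => h u (hY hu) v (hY hv)) fun h u hu v hv => h u (hY hu) v (hY hv)

/-- The set `Y` is regularly interleaving with respect to `k` reads. -/
structure Regular (p : ℕ → V → ℕ) (k : ℕ) (Y : Finset V) : Prop where
  mono : ∀ i < k, MonoRead p Y i
  trans : ∀ i < k, ∀ j < i, TransCross (p j) (p i) Y

theorem Regular.subset {p : ℕ → V → ℕ} {k : ℕ} {Y Y' : Finset V} (h : Regular p k Y)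
    (hY : Y' ⊆ Y) : Regular p k Y' :=
  ⟨fun i hi => (h.mono i hi).mono hY, fun i hi j hj => (h.trans i hi j hj).mono hY⟩

/-- `k` reads of each variable, at different times. -/
structure Reads (p : ℕ → V → ℕ) (k : ℕ) : Prop where
  lt : ∀ i j v, i < j → j < k → p i v < p j v
  inj : ∀ i < k, ∀ j < k, ∀ u v, p i u = p j v → i = j ∧ u = v

/-- Each read after the first costs one application of Erdős–Szekeres, and hence one square root of
the size. -/
theorem exists_monoReads {p : ℕ → V → ℕ} {k : ℕ} (hp : Reads p k) (X : Finset V) (m : ℕ)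
    (hm : m + 1 ≤ k) :
    ∃ Y ⊆ X, X.card ≤ Y.card ^ 2 ^ m ∧ ∀ i ≤ m, MonoRead p Y i := by
  induction m with
  | zero =>
    refine ⟨X, le_rfl, by simp, fun i hi => Or.inl ?_⟩
    rw [Nat.le_zero.mp hi]
    exact fun _ _ _ _ h => h
  | succ m ih =>
    obtain ⟨Y, hYX, hY, hYm⟩ := ih (by omega)
    obtain ⟨Z, hZY, hZ, hZm⟩ := exists_monotone_or_antitone Y (p 0) (p (m + 1))
      fun u _ v _ h => (hp.inj _ (by omega) _ (by omega) u v h).2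
    refine ⟨Z, hZY.trans hYX, ?_, fun i hi => ?_⟩
    · calc X.card ≤ Y.card ^ 2 ^ m := hY
        _ ≤ (Z.card ^ 2) ^ 2 ^ m := Nat.pow_le_pow_left hZ _
        _ = Z.card ^ 2 ^ (m + 1) := by rw [← pow_mul, pow_succ']
    · rcases Nat.le_succ_iff.mp hi with h | rfl
      · exact (hYm i h).mono hZY
      · exact hZm

theorem MonoRead.comparable {p : ℕ → V → ℕ} {k : ℕ} (hp : Reads p k) {Y : Finset V} {i j : ℕ}
    (hj : j < k) (hmi : MonoRead p Y i) (hmj : MonoRead p Y j) :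
    (∀ u ∈ Y, ∀ v ∈ Y, p j u < p j v → p i u < p i v) ∨
      ∀ u ∈ Y, ∀ v ∈ Y, p j u < p j v → p i v < p i u := by
  have htri : ∀ u v, p j u < p j v → p 0 u < p 0 v ∨ p 0 v < p 0 u := by
    intro u v h
    rcases lt_trichotomy (p 0 u) (p 0 v) with h' | h' | h'
    · exact Or.inl h'
    · rw [(hp.inj 0 (by omega) 0 (by omega) u v h').2] at h
      exact absurd h (lt_irrefl _)
    · exact Or.inr h'
  rcases hmi with hi | hi <;> rcases hmj with hj | hj
  · refine Or.inl fun u hu v hv h => ?_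
    rcases htri u v h with h' | h'
    · exact hi u hu v hv h'
    · exact absurd (hj v hv u hu h') (by omega)
  · refine Or.inr fun u hu v hv h => ?_
    rcases htri u v h with h' | h'
    · exact absurd (hj u hu v hv h') (by omega)
    · exact hi v hv u hu h'
  · refine Or.inr fun u hu v hv h => ?_
    rcases htri u v h with h' | h'
    · exact hi u hu v hv h'
    · exact absurd (hj v hv u hu h') (by omega)
  · refine Or.inl fun u hu v hv h => ?_
    rcases htri u v h with h' | h'
    · exact absurd (hj u hu v hv h') (by omega)
    · exact hi v hv u hu h'

/-- Every set of variables has a large regularly interleaving subset. -/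
theorem exists_regular {p : ℕ → V → ℕ} {k : ℕ} (hk : 1 ≤ k) (hp : Reads p k) (X : Finset V) :
    ∃ Y ⊆ X, X.card ≤ (2 ^ (k * k) * Y.card) ^ 2 ^ (k - 1) ∧ Regular p k Y := by
  classical
  obtain ⟨Y, hYX, hY, hYm⟩ := exists_monoReads hp X (k - 1) (by omega)
  -- One halving for every pair of reads. Crude counting of the pairs by `k * k` gives the factor `2
  -- ^ (k * k)`.
  have key : ∀ P : Finset (ℕ × ℕ), (∀ x ∈ P, x.2 < x.1 ∧ x.1 < k) → ∃ Z ⊆ Y,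
      Y.card ≤ 2 ^ P.card * Z.card ∧ ∀ x ∈ P, TransCross (p x.2) (p x.1) Z := by
    intro P
    induction P using Finset.induction_on with
    | empty => exact fun _ => ⟨Y, le_rfl, by simp, by simp⟩
    | insert x P hx ih =>
      intro hP
      obtain ⟨Z, hZY, hZ, hZt⟩ := ih fun y hy => hP y (Finset.mem_insert_of_mem hy)
      obtain ⟨h1, h2⟩ := hP x (Finset.mem_insert_self _ _)
      obtain ⟨Z', hZ'Z, hZ', hZ't⟩ := exists_transCross Z (p x.2) (p x.1)
        (fun u _ v _ h => (hp.inj _ (by omega) _ (by omega) u v h).2)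
        (fun v _ => hp.lt _ _ v h1 h2)
        (MonoRead.comparable hp (by omega) ((hYm x.1 (by omega)).mono hZY)
          ((hYm x.2 (by omega)).mono hZY))
      refine ⟨Z', hZ'Z.trans hZY, ?_, fun y hy => ?_⟩
      · rw [Finset.card_insert_of_notMem hx, pow_succ]
        nlinarith [Nat.mul_le_mul_left (2 ^ P.card) hZ']
      · rcases Finset.mem_insert.mp hy with rfl | hy
        · exact hZ't
        · exact (hZt y hy).mono hZ'Z
  obtain ⟨Z, hZY, hZ, hZt⟩ := key
    ((Finset.range k ×ˢ Finset.range k).filter fun x => x.2 < x.1) (fun x hx => by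
      simp only [Finset.mem_filter, Finset.mem_product, Finset.mem_range] at hx
      exact ⟨hx.2, hx.1.1⟩)
  refine ⟨Z, hZY.trans hYX, ?_, fun i hi => (hYm i (by omega)).mono hZY, fun i hi j hj => ?_⟩
  · refine hY.trans (Nat.pow_le_pow_left (hZ.trans (Nat.mul_le_mul_right _ ?_)) _)
    refine Nat.pow_le_pow_right (by norm_num) ((Finset.card_filter_le _ _).trans ?_)
    rw [Finset.card_product, Finset.card_range]
  · refine hZt (i, j) ?_
    simp only [Finset.mem_filter, Finset.mem_product, Finset.mem_range]
    omega

end Chains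


/-! ### Regularly interleaving sets are read in few blocks -/

theorem switchRun_le_of_label (P : ℕ → Bool) (tag : ℕ → ℕ) (Λ : ℕ → ℕ) (L N : ℕ)
    (hΛ : ∀ i j, i < j → j < L → tag i ≠ 0 → tag j ≠ 0 → Λ i ≤ Λ j)
    (hN : ∀ i < L, tag i ≠ 0 → Λ i ≤ N)
    (hP : ∀ i j, i < j → j < L → tag i ≠ 0 → tag j ≠ 0 → Λ i = Λ j → P (tag i) = P (tag j)) :
    (switchRun P tag L).2 ≤ N + 1 := by
  classical
  refine switchRun_le_of_monotone_label P tag Λ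
    (fun x => decide (∃ i < L, tag i ≠ 0 ∧ Λ i = x ∧ P (tag i) = true)) L N hΛ hN fun i hi h0 => ?_
  rw [Bool.eq_iff_iff, decide_eq_true_iff]
  constructor
  · exact fun h => ⟨i, hi, h0, rfl, h⟩
  · rintro ⟨j, hj, hj0, hΛj, hPj⟩
    rcases lt_trichotomy i j with h | h | h
    · rw [hP i j h hj h0 hj0 hΛj.symm, hPj]
    · rw [h, hPj]
    · rw [← hP j i h hi hj0 h0 hΛj, hPj]

theorem switchRun_le_of_const (P : ℕ → Bool) (tag : ℕ → ℕ) (L N : ℕ)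
    (hP : ∀ i < L, ∀ j < L, tag i ≠ 0 → tag j ≠ 0 → P (tag i) = P (tag j)) :
    (switchRun P tag L).2 ≤ N + 1 :=
  switchRun_le_of_label P tag (fun _ => 0) L N (fun _ _ _ _ _ _ => le_rfl)
    (fun _ _ _ => Nat.zero_le _) fun i j hij hj hi0 hj0 _ => hP i (by omega) j hj hi0 hj0

theorem iff_of_iff_iff_iff {a b c : Prop} (h : (a ↔ c) ↔ (b ↔ c)) : a ↔ b := by
  tauto

section Label

variable {V : Type*} {p : ℕ → V → ℕ} {k : ℕ} {Y : Finset V}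

/-- The read number `i` of the variables in `Y` is in the order of the first reads. -/
def IncRead (p : ℕ → V → ℕ) (Y : Finset V) (i : ℕ) : Prop :=
  ∀ u ∈ Y, ∀ v ∈ Y, p 0 u < p 0 v → p i u < p i v

theorem Regular.dec (h : Regular p k Y) {i : ℕ} (hi : i < k) (hd : ¬ IncRead p Y i) :
    ∀ u ∈ Y, ∀ v ∈ Y, p 0 u < p 0 v → p i v < p i u :=
  (h.mono i hi).resolve_left hd

theorem IncRead.le (hp : Reads p k) {i : ℕ} (hi : i < k)
    (hd : IncRead p Y i) {u v : V} (hu : u ∈ Y) (hv : v ∈ Y) (huv : p 0 u ≤ p 0 v) :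
    p i u ≤ p i v := by
  rcases huv.eq_or_lt with h' | h'
  · rw [(hp.inj 0 (by omega) 0 (by omega) u v h').2]
  · exact (hd u hu v hv h').le

theorem Regular.dec_le (h : Regular p k Y) (hp : Reads p k) {i : ℕ} (hi : i < k)
    (hd : ¬ IncRead p Y i) {u v : V} (hu : u ∈ Y) (hv : v ∈ Y) (huv : p 0 u ≤ p 0 v) :
    p i v ≤ p i u := by
  rcases huv.eq_or_lt with h' | h'
  · rw [(hp.inj 0 (by omega) 0 (by omega) u v h').2]
  · exact (h.dec hi hd u hu v hv h').le

/-- Reads in opposite directions are separated in time. -/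
theorem Regular.separated (h : Regular p k Y) (hp : Reads p k) {i j : ℕ} (hij : i < j) (hj : j < k)
    (hd : ¬ (IncRead p Y i ↔ IncRead p Y j)) {u v : V} (hu : u ∈ Y) (hv : v ∈ Y) :
    p i u < p j v := by
  have hi : i < k := hij.trans hj
  by_cases hdi : IncRead p Y i
  · have hdj : ¬ IncRead p Y j := fun h => hd ⟨fun _ => h, fun _ => hdi⟩
    rcases le_total (p 0 u) (p 0 v) with h' | h'
    · exact (IncRead.le hp hi hdi hu hv h').trans_lt (hp.lt i j v hij hj)
    · exact (hp.lt i j u hij hj).trans_le (h.dec_le hp hj hdj hv hu h')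
  · have hdj : IncRead p Y j := by
      by_contra hdj
      exact hd ⟨fun h => absurd h hdi, fun h => absurd h hdj⟩
    rcases le_total (p 0 u) (p 0 v) with h' | h'
    · exact (hp.lt i j u hij hj).trans_le (IncRead.le hp hj hdj hu hv h')
    · exact (h.dec_le hp hi hdi hv hu h').trans_lt (hp.lt i j v hij hj)

open Classical in
theorem Regular.lt_iff (h : Regular p k Y) (hp : Reads p k) {i j : ℕ} (hi : i < k) (hj : j < k)
    (hd : IncRead p Y i ↔ IncRead p Y j) {u v : V} (hu : u ∈ Y) (hv : v ∈ Y) :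
    p i u < p i v ↔ p j u < p j v := by
  have main : ∀ a, a < k → (p a u < p a v ↔ (if IncRead p Y a then p 0 u < p 0 v else
      p 0 v < p 0 u)) := by
    intro a ha
    split_ifs with hda
    · constructor
      · intro h'
        by_contra! h''
        have := IncRead.le hp ha hda hv hu h''
        omega
      · exact hda u hu v hv
    · constructor
      · intro h'
        by_contra! h''
        have := h.dec_le hp ha hda hu hv h''
        omega
      · exact h.dec ha hda v hv u hu
  rw [main i hi, main j hj]
  simp only [hd]

open Classical in
/-- The number of switches of an initial segment of a regularly interleaving set. -/
theorem Regular.switchRun_le (h : Regular p k Y) (hp : Reads p k) (L : ℕ) (tag : ℕ → ℕ)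
    (P : ℕ → Bool) (S : Finset V) (hS : ∀ u ∈ Y, ∀ v ∈ Y, v ∈ S → p 0 u ≤ p 0 v → u ∈ S)
    (htag : ∀ l < L, tag l ≠ 0 → ∃ i < k, ∃ v ∈ Y, p i v = l ∧ (P (tag l) = true ↔ v ∈ S)) :
    (switchRun P tag L).2 ≤ 2 * k + 2 := by
  by_cases hfull : ∀ v ∈ Y, v ∈ S
  · refine switchRun_le_of_const P tag L (2 * k + 1) fun i hi j hj hi0 hj0 => ?_
    obtain ⟨_, _, u, hu, _, hu'⟩ := htag i hi hi0
    obtain ⟨_, _, v, hv, _, hv'⟩ := htag j hj hj0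
    rw [hu'.mpr (hfull u hu), hv'.mpr (hfull v hv)]
  by_cases hempty : ∀ v ∈ Y, v ∉ S
  · refine switchRun_le_of_const P tag L (2 * k + 1) fun i hi j hj hi0 hj0 => ?_
    obtain ⟨_, _, u, hu, _, hu'⟩ := htag i hi hi0
    obtain ⟨_, _, v, hv, _, hv'⟩ := htag j hj hj0
    have h1 := mt hu'.mp (hempty u hu)
    have h2 := mt hv'.mp (hempty v hv)
    rw [Bool.not_eq_true] at h1 h2
    rw [h1, h2]
  push Not at hfull hempty
  obtain ⟨b, hb, hbmax⟩ := Finset.exists_max_image (Y.filter (· ∈ S)) (p 0) (by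
    obtain ⟨v, hv, hvS⟩ := hempty
    exact ⟨v, Finset.mem_filter.mpr ⟨hv, hvS⟩⟩)
  obtain ⟨b', hb', hbmin⟩ := Finset.exists_min_image (Y.filter (· ∉ S)) (p 0) (by
    obtain ⟨v, hv, hvS⟩ := hfull
    exact ⟨v, Finset.mem_filter.mpr ⟨hv, hvS⟩⟩)
  rw [Finset.mem_filter] at hb hb'
  simp only [Finset.mem_filter, and_imp] at hbmax hbmin
  -- By first reads, `b` is the last variable in `S` and `b'` the first one outside. An increasing
  -- read goes through `S` first, ending with `b`; a decreasing read goes through the complement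
  -- first, ending with `b'`. So `e i` is the last time before read number `i` crosses the boundary.
  set x : ℕ → V := fun i => if IncRead p Y i then b else b' with hx
  have hxY : ∀ i, x i ∈ Y := fun i => by
    simp only [hx]
    split_ifs
    · exact hb.1
    · exact hb'.1
  set e : ℕ → ℕ := fun i => p i (x i) with he
  have hA : ∀ i < k, ∀ v ∈ Y, (p i v ≤ e i ↔ (v ∈ S ↔ IncRead p Y i)) := by
    intro i hi v hv
    simp only [he, hx]
    split_ifs with hd
    · simp only [hd, iff_true]
      constructor
      · intro hle
        by_contra hvS
        have h1 : p 0 b < p 0 v := by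
          by_contra! h1
          exact hvS (hS v hv b hb.1 hb.2 h1)
        exact absurd (hd b hb.1 v hv h1) (by omega)
      · exact fun hvS => IncRead.le hp hi hd hv hb.1 (hbmax v hv hvS)
    · simp only [hd, iff_false]
      constructor
      · intro hle hvS
        have h1 : p 0 v < p 0 b' := by
          by_contra! h1
          exact hb'.2 (hS b' hb'.1 v hv hvS h1)
        exact absurd (h.dec hi hd v hv b' hb'.1 h1) (by omega)
      · exact fun hvS => h.dec_le hp hi hd hb'.1 hv (hbmin v hv hvS)
  have hxeq : ∀ i j, (IncRead p Y i ↔ IncRead p Y j) → x i = x j := by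
    intro i j hd
    simp only [hx, hd]
  have hemono : ∀ i j, i < j → j < k → e i < e j := by
    intro i j hij hj
    by_cases hd : IncRead p Y i ↔ IncRead p Y j
    · simp only [he]
      rw [hxeq i j hd]
      exact hp.lt i j _ hij hj
    · exact h.separated hp hij hj hd (hxY i) (hxY j)
  -- The phase counts the boundary times that have passed; two times in the same phase lie on the
  -- same side of every `e i`.
  set phase : ℕ → ℕ := fun l => ((Finset.range k).filter fun i => e i < l).card with hphase
  have hphmono : ∀ l l', l ≤ l' → phase l ≤ phase l' := fun l l' hl =>
    Finset.card_le_card (Finset.monotone_filter_right _ fun i _ hi => lt_of_lt_of_le hi hl)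
  have hpheq : ∀ l l', l ≤ l' → phase l = phase l' → ∀ i < k, (e i < l ↔ e i < l') := by
    intro l l' hl heq i hi
    have hsub : ((Finset.range k).filter fun i => e i < l) ⊆
        (Finset.range k).filter fun i => e i < l' :=
      Finset.monotone_filter_right _ fun i _ hi => lt_of_lt_of_le hi hl
    have := Finset.eq_of_subset_of_card_le hsub heq.symm.le
    have hi' := Finset.ext_iff.mp this i
    simpa [hi] using hi'
  -- the type of the read at time `l`
  set ty : ℕ → Prop := fun l => ∃ i < k, ∃ v ∈ Y, p i v = l ∧ l ≤ e i with hty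
  have htyiff : ∀ i < k, ∀ v ∈ Y, (ty (p i v) ↔ p i v ≤ e i) := by
    intro i hi v hv
    constructor
    · rintro ⟨j, hj, u, hu, hju, hle⟩
      obtain ⟨rfl, rfl⟩ := hp.inj j hj i hi u v hju
      exact hle
    · exact fun hle => ⟨i, hi, v, hv, rfl, hle⟩
  -- in a phase, the reads of the first type come after those of the second type
  have horder : ∀ i < k, ∀ j < k, ∀ v ∈ Y, ∀ u ∈ Y, p i v < p j u →
      phase (p i v) = phase (p j u) → p i v ≤ e i → ¬ p j u ≤ e j → False := by
    intro i hi j hj v hv u hu hlt hph hAi hBj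
    have hph' := hpheq _ _ hlt.le hph
    have h1 : e j < p i v := (hph' j hj).mpr (by omega)
    have h2 : p j u ≤ e i := by
      by_contra! h2
      have := (hph' i hi).mpr h2
      omega
    have hij : j < i := by
      rcases lt_trichotomy i j with h3 | h3 | h3
      · have := hemono i j h3 hj
        omega
      · subst h3
        omega
      · exact h3
    by_cases hd : IncRead p Y j ↔ IncRead p Y i
    · have hxx := hxeq j i hd
      have h4 : e j = p j (x i) := by simp only [he, hxx]
      have h5 : e i = p i (x i) := rfl
      rw [h4] at h1 hBj
      rw [h5] at hAi h2
      have h6 : p j u < p i (x i) := by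
        refine lt_of_le_of_ne h2 fun h6 => ?_
        have := (hp.inj j hj i hi _ _ h6).1
        omega
      rcases hAi.eq_or_lt with h7 | h7
      · omega
      · have h8 := (h.lt_iff hp hj hi hd hv (hxY i)).mpr h7
        -- The intervals between read `j` and read `i` cross for `v` and `x i`, and for `x i` and
        -- `u`. By transitivity they cross for `v` and `u`, so `p j u < p i v`, against the assumed
        -- order of times.
        have := h.trans i hi j hij v hv (x i) (hxY i) u hu h8 (by omega) h1 h6
        omega
    · have := h.separated hp hij hi hd hu hv
      omega
  -- There are `k + 1` phases with two types in each, so the labels are at most `2 * k + 1`.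
  refine switchRun_le_of_label P tag (fun l => 2 * phase l + if ty l then 1 else 0) L (2 * k + 1)
    ?_ ?_ ?_
  · intro l l' hl hl' h0 h0'
    obtain ⟨i, hi, v, hv, rfl, _⟩ := htag l (by omega) h0
    obtain ⟨j, hj, u, hu, rfl, _⟩ := htag l' hl' h0'
    simp only [htyiff i hi v hv, htyiff j hj u hu]
    have hm := hphmono _ _ hl.le
    rcases hm.eq_or_lt with hm | hm
    · split_ifs with h1 h2 h2
      · omega
      · exact (horder i hi j hj v hv u hu hl hm h1 h2).elim
      · omega
      · omega
    · split_ifs <;> omega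
  · intro l _ _
    have : phase l ≤ k := (Finset.card_filter_le _ _).trans (by simp)
    split_ifs <;> omega
  · intro l l' hl hl' h0 h0' heq
    obtain ⟨i, hi, v, hv, rfl, hPv⟩ := htag l (by omega) h0
    obtain ⟨j, hj, u, hu, rfl, hPu⟩ := htag l' hl' h0'
    simp only [htyiff i hi v hv, htyiff j hj u hu] at heq
    have hph : phase (p i v) = phase (p j u) := by split_ifs at heq <;> omega
    have htyp : p i v ≤ e i ↔ p j u ≤ e j := by split_ifs at heq <;> omega
    have hph' := hpheq _ _ hl.le hph
    -- For `i < j`, opposite directions would give `e i < p j u` and `p i v < e j`, which equal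
    -- phases and equal types exclude. For `j < i`, separation contradicts the order of the two
    -- times.
    have hd : IncRead p Y i ↔ IncRead p Y j := by
      by_contra hd
      rcases lt_trichotomy i j with hij | hij | hij
      · have s1 : e i < p j u := h.separated hp hij hj hd (hxY i) hu
        have s2 : p i v < e j := h.separated hp hij hj hd hv (hxY j)
        have h1 := (hph' i hi).mpr s1
        have h2 := (hph' j hj)
        by_cases hty : p i v ≤ e i
        · omega
        · have := mt htyp.mpr hty
          omega
      · rw [hij] at hd
        exact hd Iff.rfl
      · have := h.separated hp hij hi (fun h => hd h.symm) hu hv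
        omega
    have e1 := hA i hi v hv
    have e2 := hA j hj u hu
    rw [htyp, e2, hd] at e1
    rw [Bool.eq_iff_iff, hPv, hPu]
    exact (iff_of_iff_iff_iff e1).symm

end Label


/-! ### Positions from a read-k order -/

/-- The levels in which a variable is read, completed by later times to a set of size `k`. -/
def readTimes {n L : ℕ} (k : ℕ) (σ : Fin L → Fin n) (v : Fin n) : Finset ℕ :=
  ((Finset.univ.filter fun l => σ l = v).map Fin.valEmbedding) ∪
    (Finset.range (k - (Finset.univ.filter fun l => σ l = v).card)).map
      -- Disjoint blocks of `k` times beyond `L`, one block per variable, keep the added times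
      -- distinct from each other and from the levels.
      (addLeftEmbedding (L + v * k))

theorem card_readTimes {n L k : ℕ} {σ : Fin L → Fin n} (h : IsReadK k σ) (v : Fin n) :
    (readTimes k σ v).card = k := by
  rw [readTimes, Finset.card_union_of_disjoint, Finset.card_map, Finset.card_map, Finset.card_range]
  · have := h v
    omega
  · rw [Finset.disjoint_left]
    intro a ha ha'
    simp only [Finset.mem_map, Fin.valEmbedding_apply, addLeftEmbedding_apply] at ha ha'
    obtain ⟨l, _, rfl⟩ := ha
    obtain ⟨b, _, hb⟩ := ha'
    have := l.2
    omega

theorem mem_readTimes {n L k : ℕ} {σ : Fin L → Fin n} {v : Fin n} {t : ℕ}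
    (h : t ∈ readTimes k σ v) :
    (∃ hl : t < L, σ ⟨t, hl⟩ = v) ∨ ∃ r < k, t = L + v * k + r := by
  rw [readTimes, Finset.mem_union] at h
  simp only [Finset.mem_map, Fin.valEmbedding_apply, addLeftEmbedding_apply, Finset.mem_filter,
    Finset.mem_univ, true_and, Finset.mem_range] at h
  rcases h with ⟨l, hl, rfl⟩ | ⟨r, hr, rfl⟩
  · exact Or.inl ⟨l.2, hl⟩
  · exact Or.inr ⟨r, by omega, rfl⟩

theorem eq_of_mem_readTimes {n L k : ℕ} {σ : Fin L → Fin n} {u v : Fin n} {t : ℕ}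
    (hu : t ∈ readTimes k σ u) (hv : t ∈ readTimes k σ v) : u = v := by
  rcases mem_readTimes hu with ⟨h1, h2⟩ | ⟨r, hr, h2⟩ <;>
    rcases mem_readTimes hv with ⟨h3, h4⟩ | ⟨s, hs, h4⟩
  · rw [← h2, ← h4]
  · omega
  · omega
  · have h5 : (u : ℕ) * k + r = v * k + s := by omega
    have h6 : ((u : ℕ) * k + r) / k = u := by
      rw [mul_comm, Nat.mul_add_div (by omega), Nat.div_eq_of_lt hr, add_zero]
    have h7 : ((v : ℕ) * k + s) / k = v := by
      rw [mul_comm, Nat.mul_add_div (by omega), Nat.div_eq_of_lt hs, add_zero]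
    refine Fin.ext ?_
    rw [← h6, ← h7, h5]

/-- Listing the `k` times of each variable in increasing order makes all variables have exactly `k`
reads. The added times are beyond the last level, so they do not affect the switches. -/
theorem exists_reads {n L k : ℕ} {σ : Fin L → Fin n} (h : IsReadK k σ) :
    ∃ p : ℕ → Fin n → ℕ, Reads p k ∧ ∀ l : Fin L, ∃ i < k, p i (σ l) = l := by
  set f : (v : Fin n) → Fin k ↪o ℕ := fun v =>
    (readTimes k σ v).orderEmbOfFin (card_readTimes h v) with hf
  have hmem : ∀ v i, f v i ∈ readTimes k σ v := fun v i => Finset.orderEmbOfFin_mem _ _ _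
  refine ⟨fun i v => if hi : i < k then f v ⟨i, hi⟩ else 0, ⟨?_, ?_⟩, ?_⟩
  · intro i j v hij hj
    simp only [hj, hij.trans hj, dif_pos]
    exact (f v).strictMono hij
  · intro i hi j hj u v huv
    simp only [hi, hj, dif_pos] at huv
    have huv' : u = v := eq_of_mem_readTimes (hmem u ⟨i, hi⟩) (huv ▸ hmem v ⟨j, hj⟩)
    subst huv'
    exact ⟨congrArg Fin.val ((f u).injective huv), rfl⟩
  · intro l
    have hl : (l : ℕ) ∈ readTimes k σ (σ l) := by
      rw [readTimes, Finset.mem_union]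
      left
      simp only [Finset.mem_map, Finset.mem_filter, Finset.mem_univ, true_and,
        Fin.valEmbedding_apply]
      exact ⟨l, rfl, rfl⟩
    rw [← Finset.mem_coe, ← Finset.range_orderEmbOfFin _ (card_readTimes h (σ l))] at hl
    obtain ⟨i, hi⟩ := hl
    exact ⟨i, i.2, by simpa [hf] using hi⟩

/-- The position is the rank by first reads, so that initial segments of positions are those to
which the bound on the blocks applies. -/
theorem Regular.exists_validPos {n L k : ℕ} {σ : Fin L → Fin n} (hk : 1 ≤ k)
    {p : ℕ → Fin n → ℕ} (hp : Reads p k) (hσ : ∀ l : Fin L, ∃ i < k, p i (σ l) = l)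
    {Y : Finset (Fin n)} (h : Regular p k Y) :
    ∃ pos : ℕ → ℕ, (∀ v : Fin n, pos v ≠ 0 ↔ v ∈ Y) ∧ (∀ v, pos v ≤ Y.card) ∧
      ValidPos σ (2 * k + 2) pos := by
  classical
  set r : Fin n → ℕ := fun v => (Y.filter fun u => p 0 u ≤ p 0 v).card with hr
  have hr0 : ∀ v ∈ Y, r v ≠ 0 := fun v hv =>
    Finset.card_ne_zero_of_mem (Finset.mem_filter.mpr ⟨hv, le_rfl⟩)
  have hrlt : ∀ u ∈ Y, ∀ v ∈ Y, p 0 u < p 0 v → r u < r v := by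
    intro u hu v hv huv
    refine Finset.card_lt_card ⟨Finset.monotone_filter_right _ fun x _ hx => hx.trans huv.le, ?_⟩
    intro hsub
    have := hsub (Finset.mem_filter.mpr ⟨hv, le_rfl⟩)
    rw [Finset.mem_filter] at this
    omega
  have hrle : ∀ u ∈ Y, ∀ v ∈ Y, (r u ≤ r v ↔ p 0 u ≤ p 0 v) := by
    intro u hu v hv
    constructor
    · intro h'
      by_contra! h''
      have := hrlt v hv u hu h''
      omega
    · intro h'
      exact Finset.card_le_card (Finset.monotone_filter_right _ fun x _ hx => hx.trans h')
  set pos : ℕ → ℕ := fun v => if hv : v < n then if (⟨v, hv⟩ : Fin n) ∈ Y then r ⟨v, hv⟩ else 0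
    else 0 with hpos
  have hposv : ∀ v : Fin n, pos v = if v ∈ Y then r v else 0 := fun v => by simp [hpos]
  have hposY : ∀ v : Fin n, pos v ≠ 0 ↔ v ∈ Y := by
    intro v
    rw [hposv]
    split_ifs with hv
    · simp [hv, hr0 v hv]
    · simp [hv]
  refine ⟨pos, hposY, ?_, ?_, ?_⟩
  · intro v
    simp only [hpos]
    split_ifs
    · exact Finset.card_filter_le _ _
    · exact Nat.zero_le _
    · exact Nat.zero_le _
  · intro u hu v hv hu0 huv
    have hu0' : pos (⟨u, hu⟩ : Fin n) ≠ 0 := hu0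
    have hv0' : pos (⟨v, hv⟩ : Fin n) ≠ 0 := by
      change pos v ≠ 0
      rwa [← huv]
    have hu' := (hposY _).mp hu0'
    have hv' := (hposY _).mp hv0'
    have huv' : pos (⟨u, hu⟩ : Fin n) = pos (⟨v, hv⟩ : Fin n) := huv
    rw [hposv, hposv, if_pos hu', if_pos hv'] at huv'
    have h1 := (hrle _ hu' _ hv').mp huv'.le
    have h2 := (hrle _ hv' _ hu').mp huv'.ge
    have := (hp.inj 0 hk 0 hk _ _ (le_antisymm h1 h2)).2
    exact congrArg Fin.val this
  · intro q
    refine h.switchRun_le hp L _ _ (Y.filter fun v => r v ≤ q) ?_ ?_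
    · intro u hu v hv hvq huv
      rw [Finset.mem_filter] at hvq ⊢
      exact ⟨hu, ((hrle u hu v hv).mpr huv).trans hvq.2⟩
    · intro l hl h0
      rw [readTag, dif_pos hl] at h0 ⊢
      obtain ⟨i, hi, hpi⟩ := hσ ⟨l, hl⟩
      have hY := (hposY _).mp h0
      refine ⟨i, hi, σ ⟨l, hl⟩, hY, hpi, ?_⟩
      rw [decide_eq_true_iff, Finset.mem_filter, hposv, if_pos hY]
      simp [hY]

/-- Every set of unassigned variables has a large subset with valid positions, and so has every
smaller number. -/
theorem exists_validPos {n L k : ℕ} {σ : Fin L → Fin n} (hk : 1 ≤ k) (h : IsReadK k σ)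
    (X : Finset (Fin n)) :
    ∃ s, X.card ≤ (2 ^ (k * k) * s) ^ 2 ^ (k - 1) ∧ ∀ m ≤ s, ∃ (Y : Finset (Fin n)) (pos : ℕ → ℕ),
      Y ⊆ X ∧ Y.card = m ∧ (∀ v : Fin n, pos v ≠ 0 ↔ v ∈ Y) ∧ (∀ v, pos v ≤ m) ∧
        ValidPos σ (2 * k + 2) pos := by
  obtain ⟨p, hp, hσ⟩ := exists_reads h
  obtain ⟨Y, hYX, hY, hreg⟩ := exists_regular hk hp X
  refine ⟨Y.card, hY, fun m hm => ?_⟩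
  -- Regularity passes to subsets, so the size can be cut down to whatever the search allows.
  obtain ⟨Z, hZY, hZ⟩ := Finset.exists_subset_card_eq hm
  obtain ⟨pos, h1, h2, h3⟩ := (hreg.subset hZY).exists_validPos hk hp hσ
  exact ⟨Z, pos, hZY.trans hYX, hZ, h1, fun v => hZ ▸ h2 v, h3⟩


/-! ### Reasoning about programs -/

namespace Prog

/-- The program contains an assignment to the register `r` for numbers. -/
def wReg : Prog → ℕ → Bool
  | setReg r _, x => r == x
  | seq p q, x => p.wReg x || q.wReg x
  | ite _ p q, x => p.wReg x || q.wReg x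
  | loop _ p, x => p.wReg x
  | _, _ => false

/-- The program contains an assignment to the array `a` of numbers. -/
def wMem : Prog → ℕ → Bool
  | setMem a _ _, x => a == x
  | seq p q, x => p.wMem x || q.wMem x
  | ite _ p q, x => p.wMem x || q.wMem x
  | loop _ p, x => p.wMem x
  | _, _ => false

/-- The program contains an assignment to the register `r` for field elements. -/
def wFReg : Prog → ℕ → Bool
  | setFReg r _, x => r == x
  | seq p q, x => p.wFReg x || q.wFReg x
  | ite _ p q, x => p.wFReg x || q.wFReg x
  | loop _ p, x => p.wFReg x
  | _, _ => false

/-- The program contains an assignment to the array `a` of field elements. -/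
def wFMem : Prog → ℕ → Bool
  | setFMem a _ _, x => a == x
  | seq p q, x => p.wFMem x || q.wFMem x
  | ite _ p q, x => p.wFMem x || q.wFMem x
  | loop _ p, x => p.wFMem x
  | _, _ => false

/-- The stores agree where the program does not write. -/
structure Same {F : Type*} (p : Prog) (s t : Store F) : Prop where
  reg : ∀ r, p.wReg r = false → t.reg r = s.reg r
  mem : ∀ a, p.wMem a = false → t.mem a = s.mem a
  freg : ∀ r, p.wFReg r = false → t.freg r = s.freg r
  fmem : ∀ a, p.wFMem a = false → t.fmem a = s.fmem a

theorem Same.refl {F : Type*} (p : Prog) (s : Store F) : p.Same s s :=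
  ⟨fun _ _ => rfl, fun _ _ => rfl, fun _ _ => rfl, fun _ _ => rfl⟩

theorem Same.trans {F : Type*} {p : Prog} {s t u : Store F} (h : p.Same s t) (h' : p.Same t u) :
    p.Same s u :=
  ⟨fun r hr => (h'.reg r hr).trans (h.reg r hr), fun r hr => (h'.mem r hr).trans (h.mem r hr),
    fun r hr => (h'.freg r hr).trans (h.freg r hr), fun r hr => (h'.fmem r hr).trans (h.fmem r hr)⟩

theorem Same.of_le {F : Type*} {p q : Prog} {s t : Store F} (h : p.Same s t)
    (h1 : ∀ r, q.wReg r = false → p.wReg r = false) (h2 : ∀ r, q.wMem r = false → p.wMem r = false)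
    (h3 : ∀ r, q.wFReg r = false → p.wFReg r = false)
    (h4 : ∀ r, q.wFMem r = false → p.wFMem r = false) : q.Same s t :=
  ⟨fun r hr => h.reg r (h1 r hr), fun r hr => h.mem r (h2 r hr),
    fun r hr => h.freg r (h3 r hr), fun r hr => h.fmem r (h4 r hr)⟩

theorem Same.seq_left {F : Type*} {p q : Prog} {s t : Store F} (h : p.Same s t) :
    (p.seq q).Same s t := by
  refine h.of_le ?_ ?_ ?_ ?_ <;> intro r hr <;> simp_all [wReg, wMem, wFReg, wFMem]

theorem Same.seq_right {F : Type*} {p q : Prog} {s t : Store F} (h : q.Same s t) :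
    (p.seq q).Same s t := by
  refine h.of_le ?_ ?_ ?_ ?_ <;> intro r hr <;> simp_all [wReg, wMem, wFReg, wFMem]

end Prog

/-- The frame rule. The sets of written cells are computed from the program text, so for a concrete
program the side conditions hold by `rfl`. -/
theorem Runs.same {F : Type*} [Field F] {enum : ℕ → F} {p : Prog} {s t : Store F} {c : ℕ}
    (h : Runs enum p s t c) : p.Same s t := by
  induction h with
  | skip s => exact Prog.Same.refl _ _
  | setReg r e s =>
    refine ⟨fun x hx => ?_, fun _ _ => rfl, fun _ _ => rfl, fun _ _ => rfl⟩
    simp only [Prog.wReg, beq_eq_false_iff_ne, ne_eq] at hx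
    simp [Function.update_of_ne (Ne.symm hx)]
  | setMem a i e s =>
    refine ⟨fun _ _ => rfl, fun x hx => ?_, fun _ _ => rfl, fun _ _ => rfl⟩
    simp only [Prog.wMem, beq_eq_false_iff_ne, ne_eq] at hx
    simp [Function.update_of_ne (Ne.symm hx)]
  | setFReg r e s =>
    refine ⟨fun _ _ => rfl, fun _ _ => rfl, fun x hx => ?_, fun _ _ => rfl⟩
    simp only [Prog.wFReg, beq_eq_false_iff_ne, ne_eq] at hx
    simp [Function.update_of_ne (Ne.symm hx)]
  | setFMem a i e s =>
    refine ⟨fun _ _ => rfl, fun _ _ => rfl, fun _ _ => rfl, fun x hx => ?_⟩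
    simp only [Prog.wFMem, beq_eq_false_iff_ne, ne_eq] at hx
    simp [Function.update_of_ne (Ne.symm hx)]
  | seq _ _ ih1 ih2 => exact ih1.seq_left.trans ih2.seq_right
  | ite_true _ _ ih =>
    refine ih.of_le ?_ ?_ ?_ ?_ <;> intro r hr <;>
      simp_all [Prog.wReg, Prog.wMem, Prog.wFReg, Prog.wFMem]
  | ite_false _ _ ih =>
    refine ih.of_le ?_ ?_ ?_ ?_ <;> intro r hr <;>
      simp_all [Prog.wReg, Prog.wMem, Prog.wFReg, Prog.wFMem]
  | loop_true _ _ _ ih1 ih2 =>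
    refine (ih1.of_le ?_ ?_ ?_ ?_).trans ih2 <;> intro r hr <;>
      simpa [Prog.wReg, Prog.wMem, Prog.wFReg, Prog.wFMem] using hr
  | loop_false _ => exact Prog.Same.refl _ _

/-- The program `p`, started on `s`, halts in at most `X ^ m` steps on a store that satisfies `Q`. -/
def Tri {F : Type*} [Field F] (enum : ℕ → F) (X : ℕ) (p : Prog) (s : Store F) (m : ℕ)
    (Q : Store F → Prop) : Prop :=
  ∃ t c, Runs enum p s t c ∧ c ≤ X ^ m ∧ Q t

namespace Tri

variable {F : Type*} [Field F] {enum : ℕ → F} {X : ℕ} {p q : Prog} {s : Store F} {m : ℕ}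
  {Q : Store F → Prop}

theorem mono (h : Tri enum X p s m Q) {Q' : Store F → Prop} (hQ : ∀ t, p.Same s t → Q t → Q' t) :
    Tri enum X p s m Q' := by
  obtain ⟨t, c, h1, h2, h3⟩ := h
  exact ⟨t, c, h1, h2, hQ t h1.same h3⟩

variable [hX : Fact (16 ≤ X)]

theorem weaken {m' : ℕ} (h : Tri enum X p s m' Q) (hm : m' ≤ m) : Tri enum X p s m Q := by
  obtain ⟨t, c, h1, h2, h3⟩ := h
  exact ⟨t, c, h1, h2.trans (Nat.pow_le_pow_right (by have := hX.out; omega) hm), h3⟩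

/-- Since `X ≥ 16`, a sum of two costs is absorbed by one more power of `X`. Thus only exponents
have to be tracked, and these depend on the program text alone. -/
theorem seq {m₁ m₂ : ℕ} {Q₁ : Store F → Prop} (h₁ : Tri enum X p s m₁ Q₁)
    (h₂ : ∀ t, p.Same s t → Q₁ t → Tri enum X q t m₂ Q) (hm₁ : m₁ < m) (hm₂ : m₂ < m) :
    Tri enum X (p.seq q) s m Q := by
  obtain ⟨t, c, h1, h2, h3⟩ := h₁
  obtain ⟨u, c', h1', h2', h3'⟩ := h₂ t h1.same h3
  refine ⟨u, c + c', h1.seq h1', ?_, h3'⟩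
  have hX' := hX.out
  obtain ⟨m, rfl⟩ : ∃ m', m = m' + 1 := ⟨m - 1, by omega⟩
  have a1 : X ^ m₁ ≤ X ^ m := Nat.pow_le_pow_right (by omega) (by omega)
  have a2 : X ^ m₂ ≤ X ^ m := Nat.pow_le_pow_right (by omega) (by omega)
  rw [pow_succ]
  nlinarith [Nat.mul_le_mul_left (X ^ m) hX']

theorem ite {b : Test} {m' : ℕ} (hb : b.cost ≤ 16) (h₁ : b.Holds enum s → Tri enum X p s m' Q)
    (h₂ : ¬ b.Holds enum s → Tri enum X q s m' Q) (hm : m' < m) (hm1 : 2 ≤ m) :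
    Tri enum X (.ite b p q) s m Q := by
  have hX' := hX.out
  obtain ⟨m, rfl⟩ : ∃ m', m = m' + 1 := ⟨m - 1, by omega⟩
  have a1 : X ^ m' ≤ X ^ m := Nat.pow_le_pow_right (by omega) (by omega)
  have a2 : X ^ 1 ≤ X ^ m := Nat.pow_le_pow_right (by omega) (by omega)
  have a3 : b.cost + X ^ m' ≤ X ^ (m + 1) := by
    rw [pow_succ]
    nlinarith [Nat.mul_le_mul_left (X ^ m) hX']
  by_cases h : b.Holds enum s
  · obtain ⟨t, c, h1, h2, h3⟩ := h₁ h
    exact ⟨t, _, h1.ite_true h, by omega, h3⟩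
  · obtain ⟨t, c, h1, h2, h3⟩ := h₂ h
    exact ⟨t, _, h1.ite_false h, by omega, h3⟩

/-- The rule for loops with a variant. -/
theorem loop {b : Test} (I : Store F → Prop) (v : Store F → ℕ) {m' : ℕ} (hb : b.cost ≤ 16)
    (hI : I s) (hv : v s ≤ X)
    (hbody : ∀ t, (Prog.loop b p).Same s t → I t → b.Holds enum t →
      Tri enum X p t m' fun u => I u ∧ v u < v t)
    (hend : ∀ t, (Prog.loop b p).Same s t → I t → ¬ b.Holds enum t → Q t) (hm : m' + 3 ≤ m) :
    Tri enum X (.loop b p) s m Q := by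
  have hX' := hX.out
  have key : ∀ N t, (Prog.loop b p).Same s t → I t → v t ≤ N →
      ∃ u c, Runs enum (.loop b p) t u c ∧ c ≤ N * (16 + X ^ m') + 16 ∧ Q u := by
    intro N
    induction N with
    | zero =>
      intro t hst hIt hvt
      have hnb : ¬ b.Holds enum t := by
        intro hbt
        obtain ⟨u, _, _, _, _, hu⟩ := hbody t hst hIt hbt
        omega
      exact ⟨t, _, Runs.loop_false hnb, by omega, hend t hst hIt hnb⟩
    | succ N ih =>
      intro t hst hIt hvt
      by_cases hbt : b.Holds enum t
      · obtain ⟨u, c, h1, h2, h3, h4⟩ := hbody t hst hIt hbt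
        have hsu : (Prog.loop b p).Same t u := h1.same.of_le (fun _ h => h) (fun _ h => h)
          (fun _ h => h) fun _ h => h
        obtain ⟨x, c', h1', h2', h3'⟩ := ih u (hst.trans hsu) h3 (by omega)
        refine ⟨x, _, Runs.loop_true hbt h1 h1', ?_, h3'⟩
        rw [Nat.add_mul, one_mul]
        omega
      · exact ⟨t, _, Runs.loop_false hbt, by omega, hend t hst hIt hbt⟩
  -- At most `X` rounds of cost `16 + X ^ m'` and a last test fit into `X ^ (m' + 3)`.
  obtain ⟨u, c, h1, h2, h3⟩ := key X s (Prog.Same.refl _ _) hI hv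
  refine ⟨u, c, h1, h2.trans ?_, h3⟩
  refine le_trans ?_ (Nat.pow_le_pow_right (by omega) hm)
  have a1 : 1 ≤ X ^ m' := Nat.one_le_pow _ _ (by omega)
  have e1 : X ^ (m' + 3) = X ^ m' * X * X * X := by ring
  rw [e1]
  have b1 : X ≤ X ^ m' * X := by nlinarith
  have b2 : X ^ m' * X * 16 ≤ X ^ m' * X * X := Nat.mul_le_mul_left _ hX'
  have b3 : X ^ m' * X * X * 16 ≤ X ^ m' * X * X * X := Nat.mul_le_mul_left _ hX'
  nlinarith

end Tri

namespace Prog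

/-- The program has no loops. -/
def flat : Prog → Bool
  | seq p q => p.flat && q.flat
  | ite _ p q => p.flat && q.flat
  | loop _ _ => false
  | _ => true

/-- A bound for the number of steps of a program without loops. -/
def maxCost : Prog → ℕ
  | skip => 1
  | setReg _ e => e.cost + 1
  | setMem _ i e => i.cost + e.cost + 1
  | setFReg _ e => e.cost + 1
  | setFMem _ i e => i.cost + e.cost + 1
  | seq p q => p.maxCost + q.maxCost
  | ite b p q => b.cost + (p.maxCost + q.maxCost)
  | loop _ _ => 0

open Classical in
/-- The store after the execution of a program without loops. -/
noncomputable def out {F : Type*} [Field F] (enum : ℕ → F) : Prog → Store F → Store F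
  | skip, s => s
  | setReg r e, s => { s with reg := Function.update s.reg r (e.val s) }
  | setMem a i e, s => { s with
      mem := Function.update s.mem a (Function.update (s.mem a) (i.val s) (e.val s)) }
  | setFReg r e, s => { s with freg := Function.update s.freg r (e.val enum s) }
  | setFMem a i e, s => { s with
      fmem := Function.update s.fmem a (Function.update (s.fmem a) (i.val s) (e.val enum s)) }
  | seq p q, s => q.out enum (p.out enum s)
  | ite b p q, s => if b.Holds enum s then p.out enum s else q.out enum s
  | loop _ _, s => s

theorem runs_out {F : Type*} [Field F] (enum : ℕ → F) (p : Prog) (hp : p.flat = true)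
    (s : Store F) : ∃ c, Runs enum p s (p.out enum s) c ∧ c ≤ p.maxCost := by
  induction p generalizing s with
  | skip => exact ⟨_, .skip s, le_rfl⟩
  | setReg r e => exact ⟨_, .setReg r e s, le_rfl⟩
  | setMem a i e => exact ⟨_, .setMem a i e s, le_rfl⟩
  | setFReg r e => exact ⟨_, .setFReg r e s, le_rfl⟩
  | setFMem a i e => exact ⟨_, .setFMem a i e s, le_rfl⟩
  | seq p q ihp ihq =>
    rw [flat, Bool.and_eq_true] at hp
    obtain ⟨c, h1, h2⟩ := ihp hp.1 s
    obtain ⟨c', h1', h2'⟩ := ihq hp.2 (p.out enum s)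
    exact ⟨_, h1.seq h1', Nat.add_le_add h2 h2'⟩
  | ite b p q ihp ihq =>
    rw [flat, Bool.and_eq_true] at hp
    obtain ⟨c, h1, h2⟩ := ihp hp.1 s
    obtain ⟨c', h1', h2'⟩ := ihq hp.2 s
    rw [out, maxCost]
    split_ifs with h
    · exact ⟨_, h1.ite_true h, by omega⟩
    · exact ⟨_, h1'.ite_false h, by omega⟩
  | loop b p _ => simp [flat] at hp

/-- A counting loop: the register `r` runs from `0` to the value of the register `lim`. -/
def forLoop (r lim : ℕ) (p : Prog) : Prog :=
  seq (setReg r (.lit 0))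
    (loop (.lt (.var r) (.var lim)) (seq p (setReg r (.add (.var r) (.lit 1)))))

end Prog

/-- The store with a new value of a register for numbers. -/
def Store.put {F : Type*} (s : Store F) (r x : ℕ) : Store F :=
  { s with reg := Function.update s.reg r x }

namespace Tri

variable {F : Type*} [Field F] {enum : ℕ → F} {X : ℕ} {p q : Prog} {s : Store F} {m : ℕ}
  {Q : Store F → Prop} [hX : Fact (16 ≤ X)]

/-- Programs without loops are executed symbolically through `out`; their cost is at most `256 = 16
^ 2 ≤ X ^ 2`. -/
theorem flat (hp : p.flat = true) (hc : p.maxCost ≤ 256) (hQ : Q (p.out enum s)) (hm : 2 ≤ m) :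
    Tri enum X p s m Q := by
  obtain ⟨c, h1, h2⟩ := p.runs_out enum hp s
  refine ⟨_, c, h1, ?_, hQ⟩
  have hX' := hX.out
  calc c ≤ 16 ^ 2 := by omega
    _ ≤ X ^ 2 := Nat.pow_le_pow_left hX' 2
    _ ≤ X ^ m := Nat.pow_le_pow_right (by omega) hm

/-- The rule for counting loops. -/
theorem forLoop {r lim : ℕ} (N : ℕ) (I : ℕ → Store F → Prop) {m' : ℕ} (hN : s.reg lim = N)
    (hNX : N ≤ X) (hrl : r ≠ lim) (hpr : p.wReg r = false) (hpl : p.wReg lim = false)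
    (h0 : I 0 (s.put r 0))
    (hbody : ∀ i < N, ∀ t, (Prog.forLoop r lim p).Same s t → t.reg r = i → I i t →
      Tri enum X p t m' fun u => I (i + 1) (u.put r (i + 1)))
    (hQ : ∀ t, (Prog.forLoop r lim p).Same s t → I N t → Q t) (hm1 : 2 ≤ m') (hm : m' + 5 ≤ m) :
    Tri enum X (Prog.forLoop r lim p) s m Q := by
  have hsame0 : (Prog.forLoop r lim p).Same s (s.put r 0) := by
    refine ⟨fun x hx => ?_, fun _ _ => rfl, fun _ _ => rfl, fun _ _ => rfl⟩
    have : x ≠ r := by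
      rintro rfl
      simp [Prog.forLoop, Prog.wReg] at hx
    simp [Store.put, Function.update_of_ne this]
  refine Tri.seq (m₁ := 2) (Q₁ := fun t => t = s.put r 0) (Tri.flat rfl (by simp [Prog.maxCost, NExp.cost]) rfl le_rfl) ?_
    (m₂ := m' + 4) (by omega) (by omega)
  rintro t - rfl
  -- The frame condition relative to `s` is part of the invariant, so the body may rely on every
  -- cell that the loop never writes.
  refine Tri.loop (m' := m' + 1)
    (fun t => (Prog.forLoop r lim p).Same s t ∧ t.reg lim = N ∧ t.reg r ≤ N ∧ I (t.reg r) t)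
    (fun t => N - t.reg r) (by simp [Test.cost, NExp.cost]) ?_ ?_ ?_ ?_ (by omega)
  · refine ⟨hsame0, ?_, by simp [Store.put], by simpa [Store.put] using h0⟩
    simp [Store.put, Function.update_of_ne (Ne.symm hrl), hN]
  · exact (Nat.sub_le _ _).trans hNX
  · rintro t - ⟨hst, htl, htr, hIt⟩ hb
    simp only [Test.Holds, NExp.val] at hb
    rw [htl] at hb
    refine Tri.seq (m₁ := m') (m₂ := 2) (hbody _ hb t hst rfl hIt) ?_ (by omega) (by omega)
    intro u htu hIu
    have h1 := htu.reg r hpr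
    have h2 := htu.reg lim hpl
    refine Tri.flat rfl (by simp [Prog.maxCost, NExp.cost]) ?_ le_rfl
    have hout : (Prog.setReg r (.add (.var r) (.lit 1))).out enum u = u.put r (t.reg r + 1) := by
      simp [Prog.out, Store.put, NExp.val, h1]
    rw [hout]
    refine ⟨⟨?_, ?_, ?_, ?_⟩, ?_⟩
    · have h3 : (Prog.forLoop r lim p).Same t u := by
        refine htu.of_le ?_ ?_ ?_ ?_ <;> intro x hx <;>
          simp_all [Prog.forLoop, Prog.wReg, Prog.wMem, Prog.wFReg, Prog.wFMem]
      refine (hst.trans h3).trans ⟨fun x hx => ?_, fun _ _ => rfl, fun _ _ => rfl, fun _ _ => rfl⟩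
      have : x ≠ r := by
        rintro rfl
        simp [Prog.forLoop, Prog.wReg] at hx
      simp [Store.put, Function.update_of_ne this]
    · simp [Store.put, Function.update_of_ne (Ne.symm hrl), h2, htl]
    · simpa [Store.put] using hb
    · simpa [Store.put] using hIu
    · simp only [Store.put, Function.update_self]
      omega
  · rintro t - ⟨hst, htl, htr, hIt⟩ hb
    simp only [Test.Holds, NExp.val, not_lt] at hb
    rw [htl] at hb
    have : t.reg r = N := le_antisymm htr hb
    rw [this] at hIt
    exact hQ t hst hIt

end Tri


/-! ### Arithmetic subroutines -/

infixr:60 " ;; " => Prog.seq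

/-- Register `22` gets the power of register `20` to the exponent in register `21`. -/
def powProg : Prog :=
  .setReg 22 (.lit 1) ;;
  .forLoop 23 21
    -- Numbers cannot be multiplied in one step, so register `24` collects the product by repeated
    -- addition.
    (.setReg 24 (.lit 0) ;;
     .forLoop 25 20 (.setReg 24 (.add (.var 24) (.var 22))) ;;
     .setReg 22 (.var 24))

theorem powProg_spec {F : Type*} [Field F] (enum : ℕ → F) {X : ℕ} [Fact (16 ≤ X)] (s : Store F)
    (hb : s.reg 20 ≤ X) (he : s.reg 21 ≤ X) :
    Tri enum X powProg s 15 fun t => t.reg 22 = s.reg 20 ^ s.reg 21 := by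
  refine Tri.seq (m₁ := 2) (m₂ := 14) (Q₁ := fun t => t.reg 22 = 1)
    (Tri.flat rfl (by decide) (by simp [Prog.out, NExp.val]) le_rfl) ?_ (by omega) (by omega)
  intro t hst ht
  have h20 := hst.reg 20 rfl
  have h21 := hst.reg 21 rfl
  refine Tri.forLoop (m' := 9) (s.reg 21) (fun i u => u.reg 22 = s.reg 20 ^ i) h21 he (by decide)
    rfl rfl (by simp [Store.put, ht]) ?_ (fun u _ hu => hu) (by omega) (by omega)
  intro i hi u htu hui hIu
  refine Tri.seq (m₁ := 2) (m₂ := 8) (Q₁ := fun t => t.reg 24 = 0)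
    (Tri.flat rfl (by decide) (by simp [Prog.out, NExp.val]) le_rfl) ?_ (by omega) (by omega)
  intro x hux hx
  have x20 : x.reg 20 = s.reg 20 := by rw [hux.reg 20 rfl, htu.reg 20 rfl, h20]
  have x22 := hux.reg 22 rfl
  refine Tri.seq (m₁ := 7) (m₂ := 2) (Q₁ := fun t => t.reg 24 = s.reg 20 * s.reg 20 ^ i)
    (Tri.forLoop (m' := 2) (s.reg 20) (fun j y => y.reg 24 = j * s.reg 20 ^ i) x20 hb (by decide)
      rfl rfl (by simp [Store.put, hx]) ?_ (fun u _ hu => hu) le_rfl le_rfl) ?_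
    (by omega) (by omega)
  · intro j hj y hxy hyj hIy
    have y22 := hxy.reg 22 rfl
    refine Tri.flat rfl (by decide) ?_ le_rfl
    simp only [Prog.out, NExp.val, Store.put, Function.update_apply, if_true]
    simp only [y22, x22, hIu, hIy]
    simp
    ring
  · intro y hxy hy
    refine Tri.flat rfl (by decide) ?_ le_rfl
    simp [Prog.out, NExp.val, Store.put, hy]
    ring

/-- The loop that divides register `30` by register `31`: the quotient is put into register `34`,
and the remainder is left in register `30`. -/
def divProg : Prog :=
  .setReg 34 (.lit 0) ;;
  .loop (.lt (.var 31) (.add (.var 30) (.lit 1)))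
    (.setReg 30 (.sub (.var 30) (.var 31)) ;; .setReg 34 (.add (.var 34) (.lit 1)))

theorem divProg_spec {F : Type*} [Field F] (enum : ℕ → F) {X : ℕ} [Fact (16 ≤ X)] (s : Store F)
    (hb : 0 < s.reg 31) (hc : s.reg 30 ≤ X) :
    Tri enum X divProg s 6 fun t =>
      t.reg 30 = s.reg 30 % s.reg 31 ∧ t.reg 34 = s.reg 30 / s.reg 31 := by
  refine Tri.seq (m₁ := 2) (m₂ := 5) (Q₁ := fun t => t.reg 34 = 0)
    (Tri.flat rfl (by decide) (by simp [Prog.out, NExp.val]) le_rfl) ?_ (by omega) (by omega)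
  intro t hst ht
  have h30 := hst.reg 30 rfl
  have h31 := hst.reg 31 rfl
  refine Tri.loop (m' := 2) (fun u => u.reg 30 + u.reg 34 * s.reg 31 = s.reg 30) (fun u => u.reg 30)
    (by decide) (by simp [h30, ht]) (by omega) ?_ ?_ le_rfl
  · intro u htu hIu hbu
    have u31 : u.reg 31 = s.reg 31 := by rw [htu.reg 31 rfl, h31]
    simp only [Test.Holds, NExp.val, u31] at hbu
    refine Tri.flat rfl (by decide) ?_ le_rfl
    simp only [Prog.out, NExp.val, Function.update_apply, if_true]
    simp [u31]
    constructor
    · rw [Nat.add_mul, one_mul]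
      omega
    · omega
  · intro u htu hIu hbu
    simp only [Test.Holds, NExp.val, not_lt] at hbu
    have u31 : u.reg 31 = s.reg 31 := by rw [htu.reg 31 rfl, h31]
    rw [← hIu, Nat.add_mul_mod_self_right, Nat.add_mul_div_right _ _ hb, Nat.mod_eq_of_lt (by omega),
      Nat.div_eq_of_lt (by omega), zero_add]
    exact ⟨rfl, rfl⟩

/-- The digits of register `30` to the base in register `31` are put into array `10`, as many as
register `32` says. -/
def decodeProg : Prog :=
  .forLoop 33 32 (divProg ;; .setMem 10 (.var 33) (.var 30) ;; .setReg 30 (.var 34))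

theorem decodeProg_spec {F : Type*} [Field F] (enum : ℕ → F) {X : ℕ} [Fact (16 ≤ X)] (s : Store F)
    (hb : 0 < s.reg 31) (hc : s.reg 30 ≤ X) (hl : s.reg 32 ≤ X) :
    Tri enum X decodeProg s 12 fun t =>
      ∀ i < s.reg 32, t.mem 10 i = s.reg 30 / s.reg 31 ^ i % s.reg 31 := by
  refine Tri.forLoop (m' := 7) (s.reg 32) (fun i u => u.reg 30 = s.reg 30 / s.reg 31 ^ i ∧
    ∀ j < i, u.mem 10 j = s.reg 30 / s.reg 31 ^ j % s.reg 31) rfl hl (by decide) rfl rfl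
    (by simp [Store.put]) ?_ (fun u _ hu => hu.2) (by omega) (by omega)
  intro i hi t hst hti ⟨h1, h2⟩
  have t31 : t.reg 31 = s.reg 31 := hst.reg 31 rfl
  refine Tri.seq (m₁ := 6) (m₂ := 3) (divProg_spec enum t (by omega)
    (by rw [h1]; exact (Nat.div_le_self _ _).trans hc)) ?_ (by omega) (by omega)
  intro u htu ⟨hu1, hu2⟩
  have u33 := htu.reg 33 rfl
  have um := htu.mem 10 rfl
  refine Tri.flat rfl (by decide) ?_ (by omega)
  simp only [Prog.out, NExp.val, Store.put, Function.update_apply, if_true]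
  rw [u33, hti, hu1, hu2, h1, t31, um]
  constructor
  · simp [Nat.div_div_eq_div_mul, pow_succ]
  · intro j hj
    split_ifs with h
    · rw [h]
    · exact h2 j (by omega)


/-! ### The search for a class of variables -/

/-- The positions, the number of variables, and a flag for the correctness, that are read off from a
list of variables `δ 0, …, δ (i - 1)` in which the entries that are at least `n` are ignored. -/
def buildPos (δ rd : ℕ → ℕ) (n : ℕ) : ℕ → (ℕ → ℕ) × ℕ × ℕ
  | 0 => (fun _ => 0, 0, 1)
  | i + 1 =>
    let st := buildPos δ rd n i
    if δ i < n then
      -- The sum is `0` exactly if the variable has no class yet and has not occurred earlier in the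
      -- list.
      if rd (δ i) + st.1 (δ i) < 1 then
        (Function.update st.1 (δ i) (st.2.1 + 1), st.2.1 + 1, st.2.2)
      else (st.1, st.2.1, 0)
    else st

/-- Array `11` gets the positions, register `45` their number and register `46` the flag. -/
def buildProg : Prog :=
  .forLoop 42 0 (.setMem 11 (.var 42) (.lit 0)) ;;
  (.setReg 45 (.lit 0) ;; .setReg 46 (.lit 1)) ;;
  .forLoop 47 9
    (.setReg 48 (.get 10 (.var 47)) ;;
     .ite (.lt (.var 48) (.var 0))
       (.ite (.lt (.add (.get 12 (.var 48)) (.get 11 (.var 48))) (.lit 1))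
         (.setReg 45 (.add (.var 45) (.lit 1)) ;; .setMem 11 (.var 48) (.var 45))
         (.setReg 46 (.lit 0)))
       .skip)

theorem buildProg_spec {F : Type*} [Field F] (enum : ℕ → F) {X : ℕ} [Fact (16 ≤ X)] (s : Store F)
    (hn : s.reg 0 ≤ X) (hM : s.reg 9 ≤ X) :
    Tri enum X buildProg s 9 fun t =>
      let st := buildPos (s.mem 10) (s.mem 12) (s.reg 0) (s.reg 9)
      (∀ v < s.reg 0, t.mem 11 v = st.1 v) ∧ t.reg 45 = st.2.1 ∧ t.reg 46 = st.2.2 := by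
  refine Tri.seq (m₁ := 7) (m₂ := 8) (Q₁ := fun t => ∀ v < s.reg 0, t.mem 11 v = 0)
    (Tri.forLoop (m' := 2) (s.reg 0) (fun i u => ∀ v < i, u.mem 11 v = 0) rfl hn (by decide) rfl rfl
      (by simp) ?_ (fun u _ hu => hu) le_rfl le_rfl) ?_ (by omega) (by omega)
  · intro i hi t hst hti h
    refine Tri.flat rfl (by decide) ?_ le_rfl
    intro v hv
    simp only [Prog.out, NExp.val, Store.put, Function.update_apply, if_true, hti]
    split_ifs with h'
    · rfl
    · exact h v (by omega)
  intro t hst ht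
  have t0 := hst.reg 0 rfl
  have t9 := hst.reg 9 rfl
  have tm10 := hst.mem 10 rfl
  have tm12 := hst.mem 12 rfl
  refine Tri.seq (m₁ := 2) (m₂ := 7) (Q₁ := fun u => (∀ v < s.reg 0, u.mem 11 v = 0) ∧
    u.reg 45 = 0 ∧ u.reg 46 = 1) (Tri.flat rfl (by decide) (by simpa [Prog.out, NExp.val] using ht)
      le_rfl) ?_ (by omega) (by omega)
  intro u htu ⟨h1, h2, h3⟩
  have u0 : u.reg 0 = s.reg 0 := (htu.reg 0 rfl).trans t0
  have u9 : u.reg 9 = s.reg 9 := (htu.reg 9 rfl).trans t9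
  have um10 : u.mem 10 = s.mem 10 := (htu.mem 10 rfl).trans tm10
  have um12 : u.mem 12 = s.mem 12 := (htu.mem 12 rfl).trans tm12
  refine Tri.forLoop (m' := 2) (s.reg 9) (fun i x =>
    let st := buildPos (s.mem 10) (s.mem 12) (s.reg 0) i
    (∀ v < s.reg 0, x.mem 11 v = st.1 v) ∧ x.reg 45 = st.2.1 ∧ x.reg 46 = st.2.2) u9 hM
    (by decide) rfl rfl ?_ ?_ (fun u _ hu => hu) le_rfl le_rfl
  · simp only [buildPos, Store.put]
    exact ⟨h1, by simpa using h2, by simpa using h3⟩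
  · intro i hi x hux hxi ⟨hx1, hx2, hx3⟩
    have x0 : x.reg 0 = s.reg 0 := (hux.reg 0 rfl).trans u0
    have xm10 : x.mem 10 = s.mem 10 := (hux.mem 10 rfl).trans um10
    have xm12 : x.mem 12 = s.mem 12 := (hux.mem 12 rfl).trans um12
    refine Tri.flat rfl (by decide) ?_ le_rfl
    by_cases hv : s.mem 10 i < s.reg 0
    · have hx4 := hx1 _ hv
      by_cases h0 : s.mem 12 (s.mem 10 i) +
          (buildPos (s.mem 10) (s.mem 12) (s.reg 0) i).1 (s.mem 10 i) < 1
      · rw [Nat.lt_one_iff] at h0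
        have h0' := h0
        rw [Nat.add_eq_zero_iff] at h0'
        simp [Prog.out, NExp.val, Test.Holds, buildPos, Store.put, hxi, xm10, xm12, x0, hv, hx4,
          h0'.1, h0'.2, hx2, hx3]
        intro v hv
        by_cases hvi : v = s.mem 10 i
        · simp [hvi]
        · simp [hvi, hx1 v hv]
      · rw [Nat.lt_one_iff] at h0
        have h0' := h0
        rw [Nat.add_eq_zero_iff] at h0'
        simpa [Prog.out, NExp.val, Test.Holds, buildPos, Store.put, hxi, xm10, xm12, x0, hv, hx4,
          h0', hx2, hx3] using hx1
    · simpa [Prog.out, NExp.val, Test.Holds, buildPos, Store.put, hxi, xm10, xm12, x0, hv, hx2, hx3]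
        using hx1

/-- Registers `50` and `51` get the last truth value and the number of changes for the initial segment
with number `49` of the positions in array `11`. -/
def switchProg : Prog :=
  (.setReg 50 (.lit 0) ;; .setReg 51 (.lit 0)) ;;
  .forLoop 52 4
    (.setReg 53 (.get 11 (.get 0 (.var 52))) ;;
     .ite (.lt (.lit 0) (.var 53))
       (.ite (.lt (.var 53) (.add (.var 49) (.lit 1))) (.setReg 54 (.lit 1)) (.setReg 54 (.lit 0)) ;;
        -- With truncated subtraction, the sum of both differences is positive exactly if the truth
        -- values differ.
        .ite (.lt (.lit 0) (.add (.sub (.var 50) (.var 54)) (.sub (.var 54) (.var 50))))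
          (.setReg 51 (.add (.var 51) (.lit 1)) ;; .setReg 50 (.var 54)) .skip)
       .skip)

theorem switchProg_spec {F : Type*} [Field F] (enum : ℕ → F) {X : ℕ} [Fact (16 ≤ X)] (s : Store F)
    (hL : s.reg 4 ≤ X) :
    Tri enum X switchProg s 8 fun t => t.reg 51 =
      (switchRun (fun x => decide (x ≤ s.reg 49)) (fun l => s.mem 11 (s.mem 0 l)) (s.reg 4)).2 := by
  refine Tri.seq (m₁ := 2) (m₂ := 7) (Q₁ := fun t => t.reg 50 = 0 ∧ t.reg 51 = 0)
    (Tri.flat rfl (by decide) (by simp [Prog.out, NExp.val]) le_rfl) ?_ (by omega) (by omega)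
  intro t hst ⟨h1, h2⟩
  refine Tri.forLoop (m' := 2) (s.reg 4) (fun l u =>
    let r := switchRun (fun x => decide (x ≤ s.reg 49)) (fun l => s.mem 11 (s.mem 0 l)) l
    u.reg 50 = r.1.toNat ∧ u.reg 51 = r.2) (hst.reg 4 rfl) hL (by decide) rfl rfl
    (by simp [switchRun, Store.put, h1, h2]) ?_ (fun u _ hu => hu.2) le_rfl le_rfl
  intro l hl u htu hul ⟨hu1, hu2⟩
  have um11 : u.mem 11 = s.mem 11 := (htu.mem 11 rfl).trans (hst.mem 11 rfl)
  have um0 : u.mem 0 = s.mem 0 := (htu.mem 0 rfl).trans (hst.mem 0 rfl)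
  have u49 : u.reg 49 = s.reg 49 := (htu.reg 49 rfl).trans (hst.reg 49 rfl)
  refine Tri.flat rfl (by decide) ?_ le_rfl
  rcases hr : switchRun (fun x => decide (x ≤ s.reg 49)) (fun l => s.mem 11 (s.mem 0 l)) l with
    ⟨b, c⟩
  simp only [hr] at hu1 hu2
  rcases Nat.eq_zero_or_pos (s.mem 11 (s.mem 0 l)) with h0 | h0
  · simp [Prog.out, NExp.val, Test.Holds, switchRun, Store.put, hul, um11, um0, hr, h0, hu1, hu2]
  · have h0' : s.mem 11 (s.mem 0 l) ≠ 0 := by omega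
    by_cases hq : s.mem 11 (s.mem 0 l) ≤ s.reg 49
    · have hq' : s.mem 11 (s.mem 0 l) < s.reg 49 + 1 := by omega
      cases b <;> simp [Prog.out, NExp.val, Test.Holds, switchRun, Store.put, hul, um11, um0, u49, hr,
        h0, h0', hq, hq', hu1, hu2]
    · have hq' : ¬ s.mem 11 (s.mem 0 l) < s.reg 49 + 1 := by omega
      cases b <;> simp [Prog.out, NExp.val, Test.Holds, switchRun, Store.put, hul, um11, um0, u49, hr,
        h0, h0', hq, hq', hu1, hu2]

open Classical in
/-- The number of variables in the list, or `0` if it does not give valid positions. -/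
noncomputable def score (δ rd ord : ℕ → ℕ) (n L M K : ℕ) : ℕ :=
  let st := buildPos δ rd n M
  if st.2.2 = 1 ∧ ∀ q < M + 1, (switchRun (fun x => decide (x ≤ q)) (fun l => st.1 (ord l)) L).2 ≤ K
  then st.2.1 else 0

theorem switchRun_congr (P : ℕ → Bool) {tag tag' : ℕ → ℕ} (L : ℕ) (h : ∀ l < L, tag l = tag' l) :
    switchRun P tag L = switchRun P tag' L := by
  induction L with
  | zero => rfl
  | succ L ih =>
    rw [switchRun, switchRun, ih fun l hl => h l (by omega), h L (by omega)]

theorem buildPos_flag (δ rd : ℕ → ℕ) (n i : ℕ) :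
    (buildPos δ rd n i).2.2 = 0 ∨ (buildPos δ rd n i).2.2 = 1 := by
  induction i with
  | zero => exact Or.inr rfl
  | succ i ih =>
    simp only [buildPos]
    split_ifs
    · exact ih
    · exact Or.inl rfl
    · exact ih

/-- Array `11` gets the positions that belong to the list in array `10`, and register `45` gets
its score. -/
def checkProg : Prog :=
  buildProg ;;
  .forLoop 49 18 (switchProg ;; .ite (.lt (.var 11) (.var 51)) (.setReg 46 (.lit 0)) .skip) ;;
  .ite (.lt (.var 46) (.lit 1)) (.setReg 45 (.lit 0)) .skip

theorem checkProg_spec {F : Type*} [Field F] (enum : ℕ → F) {X : ℕ} [Fact (16 ≤ X)] (s : Store F)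
    (hn : s.reg 0 ≤ X) (hM : s.reg 9 ≤ X) (hM1 : s.reg 18 = s.reg 9 + 1) (hMX : s.reg 18 ≤ X)
    (hL : s.reg 4 ≤ X) (hord : ∀ l < s.reg 4, s.mem 0 l < s.reg 0) :
    Tri enum X checkProg s 16 fun t =>
      (∀ v < s.reg 0, t.mem 11 v = (buildPos (s.mem 10) (s.mem 12) (s.reg 0) (s.reg 9)).1 v) ∧
      t.reg 45 = score (s.mem 10) (s.mem 12) (s.mem 0) (s.reg 0) (s.reg 4) (s.reg 9) (s.reg 11) := by
  classical
  refine Tri.seq (m₁ := 9) (m₂ := 15) (buildProg_spec enum s hn hM) ?_ (by omega) (by omega)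
  intro t hst ⟨h1, h2, h3⟩
  set st := buildPos (s.mem 10) (s.mem 12) (s.reg 0) (s.reg 9) with hst'
  have t0 := hst.reg 0 rfl
  have t4 := hst.reg 4 rfl
  have t11 := hst.reg 11 rfl
  have t18 := hst.reg 18 rfl
  have tm0 := hst.mem 0 rfl
  refine Tri.seq (m₁ := 14) (m₂ := 3) (Q₁ := fun u =>
    (∀ v < s.reg 0, u.mem 11 v = st.1 v) ∧ u.reg 45 = st.2.1 ∧ u.reg 46 =
      if st.2.2 = 1 ∧ ∀ q < s.reg 9 + 1, (switchRun (fun x => decide (x ≤ q))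
        (fun l => st.1 (s.mem 0 l)) (s.reg 4)).2 ≤ s.reg 11 then 1 else 0)
    (Tri.forLoop (m' := 9) (s.reg 18) (fun q' u =>
      u.reg 46 = if st.2.2 = 1 ∧ ∀ q < q', (switchRun (fun x => decide (x ≤ q))
        (fun l => st.1 (s.mem 0 l)) (s.reg 4)).2 ≤ s.reg 11 then 1 else 0) t18 hMX (by decide)
      rfl rfl ?_ ?_ ?_ (by omega) (by omega)) ?_ (by omega) (by omega)
  · simp only [Store.put, Nat.not_lt_zero, false_imp_iff, implies_true, and_true]
    rw [Function.update_of_ne (by decide), h3]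
    rcases buildPos_flag (s.mem 10) (s.mem 12) (s.reg 0) (s.reg 9) with h | h <;>
      simp [hst', h]
  · intro q hq u htu huq hu
    refine Tri.seq (m₁ := 8) (m₂ := 2) (switchProg_spec enum u (by
      rw [htu.reg 4 rfl, t4]; exact hL)) ?_ (by omega) (by omega)
    intro x hux hx
    rw [huq, htu.reg 4 rfl, t4, htu.mem 11 rfl, htu.mem 0 rfl, tm0,
      switchRun_congr (tag' := fun l => st.1 (s.mem 0 l)) _ _ fun l hl => h1 _ (hord l hl)] at hx
    have x11 : x.reg 11 = s.reg 11 := by rw [hux.reg 11 rfl, htu.reg 11 rfl, t11]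
    have x46 := hux.reg 46 rfl
    refine Tri.flat rfl (by decide) ?_ le_rfl
    simp only [Prog.out, NExp.val, Test.Holds, Store.put, x11, hx]
    by_cases hc : s.reg 11 < (switchRun (fun x => decide (x ≤ q))
        (fun l => st.1 (s.mem 0 l)) (s.reg 4)).2
    · simp only [hc, if_true]
      rw [if_neg]
      · simp
      · rintro ⟨_, h⟩
        have := h q (by omega)
        omega
    · simp only [hc, if_false]
      rw [Function.update_of_ne (by decide), x46, hu]
      congr 1
      rw [eq_iff_iff]
      refine and_congr_right fun _ => ⟨fun h q' hq' => ?_, fun h q' hq' => h q' (by omega)⟩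
      rcases Nat.lt_succ_iff_lt_or_eq.mp hq' with h' | rfl
      · exact h q' h'
      · omega
  · intro u htu hu
    refine ⟨fun v hv => ?_, ?_, ?_⟩
    · rw [htu.mem 11 rfl]
      exact h1 v hv
    · rw [htu.reg 45 rfl, h2]
    · rw [hu, hM1]
  · intro u htu ⟨hu1, hu2, hu3⟩
    refine Tri.flat rfl (by decide) ?_ (by omega)
    simp only [Prog.out, NExp.val, Test.Holds, score, ← hst', hu3]
    split_ifs with hc h'
    · omega
    · exact ⟨hu1, hu2⟩
    · exact ⟨hu1, by simp⟩
    · omega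


theorem buildPos_congr {δ δ' rd : ℕ → ℕ} {n : ℕ} (i : ℕ) (h : ∀ j < i, δ j = δ' j) :
    buildPos δ rd n i = buildPos δ' rd n i := by
  induction i with
  | zero => rfl
  | succ i ih => rw [buildPos, buildPos, ih fun j hj => h j (by omega), h i (by omega)]

theorem score_congr {δ δ' rd ord : ℕ → ℕ} {n L M K : ℕ} (h : ∀ j < M, δ j = δ' j) :
    score δ rd ord n L M K = score δ' rd ord n L M K := by
  rw [score, score, buildPos_congr M h]

/-- Once cleared, the flag is never set again, so its final value `1` certifies every step of the
induction. -/
theorem buildPos_sound (δ rd : ℕ → ℕ) (n i : ℕ) (h : (buildPos δ rd n i).2.2 = 1) :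
    (buildPos δ rd n i).2.1 ≤ i ∧
    (∀ v, (buildPos δ rd n i).1 v ≤ (buildPos δ rd n i).2.1) ∧
    (∀ v, (buildPos δ rd n i).1 v ≠ 0 → v < n ∧ rd v = 0) ∧
    (∀ u v, (buildPos δ rd n i).1 u ≠ 0 →
      (buildPos δ rd n i).1 u = (buildPos δ rd n i).1 v → u = v) ∧
    ((Finset.range n).filter fun v => (buildPos δ rd n i).1 v ≠ 0).card =
      (buildPos δ rd n i).2.1 := by
  induction i with
  | zero => simp [buildPos]
  | succ i ih =>
    rw [buildPos] at h ⊢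
    by_cases h1 : δ i < n
    · by_cases h2 : rd (δ i) + (buildPos δ rd n i).1 (δ i) < 1
      · simp only [h1, h2, if_true] at h ⊢
        obtain ⟨a1, a2, a3, a4, a5⟩ := ih h
        generalize buildPos δ rd n i = st at *
        refine ⟨by omega, fun v => ?_, fun v hv => ?_, fun u v hu huv => ?_, ?_⟩
        · by_cases hv : v = δ i
          · simp [hv]
          · rw [Function.update_of_ne hv]
            exact (a2 v).trans (by omega)
        · by_cases hv' : v = δ i
          · exact hv' ▸ ⟨h1, by omega⟩
          · rw [Function.update_of_ne hv'] at hv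
            exact a3 v hv
        · have b1 := a2 u
          have b2 := a2 v
          by_cases hu' : u = δ i <;> by_cases hv' : v = δ i
          · rw [hu', hv']
          · rw [hu', Function.update_self, Function.update_of_ne hv'] at huv
            omega
          · rw [hv', Function.update_self, Function.update_of_ne hu'] at huv
            omega
          · rw [Function.update_of_ne hv', Function.update_of_ne hu'] at huv
            rw [Function.update_of_ne hu'] at hu
            exact a4 u v hu huv
        · rw [← a5, ← Finset.card_insert_of_notMem (a := δ i)]
          · congr 1
            ext v
            by_cases hv : v = δ i
            · simp [hv, h1]
            · simp [hv]
          · simp only [Finset.mem_filter, not_and_or]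
            right
            omega
      · simp [h1, h2] at h
    · simp only [h1, if_false] at h ⊢
      obtain ⟨a1, a2⟩ := ih h
      exact ⟨by omega, a2⟩

theorem score_sound {δ rd ord : ℕ → ℕ} {n L M K : ℕ} {σ : Fin L → Fin n}
    (hord : ∀ l (hl : l < L), ord l = σ ⟨l, hl⟩) (h : 0 < score δ rd ord n L M K) :
    score δ rd ord n L M K ≤ M ∧
    (∀ v, (buildPos δ rd n M).1 v ≤ score δ rd ord n L M K) ∧
    (∀ v, (buildPos δ rd n M).1 v ≠ 0 → v < n ∧ rd v = 0) ∧
    ((Finset.range n).filter fun v => (buildPos δ rd n M).1 v ≠ 0).card = score δ rd ord n L M K ∧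
    ValidPos σ K (buildPos δ rd n M).1 := by
  simp only [score] at h ⊢
  split_ifs at h ⊢ with hc
  swap
  · exact absurd h (lt_irrefl 0)
  obtain ⟨a1, a2, a3, a4, a5⟩ := buildPos_sound δ rd n M hc.1
  refine ⟨a1, a2, a3, a5, fun u _ v _ => a4 u v, fun q => ?_⟩
  have hcongr : ∀ P, switchRun P (readTag σ (buildPos δ rd n M).1) L =
      switchRun P (fun l => (buildPos δ rd n M).1 (ord l)) L := fun P =>
    switchRun_congr P L fun l hl => by rw [readTag, dif_pos hl, hord l hl]
  rw [hcongr]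
  -- No position exceeds `M`, so the segments with `q > M` coincide with the one for `q = M`, and
  -- finitely many tests suffice.
  by_cases hq : q < M + 1
  · exact hc.2 q hq
  · rw [show switchRun (fun t => decide (t ≤ q)) (fun l => (buildPos δ rd n M).1 (ord l)) L =
      switchRun (fun t => decide (t ≤ M)) (fun l => (buildPos δ rd n M).1 (ord l)) L from ?_]
    · exact hc.2 M (by omega)
    · generalize L = L'
      induction L' with
      | zero => rfl
      | succ l ih =>
        have := (a2 (ord l)).trans a1
        rw [switchRun, switchRun, ih]
        simp [this, this.trans (show M ≤ q by omega)]

/-- A list from which given positions can be read off. -/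
theorem exists_buildPos {rd pos : ℕ → ℕ} {n m M : ℕ} (hm : m ≤ M) (hpos : ∀ v, pos v ≤ m)
    (hinj : ∀ u < n, ∀ v < n, pos u ≠ 0 → pos u = pos v → u = v)
    (hrd : ∀ v < n, pos v ≠ 0 → rd v = 0)
    (hsurj : ∀ i < m, ∃ v < n, pos v = i + 1) :
    ∃ δ : ℕ → ℕ, (∀ i, δ i ≤ n) ∧ buildPos δ rd n M =
      (fun v => if v < n then pos v else 0, m, 1) := by
  classical
  choose! g hg1 hg2 using hsurj
  -- The variables are listed by increasing position, and the list is padded with the ignored entry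
  -- `n`.
  refine ⟨fun i => if i < m then g i else n, fun i => ?_, ?_⟩
  · simp only
    split_ifs with h
    · exact (hg1 i h).le
    · exact le_rfl
  have key : ∀ i ≤ m, buildPos (fun i => if i < m then g i else n) rd n i =
      (fun v => if v < n ∧ pos v ≤ i then pos v else 0, i, 1) := by
    intro i
    induction i with
    | zero =>
      intro _
      rw [buildPos]
      congr 1
      ext v
      split_ifs <;> omega
    | succ i ih =>
      intro hi
      have hi' : i < m := hi
      have h1 := hg1 i hi'
      have h2 := hg2 i hi'
      rw [buildPos, ih (by omega)]
      simp only [hi', if_true, h1]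
      rw [if_pos (by rw [hrd _ h1 (by omega), if_neg (by omega)]; omega)]
      congr 1
      ext v
      by_cases hv : v = g i
      · simp [hv, h1, h2]
      · rw [Function.update_of_ne hv]
        by_cases hvn : v < n
        · have h3 : pos v ≠ i + 1 := fun h => hv (hinj v hvn (g i) h1 (by omega) (by omega))
          simp only [hvn, true_and]
          split_ifs <;> omega
        · simp [hvn]
  have key2 : ∀ i, m ≤ i → buildPos (fun i => if i < m then g i else n) rd n i =
      buildPos (fun i => if i < m then g i else n) rd n m := by
    intro i hi
    induction i, hi using Nat.le_induction with
    | base => rfl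
    | succ i hi ih =>
      rw [buildPos, ih]
      simp [show ¬ i < m by omega]
  rw [key2 M hm, key m le_rfl]
  congr 1
  ext v
  simp [hpos v]

/-- Completeness of the search: a regularly interleaving set, cut down to `M` elements if necessary,
appears as a list. The search may then use any list of best score, since a positive score by itself
certifies valid positions. -/
theorem exists_score {n L k : ℕ} {σ : Fin L → Fin n} (hk : 1 ≤ k) (h : IsReadK k σ)
    {rd ord : ℕ → ℕ} (hord : ∀ l (hl : l < L), ord l = σ ⟨l, hl⟩) (M : ℕ) :
    ∃ s, ((Finset.range n).filter fun v => rd v = 0).card ≤ (2 ^ (k * k) * s) ^ 2 ^ (k - 1) ∧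
      ∃ δ : ℕ → ℕ, (∀ i, δ i ≤ n) ∧ min s M ≤ score δ rd ord n L M (2 * k + 2) := by
  classical
  obtain ⟨s, hs, hs'⟩ := exists_validPos hk h (Finset.univ.filter fun v : Fin n => rd v = 0)
  refine ⟨s, ?_, ?_⟩
  · refine le_trans (le_of_eq ?_) hs
    rw [← Finset.card_map Fin.valEmbedding]
    congr 1
    ext v
    simp only [Finset.mem_filter, Finset.mem_range, Finset.mem_map, Finset.mem_univ, true_and,
      Fin.valEmbedding_apply]
    exact ⟨fun h => ⟨⟨v, h.1⟩, h.2, rfl⟩, by rintro ⟨u, hu, rfl⟩; exact ⟨u.2, hu⟩⟩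
  · obtain ⟨Y, pos, hYX, hY, h1, h2, h3⟩ := hs' (min s M) (min_le_left _ _)
    have hinj : ∀ u ∈ Y, ∀ v ∈ Y, pos u = pos v → u = v := fun u hu v hv huv =>
      Fin.ext (h3.1 u u.2 v v.2 ((h1 u).mpr hu) huv)
    have himg : Y.image (fun v : Fin n => pos v) = Finset.Icc 1 (min s M) := by
      refine Finset.eq_of_subset_of_card_le ?_ ?_
      · intro x hx
        obtain ⟨v, hv, rfl⟩ := Finset.mem_image.mp hx
        have := (h1 v).mpr hv
        exact Finset.mem_Icc.mpr ⟨by omega, h2 v⟩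
      · rw [Finset.card_image_of_injOn fun u hu v hv huv => hinj u hu v hv huv, hY]
        simp
    obtain ⟨δ, hδ, hb⟩ := exists_buildPos (rd := rd) (n := n) (min_le_right s M) h2 h3.1
      (fun v hv h0 => by
        have := hYX ((h1 ⟨v, hv⟩).mp h0)
        simpa using this)
      (fun i hi => by
        have : i + 1 ∈ Y.image (fun v : Fin n => pos v) := by
          rw [himg]
          exact Finset.mem_Icc.mpr ⟨by omega, by omega⟩
        obtain ⟨v, hv, hv'⟩ := Finset.mem_image.mp this
        exact ⟨v, v.2, hv'⟩)
    refine ⟨δ, hδ, ?_⟩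
    rw [score, hb]
    simp only [true_and]
    rw [if_pos]
    intro q _
    rw [switchRun_congr (tag' := readTag σ pos)]
    · exact h3.2 q
    · intro l hl
      rw [hord l hl, if_pos (Fin.is_lt _), readTag, dif_pos hl]


/-! ### The number of classes -/

/-- The potential `2 ^ (k * k + 1) * rem ^ (1 - θ)` with `θ = 1 / 2 ^ (k - 1)` drops by at least one
per class, since a class has at least `rem ^ θ / 2 ^ (k * k)` elements. It therefore bounds the
number of classes. -/
theorem classes_potential_step {n k M s s' rem : ℕ} (hk : 2 ≤ k) (hM : n ≤ M * M) (hrn : rem ≤ n)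
    (hr0 : 0 < rem) (hs : rem ≤ (2 ^ (k * k) * s) ^ 2 ^ (k - 1)) (hs' : min s M ≤ s')
    (hsr : s' ≤ rem) :
    0 < s' ∧ 1 + 2 ^ (k * k + 1) * ((rem - s' : ℕ) : ℝ) ^ (1 - 1 / (2 : ℝ) ^ (k - 1)) ≤
      2 ^ (k * k + 1) * (rem : ℝ) ^ (1 - 1 / (2 : ℝ) ^ (k - 1)) := by
  obtain ⟨k, rfl⟩ : ∃ k', k = k' + 2 := ⟨k - 2, by omega⟩
  simp only [show k + 2 - 1 = k + 1 by omega] at *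
  have hs0 : 0 < s := by
    rcases Nat.eq_zero_or_pos s with rfl | h
    · simp at hs
      omega
    · exact h
  have hM0 : 0 < M := by
    rcases Nat.eq_zero_or_pos M with rfl | h
    · omega
    · exact h
  refine ⟨lt_of_lt_of_le (lt_min hs0 hM0) hs', ?_⟩
  set θ : ℝ := 1 / (2 : ℝ) ^ (k + 1) with hθ
  have hθ0 : 0 < θ := by positivity
  have hθ1 : θ ≤ 1 / 2 := by
    rw [hθ, pow_succ]
    have : (1 : ℝ) ≤ 2 ^ k := one_le_pow₀ (by norm_num)
    gcongr
    linarith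
  set P : ℝ := 2 ^ ((k + 2) * (k + 2)) with hP
  have hP1 : 1 ≤ P := one_le_pow₀ (by norm_num)
  have hrem : (0 : ℝ) < rem := by exact_mod_cast hr0
  have hrem1 : (1 : ℝ) ≤ rem := by exact_mod_cast hr0
  have h1 : (rem : ℝ) ^ θ ≤ P * s := by
    have : (rem : ℝ) ≤ (P * s) ^ 2 ^ (k + 1) := by
      rw [hP]
      exact_mod_cast hs
    calc (rem : ℝ) ^ θ ≤ ((P * s) ^ 2 ^ (k + 1)) ^ θ :=
          Real.rpow_le_rpow hrem.le this hθ0.le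
      _ = P * s := by
          rw [← Real.rpow_natCast, ← Real.rpow_mul (by positivity), hθ]
          push_cast
          rw [mul_one_div_cancel (by positivity), Real.rpow_one]
  -- Here `k ≥ 2` enters: `θ ≤ 1 / 2`, so the cap `M ≥ √n` is never below `rem ^ θ`.
  have h2 : (rem : ℝ) ^ θ ≤ P * M := by
    have : (rem : ℝ) ≤ (M : ℝ) ^ 2 := by
      rw [sq]
      exact_mod_cast hrn.trans hM
    calc (rem : ℝ) ^ θ ≤ (rem : ℝ) ^ (1 / 2 : ℝ) := Real.rpow_le_rpow_of_exponent_le hrem1 hθ1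
      _ ≤ ((M : ℝ) ^ 2) ^ (1 / 2 : ℝ) := Real.rpow_le_rpow hrem.le this (by norm_num)
      _ = M := by
          rw [← Real.sqrt_eq_rpow, Real.sqrt_sq (by positivity)]
      _ ≤ P * M := le_mul_of_one_le_left (by positivity) hP1
  have h3 : (rem : ℝ) ^ θ ≤ P * s' := by
    rcases le_total s M with h | h
    · rw [min_eq_left h] at hs'
      exact h1.trans (mul_le_mul_of_nonneg_left (by exact_mod_cast hs') (by positivity))
    · rw [min_eq_right h] at hs'
      exact h2.trans (mul_le_mul_of_nonneg_left (by exact_mod_cast hs') (by positivity))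
  have hsr' : (s' : ℝ) ≤ rem := by exact_mod_cast hsr
  -- Bernoulli's inequality for the exponent `1 - θ`; as `1 - θ ≥ 1 / 2`, the factor `2` in the
  -- potential makes up for it.
  have hb := rpow_one_add_le_one_add_mul_self (s := -(s' / rem : ℝ))
    (by rw [neg_le_neg_iff]; exact (div_le_one hrem).mpr hsr') (p := 1 - θ) (by linarith) (by linarith)
  have e1 : ((rem - s' : ℕ) : ℝ) = rem * (1 + -(s' / rem)) := by
    rw [Nat.cast_sub hsr]
    field_simp
    ring
  rw [e1, Real.mul_rpow hrem.le (by
    have := (div_le_one hrem).mpr hsr'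
    linarith)]
  have hpos : (0 : ℝ) < (rem : ℝ) ^ (1 - θ) := Real.rpow_pos_of_pos hrem _
  have e2 : (rem : ℝ) ^ (1 - θ) * (rem : ℝ) ^ θ = rem := by
    rw [← Real.rpow_add hrem]
    simp
  have h4 : 1 ≤ 2 * P * ((rem : ℝ) ^ (1 - θ) * ((1 - θ) * (s' / rem))) := by
    have a1 : (rem : ℝ) ≤ (rem : ℝ) ^ (1 - θ) * (P * s') := by
      rw [← e2]
      have := mul_le_mul_of_nonneg_left h3 hpos.le
      rwa [e2] at this ⊢
    have a2 : 2 * P * ((rem : ℝ) ^ (1 - θ) * ((1 - θ) * (s' / rem))) =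
        2 * (1 - θ) * (((rem : ℝ) ^ (1 - θ) * (P * s')) / rem) := by
      field_simp
    rw [a2]
    have a3 : 1 ≤ ((rem : ℝ) ^ (1 - θ) * (P * s')) / rem := (one_le_div hrem).mpr a1
    nlinarith
  have h5 := mul_le_mul_of_nonneg_left hb hpos.le
  have h6 := mul_le_mul_of_nonneg_left h5 (show 0 ≤ 2 * P by positivity)
  rw [show (2 : ℝ) ^ ((k + 2) * (k + 2) + 1) = 2 * P by rw [pow_succ, hP]; ring]
  nlinarith

/-! ### The search for the classes -/

/-- Register `16` gets the best score of a list, and array `14` the positions of such a list. -/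
def searchProg : Prog :=
  .setReg 16 (.lit 0) ;;
  .forLoop 60 17
    ((.setReg 30 (.var 60) ;; .setReg 31 (.var 12) ;; .setReg 32 (.var 9)) ;;
     decodeProg ;; checkProg ;;
     .ite (.lt (.var 16) (.var 45))
       (.setReg 16 (.var 45) ;; .forLoop 61 0 (.setMem 14 (.var 61) (.get 11 (.var 61)))) .skip)

/-- The codes in base `n + 1` run through all lists with entries at most `n`. Array `14` is
rewritten only when the score improves, so it always belongs to the current best score. -/
theorem searchProg_spec {F : Type*} [Field F] (enum : ℕ → F) {X : ℕ} [Fact (16 ≤ X)] (s : Store F)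
    (hn : s.reg 0 ≤ X) (hM1 : s.reg 18 = s.reg 9 + 1) (hMX : s.reg 18 ≤ X)
    (hL : s.reg 4 ≤ X) (hord : ∀ l < s.reg 4, s.mem 0 l < s.reg 0) (h12 : 0 < s.reg 12)
    (h17 : s.reg 17 ≤ X) :
    Tri enum X searchProg s 27 fun t =>
      (∀ c < s.reg 17, score (fun i => c / s.reg 12 ^ i % s.reg 12) (s.mem 12) (s.mem 0) (s.reg 0)
        (s.reg 4) (s.reg 9) (s.reg 11) ≤ t.reg 16) ∧
      (t.reg 16 = 0 ∨ ∃ δ, t.reg 16 = score δ (s.mem 12) (s.mem 0) (s.reg 0) (s.reg 4) (s.reg 9)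
        (s.reg 11) ∧ ∀ v < s.reg 0, t.mem 14 v = (buildPos δ (s.mem 12) (s.reg 0) (s.reg 9)).1 v) := by
  refine Tri.seq (m₁ := 2) (m₂ := 26) (Q₁ := fun t => t.reg 16 = 0)
    (Tri.flat rfl (by decide) (by simp [Prog.out, NExp.val]) le_rfl) ?_ (by omega) (by omega)
  intro t hst ht
  refine Tri.forLoop (m' := 20) (s.reg 17) (fun N t =>
      (∀ c < N, score (fun i => c / s.reg 12 ^ i % s.reg 12) (s.mem 12) (s.mem 0) (s.reg 0)
        (s.reg 4) (s.reg 9) (s.reg 11) ≤ t.reg 16) ∧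
      (t.reg 16 = 0 ∨ ∃ δ, t.reg 16 = score δ (s.mem 12) (s.mem 0) (s.reg 0) (s.reg 4) (s.reg 9)
        (s.reg 11) ∧ ∀ v < s.reg 0, t.mem 14 v = (buildPos δ (s.mem 12) (s.reg 0) (s.reg 9)).1 v))
    (hst.reg 17 rfl) h17 (by decide) rfl rfl ?_ ?_ (fun u _ hu => hu) (by omega) (by omega)
  · simp [Store.put, ht]
  intro c hc u htu huc ⟨hu1, hu2⟩
  have su0 : u.reg 0 = s.reg 0 := (htu.reg 0 rfl).trans (hst.reg 0 rfl)
  have su4 : u.reg 4 = s.reg 4 := (htu.reg 4 rfl).trans (hst.reg 4 rfl)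
  have su9 : u.reg 9 = s.reg 9 := (htu.reg 9 rfl).trans (hst.reg 9 rfl)
  have su11 : u.reg 11 = s.reg 11 := (htu.reg 11 rfl).trans (hst.reg 11 rfl)
  have su12 : u.reg 12 = s.reg 12 := (htu.reg 12 rfl).trans (hst.reg 12 rfl)
  have su17 : u.reg 17 = s.reg 17 := (htu.reg 17 rfl).trans (hst.reg 17 rfl)
  have su18 : u.reg 18 = s.reg 18 := (htu.reg 18 rfl).trans (hst.reg 18 rfl)
  have sm0 : u.mem 0 = s.mem 0 := (htu.mem 0 rfl).trans (hst.mem 0 rfl)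
  have sm12 : u.mem 12 = s.mem 12 := (htu.mem 12 rfl).trans (hst.mem 12 rfl)
  refine Tri.seq (m₁ := 2) (m₂ := 19) (Q₁ := fun x => x.reg 30 = c ∧ x.reg 31 = s.reg 12 ∧
      x.reg 32 = s.reg 9)
    (Tri.flat rfl (by decide) (by simp [Prog.out, NExp.val, huc, su12, su9]) le_rfl) ?_
    (by omega) (by omega)
  intro x hux ⟨x30, x31, x32⟩
  refine Tri.seq (m₁ := 12) (m₂ := 18) (decodeProg_spec enum x (by omega) (by omega) (by omega)) ?_
    (by omega) (by omega)
  intro y hxy hy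
  rw [x30, x31, x32] at hy
  have y0 : y.reg 0 = s.reg 0 := by rw [hxy.reg 0 rfl, hux.reg 0 rfl, su0]
  have y4 : y.reg 4 = s.reg 4 := by rw [hxy.reg 4 rfl, hux.reg 4 rfl, su4]
  have y9 : y.reg 9 = s.reg 9 := by rw [hxy.reg 9 rfl, hux.reg 9 rfl, su9]
  have y11 : y.reg 11 = s.reg 11 := by rw [hxy.reg 11 rfl, hux.reg 11 rfl, su11]
  have y18 : y.reg 18 = s.reg 18 := by rw [hxy.reg 18 rfl, hux.reg 18 rfl, su18]
  have y16 : y.reg 16 = u.reg 16 := by rw [hxy.reg 16 rfl, hux.reg 16 rfl]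
  have ym0 : y.mem 0 = s.mem 0 := by rw [hxy.mem 0 rfl, hux.mem 0 rfl, sm0]
  have ym12 : y.mem 12 = s.mem 12 := by rw [hxy.mem 12 rfl, hux.mem 12 rfl, sm12]
  have ym14 : y.mem 14 = u.mem 14 := by rw [hxy.mem 14 rfl, hux.mem 14 rfl]
  refine Tri.seq (m₁ := 16) (m₂ := 17) (checkProg_spec enum y (by omega) (by omega) (by omega)
    (by omega) (by omega) (by rw [y4, ym0, y0]; exact hord)) ?_ (by omega) (by omega)
  rw [y0, y4, y9, y11, ym0, ym12]
  intro z hyz ⟨hz1, hz2⟩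
  have hsc : score (y.mem 10) (s.mem 12) (s.mem 0) (s.reg 0) (s.reg 4) (s.reg 9) (s.reg 11) =
      score (fun i => c / s.reg 12 ^ i % s.reg 12) (s.mem 12) (s.mem 0) (s.reg 0) (s.reg 4) (s.reg 9)
        (s.reg 11) := score_congr hy
  have z16 : z.reg 16 = u.reg 16 := (hyz.reg 16 rfl).trans y16
  have z0 : z.reg 0 = s.reg 0 := (hyz.reg 0 rfl).trans y0
  have zm14 : z.mem 14 = u.mem 14 := (hyz.mem 14 rfl).trans ym14
  refine Tri.ite (m' := 16) (by decide) (fun hb => ?_) (fun hb => ?_) (by omega) (by omega)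
  · simp only [Test.Holds, NExp.val] at hb
    refine Tri.seq (m₁ := 2) (m₂ := 7) (Q₁ := fun a => a.reg 16 = z.reg 45)
      (Tri.flat rfl (by decide) (by simp [Prog.out, NExp.val]) le_rfl) ?_ (by omega) (by omega)
    intro a hza ha
    have a0 : a.reg 0 = s.reg 0 := (hza.reg 0 rfl).trans z0
    have am11 := hza.mem 11 rfl
    refine Tri.forLoop (m' := 2) (s.reg 0) (fun i b => ∀ v < i, b.mem 14 v = a.mem 11 v) a0 hn
      (by decide) rfl rfl (by simp) ?_ ?_ le_rfl le_rfl
    · intro i hi b hab hbi hIb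
      have bm11 := hab.mem 11 rfl
      refine Tri.flat rfl (by decide) ?_ le_rfl
      intro v hv
      by_cases hvi : v = i
      · simp [Prog.out, NExp.val, Store.put, hbi, hvi, bm11]
      · simpa [Prog.out, NExp.val, Store.put, hbi, hvi] using hIb v (by omega)
    · intro b hab hb'
      have b16 : b.reg 16 = z.reg 45 := (hab.reg 16 rfl).trans ha
      simp only [Store.put, Function.update_of_ne (show (16 : ℕ) ≠ 60 by decide), b16]
      refine ⟨fun c' hc' => ?_, Or.inr ⟨y.mem 10, hz2, fun v hv => ?_⟩⟩
      · rcases Nat.lt_succ_iff_lt_or_eq.mp hc' with h | rfl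
        · exact (hu1 c' h).trans (by omega)
        · rw [hz2, hsc]
      · rw [hb' v hv, am11, hz1 v hv]
  · simp only [Test.Holds, NExp.val, not_lt] at hb
    refine Tri.flat rfl (by decide) ?_ (by omega)
    simp only [Prog.out, Store.put, Function.update_of_ne (show (16 : ℕ) ≠ 60 by decide), z16, zm14]
    refine ⟨fun c' hc' => ?_, hu2⟩
    rcases Nat.lt_succ_iff_lt_or_eq.mp hc' with h | rfl
    · exact hu1 c' h
    · rw [← hsc, ← hz2]
      omega


theorem ValidPos.congr {n L K : ℕ} {σ : Fin L → Fin n} {pos pos' : ℕ → ℕ} (h : ValidPos σ K pos)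
    (hp : ∀ v < n, pos' v = pos v) : ValidPos σ K pos' := by
  refine ⟨fun u hu v hv => ?_, fun q => ?_⟩
  · rw [hp u hu, hp v hv]
    exact h.1 u hu v hv
  · rw [switchRun_congr (tag' := readTag σ pos)]
    · exact h.2 q
    · intro l hl
      rw [readTag, readTag, dif_pos hl, dif_pos hl, hp _ (Fin.is_lt _)]

/-- The variables `v` with `rd v ≠ 0` are distributed to classes `1, …, ρ` of variables,
with valid positions in every class. -/
def Classes {n L : ℕ} (σ : Fin L → Fin n) (K J ρ : ℕ) (rd ps : ℕ → ℕ) : Prop :=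
  (∀ v < n, rd v ≤ ρ) ∧ (∀ v < n, rd v ≠ 0 → ps v < 2 ^ J) ∧
    ∀ r < ρ, ValidPos σ K (classPos rd ps (r + 1))

theorem Classes.step {n L K J ρ : ℕ} {σ : Fin L → Fin n} {rd ps rd' ps' pos : ℕ → ℕ}
    (h : Classes σ K J ρ rd ps) (hJ : ∀ v < n, pos v ≤ 2 ^ J)
    (hrd : ∀ v, pos v ≠ 0 → v < n ∧ rd v = 0) (hv : ValidPos σ K pos)
    (hrd' : ∀ v < n, rd' v = if 0 < pos v then ρ + 1 else rd v)
    (hps' : ∀ v < n, ps' v = if 0 < pos v then pos v - 1 else ps v) :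
    Classes σ K J (ρ + 1) rd' ps' ∧
      ((Finset.range n).filter fun v => rd' v = 0).card =
        ((Finset.range n).filter fun v => rd v = 0).card -
          ((Finset.range n).filter fun v => pos v ≠ 0).card := by
  obtain ⟨h1, h2, h3⟩ := h
  refine ⟨⟨fun v hvn => ?_, fun v hvn h0 => ?_, fun r hr => ?_⟩, ?_⟩
  · rw [hrd' v hvn]
    have := h1 v hvn
    split_ifs <;> omega
  · rw [hrd' v hvn] at h0
    rw [hps' v hvn]
    have := hJ v hvn
    split_ifs at h0 ⊢
    · omega
    · exact h2 v hvn h0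
  · rcases Nat.lt_succ_iff_lt_or_eq.mp hr with hr | rfl
    · refine (h3 r hr).congr fun v hvn => ?_
      have := hrd v
      simp only [classPos, hrd' v hvn, hps' v hvn]
      split_ifs <;> omega
    · refine hv.congr fun v hvn => ?_
      have := h1 v hvn
      simp only [classPos, hrd' v hvn, hps' v hvn]
      split_ifs <;> omega
  · rw [← Finset.card_sdiff_of_subset]
    · congr 1
      ext v
      simp only [Finset.mem_filter, Finset.mem_range, Finset.mem_sdiff]
      constructor
      · rintro ⟨hvn, hv0⟩
        rw [hrd' v hvn] at hv0
        split_ifs at hv0 with hp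
        exact ⟨⟨hvn, hv0⟩, fun h => hp (by omega)⟩
      · rintro ⟨⟨hvn, hv0⟩, h⟩
        refine ⟨hvn, ?_⟩
        rw [hrd' v hvn, if_neg (by intro h'; exact h ⟨hvn, by omega⟩), hv0]
    · intro v hv
      rw [Finset.mem_filter] at hv ⊢
      exact ⟨hv.1, (hrd v hv.2).2⟩

/-- The distribution of the variables to classes, one class after another: array `12` gets the numbers
of the classes, array `13` the positions, and register `14` the number of classes. -/
def classProg : Prog :=
  (.setReg 14 (.lit 0) ;; .setReg 15 (.var 0)) ;;
  .loop (.lt (.lit 0) (.var 15))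
    (searchProg ;; .setReg 14 (.add (.var 14) (.lit 1)) ;;
     .forLoop 62 0 (.ite (.lt (.lit 0) (.get 14 (.var 62)))
       (.setMem 12 (.var 62) (.var 14) ;; .setMem 13 (.var 62) (.sub (.get 14 (.var 62)) (.lit 1)))
       .skip) ;;
     .setReg 15 (.sub (.var 15) (.var 16)))

theorem classProg_spec {F : Type*} [Field F] (enum : ℕ → F) {X : ℕ} [Fact (16 ≤ X)] (s : Store F)
    {n L k J M : ℕ} {σ : Fin L → Fin n} (hk : 2 ≤ k) (hσ : IsReadK k σ)
    (hord : ∀ l (hl : l < L), s.mem 0 l = σ ⟨l, hl⟩)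
    (h0 : s.reg 0 = n) (h4 : s.reg 4 = L) (h9 : s.reg 9 = M) (h11 : s.reg 11 = 2 * k + 2)
    (h12 : s.reg 12 = n + 1) (h17 : s.reg 17 = (n + 1) ^ M) (h18 : s.reg 18 = M + 1)
    (hn : n ≤ X) (hL : L ≤ X) (hMX : M + 1 ≤ X) (hNX : (n + 1) ^ M ≤ X)
    (hm : ∀ v < n, s.mem 12 v = 0) (hM : n ≤ M * M) (hMJ : M ≤ 2 ^ J) :
    Tri enum X classProg s 35 fun t => (∀ v < n, t.mem 12 v ≠ 0) ∧
      Classes σ (2 * k + 2) J (t.reg 14) (t.mem 12) (t.mem 13) ∧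
      (t.reg 14 : ℝ) ≤ 2 ^ (k * k + 1) * (n : ℝ) ^ (1 - 1 / (2 : ℝ) ^ (k - 1)) := by
  have hord' : ∀ l < L, s.mem 0 l < n := fun l hl => by rw [hord l hl]; exact Fin.is_lt _
  refine Tri.seq (m₁ := 2) (m₂ := 34) (Q₁ := fun t => t.reg 14 = 0 ∧ t.reg 15 = n)
    (Tri.flat rfl (by decide) (by simp [Prog.out, NExp.val, h0]) le_rfl) ?_ (by omega) (by omega)
  intro t hst ⟨t14, t15⟩
  have t0 : t.reg 0 = n := (hst.reg 0 rfl).trans h0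
  have t4 : t.reg 4 = L := (hst.reg 4 rfl).trans h4
  have t9 : t.reg 9 = M := (hst.reg 9 rfl).trans h9
  have t11 : t.reg 11 = 2 * k + 2 := (hst.reg 11 rfl).trans h11
  have t12 : t.reg 12 = n + 1 := (hst.reg 12 rfl).trans h12
  have t17 : t.reg 17 = (n + 1) ^ M := (hst.reg 17 rfl).trans h17
  have t18 : t.reg 18 = M + 1 := (hst.reg 18 rfl).trans h18
  have tm0 : t.mem 0 = s.mem 0 := hst.mem 0 rfl
  have tm12 : t.mem 12 = s.mem 12 := hst.mem 12 rfl
  -- The number of classes plus the potential of the unassigned variables never increases; at the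
  -- end it bounds the number of classes. The variant is the number of unassigned variables.
  refine Tri.loop (m' := 30) (fun u =>
    u.reg 15 = ((Finset.range n).filter fun v => u.mem 12 v = 0).card ∧
    Classes σ (2 * k + 2) J (u.reg 14) (u.mem 12) (u.mem 13) ∧
    (u.reg 14 : ℝ) + 2 ^ (k * k + 1) * (u.reg 15 : ℝ) ^ (1 - 1 / (2 : ℝ) ^ (k - 1)) ≤
      2 ^ (k * k + 1) * (n : ℝ) ^ (1 - 1 / (2 : ℝ) ^ (k - 1))) (fun u => u.reg 15) (by decide)
    ?_ (by omega) ?_ ?_ (by omega)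
  · refine ⟨?_, ⟨fun v hv => ?_, fun v hv h => ?_, fun r hr => ?_⟩, ?_⟩
    · rw [t15, tm12, Finset.filter_true_of_mem, Finset.card_range]
      exact fun v hv => hm v (by simpa using hv)
    · rw [tm12, hm v hv]
      exact Nat.zero_le _
    · rw [tm12, hm v hv] at h
      exact absurd rfl h
    · omega
    · rw [t14, t15]
      simp
  · intro u htu ⟨u15, hcl, hpot⟩ hb
    simp only [Test.Holds, NExp.val] at hb
    have u0 : u.reg 0 = n := (htu.reg 0 rfl).trans t0
    have u4 : u.reg 4 = L := (htu.reg 4 rfl).trans t4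
    have u9 : u.reg 9 = M := (htu.reg 9 rfl).trans t9
    have u11 : u.reg 11 = 2 * k + 2 := (htu.reg 11 rfl).trans t11
    have u12 : u.reg 12 = n + 1 := (htu.reg 12 rfl).trans t12
    have u17 : u.reg 17 = (n + 1) ^ M := (htu.reg 17 rfl).trans t17
    have u18 : u.reg 18 = M + 1 := (htu.reg 18 rfl).trans t18
    have um0 : u.mem 0 = s.mem 0 := (htu.mem 0 rfl).trans tm0
    refine Tri.seq (m₁ := 27) (m₂ := 29) (searchProg_spec enum u (by omega) (by omega) (by omega)
      (by omega) (by rw [u0, u4, um0]; exact hord') (by omega) (by omega)) ?_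
      (by omega) (by omega)
    rw [u0, u4, u9, u11, u12, u17, um0]
    intro a hua ⟨ha1, ha2⟩
    have a0 : a.reg 0 = n := (hua.reg 0 rfl).trans u0
    have a14 := hua.reg 14 rfl
    have a15 := hua.reg 15 rfl
    have am12 := hua.mem 12 rfl
    have am13 := hua.mem 13 rfl
    obtain ⟨sz, hsz, δ, hδ, hδs⟩ := exists_score (show 1 ≤ k by omega) hσ (rd := u.mem 12) hord M
    rw [← u15] at hsz
    obtain ⟨c, hc, hcδ⟩ := exists_code (E := n + 1) M δ (fun i => Nat.lt_succ_of_le (hδ i))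
    have hbest : min sz M ≤ a.reg 16 := by
      refine hδs.trans ((le_of_eq ?_).trans (ha1 c hc))
      exact score_congr fun j hj => (hcδ j hj).symm
    have hrn : u.reg 15 ≤ n := by
      rw [u15]
      exact (Finset.card_filter_le _ _).trans (by simp)
    -- The best score is not `0` as long as some variable is unassigned.
    obtain ⟨δ', hδ', hδm⟩ : ∃ δ, a.reg 16 = score δ (u.mem 12) (s.mem 0) n L M (2 * k + 2) ∧
        ∀ v < n, a.mem 14 v = (buildPos δ (u.mem 12) n M).1 v := by
      rcases ha2 with h | h
      · have := (classes_potential_step hk hM hrn hb hsz hbest (by omega)).1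
        omega
      · exact h
    have hpos : 0 < a.reg 16 := by
      by_contra hcon
      have := (classes_potential_step hk hM hrn hb hsz hbest (by omega)).1
      exact hcon this
    rw [hδ'] at hpos
    obtain ⟨b1, b2, b3, b4, b5⟩ := score_sound hord hpos
    rw [← hδ'] at b1 b2 b4 hpos
    have hle : a.reg 16 ≤ u.reg 15 := by
      rw [u15, ← b4]
      refine Finset.card_le_card fun v hv => ?_
      rw [Finset.mem_filter] at hv ⊢
      exact ⟨hv.1, (b3 v hv.2).2⟩
    have hstep := (classes_potential_step hk hM hrn hb hsz hbest hle).2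
    refine Tri.seq (m₁ := 2) (m₂ := 8) (Q₁ := fun x => x.reg 14 = u.reg 14 + 1)
      (Tri.flat rfl (by decide) (by simp [Prog.out, NExp.val, a14]) le_rfl) ?_ (by omega) (by omega)
    intro x hax x14
    have x0 : x.reg 0 = n := (hax.reg 0 rfl).trans a0
    have xm12 : x.mem 12 = u.mem 12 := (hax.mem 12 rfl).trans am12
    have xm13 : x.mem 13 = u.mem 13 := (hax.mem 13 rfl).trans am13
    have xm14 := hax.mem 14 rfl
    refine Tri.seq (m₁ := 7) (m₂ := 2) (Q₁ := fun y => ∀ v < n,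
      y.mem 12 v = (if 0 < a.mem 14 v then u.reg 14 + 1 else u.mem 12 v) ∧
      y.mem 13 v = (if 0 < a.mem 14 v then a.mem 14 v - 1 else u.mem 13 v))
      (Tri.forLoop (m' := 2) n (fun i y => ∀ v < n,
        y.mem 12 v = (if v < i ∧ 0 < a.mem 14 v then u.reg 14 + 1 else u.mem 12 v) ∧
        y.mem 13 v = (if v < i ∧ 0 < a.mem 14 v then a.mem 14 v - 1 else u.mem 13 v)) x0 hn
        (by decide) rfl rfl ?_ ?_ ?_ le_rfl le_rfl) ?_ (by omega) (by omega)
    · simp [Store.put, xm12, xm13]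
    · intro i hi y hxy hyi hy
      have y14 : y.reg 14 = u.reg 14 + 1 := (hxy.reg 14 rfl).trans x14
      have ym14 : y.mem 14 = a.mem 14 := (hxy.mem 14 rfl).trans xm14
      refine Tri.flat rfl (by decide) ?_ le_rfl
      intro v hv
      obtain ⟨hy1, hy2⟩ := hy v hv
      by_cases hp : 0 < a.mem 14 i
      · by_cases hvi : v = i
        · simp [Prog.out, NExp.val, Test.Holds, Store.put, hyi, ym14, y14, hp, hvi]
        · have : v < i + 1 ↔ v < i := by omega
          simp [Prog.out, NExp.val, Test.Holds, Store.put, hyi, ym14, y14, hp, hvi, hy1, hy2, this]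
      · by_cases hvi : v = i
        · subst hvi
          simp [Prog.out, NExp.val, Test.Holds, Store.put, hyi, ym14, hp, hy1, hy2]
        · have : v < i + 1 ↔ v < i := by omega
          simp [Prog.out, NExp.val, Test.Holds, Store.put, hyi, ym14, hp, hy1, hy2, this]
    · intro y _ hy v hv
      simpa [hv] using hy v hv
    · intro y hxy hy
      have y14 : y.reg 14 = u.reg 14 + 1 := (hxy.reg 14 rfl).trans x14
      have y15 : y.reg 15 = u.reg 15 := by rw [hxy.reg 15 rfl, hax.reg 15 rfl, a15]
      have y16 : y.reg 16 = a.reg 16 := by rw [hxy.reg 16 rfl, hax.reg 16 rfl]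
      obtain ⟨e1, e2⟩ := hcl.step (rd' := y.mem 12) (ps' := y.mem 13)
        (fun v _ => ((b2 v).trans b1).trans hMJ) b3 b5
        (fun v hv => by rw [(hy v hv).1, hδm v hv]) (fun v hv => by rw [(hy v hv).2, hδm v hv])
      rw [b4, ← u15] at e2
      refine Tri.flat rfl (by decide) ?_ le_rfl
      simp only [Prog.out, NExp.val, Function.update_self, y15, y16,
        Function.update_of_ne (show (14 : ℕ) ≠ 15 by decide), y14]
      refine ⟨⟨e2.symm, e1, ?_⟩, by omega⟩
      push_cast at hstep ⊢
      linarith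
  · intro u htu ⟨u15, hcl, hpot⟩ hb
    simp only [Test.Holds, NExp.val, not_lt, Nat.le_zero] at hb
    rw [hb] at u15 hpot
    refine ⟨fun v hv h => ?_, hcl, ?_⟩
    · have := Finset.card_eq_zero.mp u15.symm
      have hmem : v ∈ (Finset.range n).filter fun v => u.mem 12 v = 0 := by simp [hv, h]
      rw [this] at hmem
      simp at hmem
    · have : (0 : ℝ) ≤ 2 ^ (k * k + 1) * ((0 : ℕ) : ℝ) ^ (1 - 1 / (2 : ℝ) ^ (k - 1)) := by positivity
      linarith


/-! ### The read-once case and the parameters -/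

theorem IsReadK.injective {n L : ℕ} {σ : Fin L → Fin n} (h : IsReadK 1 σ) :
    Function.Injective σ := fun a b hab =>
  Finset.card_le_one.mp (h (σ a)) a (by simp) b (by simp [hab])

theorem IsReadK.length_le {n L k : ℕ} {σ : Fin L → Fin n} (h : IsReadK k σ) : L ≤ n * k := by
  have h1 := Finset.card_eq_sum_card_fiberwise (f := σ) (s := Finset.univ) (t := Finset.univ)
    (by intro x _; simp)
  rw [Finset.card_univ, Fintype.card_fin] at h1
  calc L = _ := h1
    _ ≤ ∑ _i : Fin n, k := Finset.sum_le_sum fun i _ => h i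
    _ = n * k := by simp

open Classical in
/-- The time at which a variable is read, and a time after the end for the variables
that are not read. -/
noncomputable def readPos {n L : ℕ} (σ : Fin L → Fin n) (v : ℕ) : ℕ :=
  if h : ∃ l : Fin L, (σ l : ℕ) = v then h.choose else n + v

theorem readPos_apply {n L : ℕ} {σ : Fin L → Fin n} (h : Function.Injective σ) (l : Fin L) :
    readPos σ (σ l) = l := by
  have h' : ∃ l' : Fin L, (σ l' : ℕ) = σ l := ⟨l, rfl⟩
  rw [readPos, dif_pos h']
  exact congrArg Fin.val (h (Fin.ext h'.choose_spec))

/-- Ordered by reading times, an initial segment of a read-once order is one block. Since `L ≤ n`,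
unread variables can be placed at `n + v`, after all the others; this is why `2 ^ J` has to reach `2
* n`. -/
theorem classes_readPos {n L J : ℕ} {σ : Fin L → Fin n} (hσ : IsReadK 1 σ) (hJ : 2 * n ≤ 2 ^ J)
    {rd ps : ℕ → ℕ} (hrd : ∀ v < n, rd v = 1) (hps : ∀ v < n, ps v = readPos σ v) :
    Classes σ (2 * 1 + 2) J 1 rd ps := by
  have hinj := hσ.injective
  have hL := hσ.length_le
  have hcases : ∀ v < n, (∃ l : Fin L, (σ l : ℕ) = v ∧ ps v = l) ∨
      ((¬ ∃ l : Fin L, (σ l : ℕ) = v) ∧ ps v = n + v) := by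
    intro v hv
    by_cases h : ∃ l : Fin L, (σ l : ℕ) = v
    · obtain ⟨l, rfl⟩ := h
      exact Or.inl ⟨l, rfl, by rw [hps _ hv, readPos_apply hinj]⟩
    · refine Or.inr ⟨h, ?_⟩
      rw [hps v hv, readPos, dif_neg h]
  refine ⟨fun v hv => (hrd v hv).le, fun v hv _ => ?_, fun r hr => ?_⟩
  · rcases hcases v hv with ⟨l, _, h⟩ | ⟨_, h⟩
    · have := l.2
      omega
    · omega
  · obtain rfl : r = 0 := by omega
    have hcp : ∀ v < n, classPos rd ps (0 + 1) v = ps v + 1 := fun v hv => by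
      simp [classPos, hrd v hv]
    refine ⟨fun u hu v hv _ huv => ?_, fun q => ?_⟩
    · rw [hcp u hu, hcp v hv] at huv
      rcases hcases u hu with ⟨l, hl, h⟩ | ⟨_, h⟩ <;> rcases hcases v hv with ⟨l', hl', h'⟩ | ⟨_, h'⟩
      · have : l = l' := Fin.ext (by omega)
        rw [← hl, ← hl', this]
      · have := l.2
        omega
      · have := l'.2
        omega
      · omega
    · have htag : ∀ l < L, readTag σ (classPos rd ps (0 + 1)) l = l + 1 := fun l hl => by
        rw [readTag, dif_pos hl, hcp _ (Fin.is_lt _), hps _ (Fin.is_lt _), readPos_apply hinj]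
      refine (switchRun_le_of_label _ _ (fun l => if l + 1 ≤ q then 0 else 1) L 1 ?_ ?_ ?_).trans
        (by omega)
      · intro i j hij _ _ _
        split_ifs <;> omega
      · intro i _ _
        split_ifs <;> omega
      · intro i j hij hj _ _ h
        rw [htag i (by omega), htag j hj]
        split_ifs at h with h1 h2 h2 <;> simp [h1, h2]

/-- The distribution of the variables of a read-once order to one class. -/
def singleProg : Prog :=
  .setReg 14 (.lit 1) ;;
  .forLoop 62 4 (.setReg 48 (.get 0 (.var 62)) ;;
    .setMem 12 (.var 48) (.lit 1) ;; .setMem 13 (.var 48) (.var 62)) ;;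
  .forLoop 62 0 (.ite (.lt (.get 12 (.var 62)) (.lit 1))
    (.setMem 12 (.var 62) (.lit 1) ;; .setMem 13 (.var 62) (.add (.var 0) (.var 62))) .skip)

theorem singleProg_spec {F : Type*} [Field F] (enum : ℕ → F) {X : ℕ} [Fact (16 ≤ X)] (s : Store F)
    {n L J : ℕ} {σ : Fin L → Fin n} (hσ : IsReadK 1 σ)
    (hord : ∀ l (hl : l < L), s.mem 0 l = σ ⟨l, hl⟩)
    (h0 : s.reg 0 = n) (h4 : s.reg 4 = L) (hn : n ≤ X) (hL : L ≤ X)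
    (hm : ∀ v < n, s.mem 12 v = 0) (hJ : 2 * n ≤ 2 ^ J) :
    Tri enum X singleProg s 10 fun t => t.reg 14 = 1 ∧ (∀ v < n, t.mem 12 v ≠ 0) ∧
      Classes σ (2 * 1 + 2) J 1 (t.mem 12) (t.mem 13) := by
  classical
  have hinj := hσ.injective
  refine Tri.seq (m₁ := 2) (m₂ := 9) (Q₁ := fun t => t.reg 14 = 1)
    (Tri.flat rfl (by decide) (by simp [Prog.out, NExp.val]) le_rfl) ?_ (by omega) (by omega)
  intro t hst t14
  have t0 : t.reg 0 = n := (hst.reg 0 rfl).trans h0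
  have t4 : t.reg 4 = L := (hst.reg 4 rfl).trans h4
  have tm0 : t.mem 0 = s.mem 0 := hst.mem 0 rfl
  have tm12 : t.mem 12 = s.mem 12 := hst.mem 12 rfl
  refine Tri.seq (m₁ := 7) (m₂ := 8) (Q₁ := fun u => ∀ v < n,
      u.mem 12 v = (if ∃ l : Fin L, (σ l : ℕ) = v then 1 else 0) ∧
      (u.mem 12 v ≠ 0 → u.mem 13 v = readPos σ v))
    (Tri.forLoop (m' := 2) L (fun i u => ∀ v < n,
      u.mem 12 v = (if ∃ l : Fin L, l < i ∧ (σ l : ℕ) = v then 1 else 0) ∧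
      (u.mem 12 v ≠ 0 → u.mem 13 v = readPos σ v)) t4 hL (by decide) rfl rfl ?_ ?_ ?_ le_rfl le_rfl)
    ?_ (by omega) (by omega)
  · intro v hv
    simp [Store.put, tm12, hm v hv]
  · intro i hi u htu hui hu
    have um0 : u.mem 0 = s.mem 0 := (htu.mem 0 rfl).trans tm0
    refine Tri.flat rfl (by decide) ?_ le_rfl
    intro v hv
    obtain ⟨hu1, hu2⟩ := hu v hv
    by_cases hvi : v = σ ⟨i, hi⟩
    · have hex : ∃ l : Fin L, l < i + 1 ∧ (σ l : ℕ) = v := ⟨⟨i, hi⟩, by simp, hvi.symm⟩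
      rw [if_pos hex]
      simp [Prog.out, NExp.val, Store.put, hui, um0, hord i hi, hvi, readPos_apply hinj]
    · have hex : (∃ l : Fin L, l < i + 1 ∧ (σ l : ℕ) = v) ↔ ∃ l : Fin L, l < i ∧ (σ l : ℕ) = v := by
        refine exists_congr fun l => and_congr_left fun h => ?_
        constructor
        · intro hl
          rcases Nat.lt_succ_iff_lt_or_eq.mp hl with h' | h'
          · exact h'
          · exact absurd h.symm (by rw [show l = ⟨i, hi⟩ from Fin.ext h']; exact hvi)
        · omega
      simp only [hex]
      simpa [Prog.out, NExp.val, Store.put, hui, um0, hord i hi, hvi] using hu v hv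
  · intro u _ hu v hv
    simpa using hu v hv
  · intro u htu hu
    have u0 : u.reg 0 = n := (htu.reg 0 rfl).trans t0
    have u14 : u.reg 14 = 1 := (htu.reg 14 rfl).trans t14
    refine Tri.forLoop (m' := 2) n (fun i x => ∀ v < n,
      x.mem 12 v = (if v < i ∨ ∃ l : Fin L, (σ l : ℕ) = v then 1 else 0) ∧
      (x.mem 12 v ≠ 0 → x.mem 13 v = readPos σ v)) u0 hn (by decide) rfl rfl ?_ ?_ ?_ le_rfl
      (by omega)
    · simpa [Store.put] using hu
    · intro i hi x hux hxi hx
      have x0 : x.reg 0 = n := (hux.reg 0 rfl).trans u0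
      refine Tri.flat rfl (by decide) ?_ le_rfl
      intro v hv
      by_cases hvi : v = i
      · subst hvi
        obtain ⟨hx1, hx2⟩ := hx v hv
        by_cases h : ∃ l : Fin L, (σ l : ℕ) = v
        · rw [if_pos (Or.inr h)] at hx1
          simp [Prog.out, NExp.val, Test.Holds, Store.put, hxi, hx1, hx2]
        · rw [if_neg (by simpa using h)] at hx1
          simp [Prog.out, NExp.val, Test.Holds, Store.put, hxi, hx1, x0, readPos, h]
      · have h1 : v < i + 1 ↔ v < i := by omega
        simp only [h1]
        by_cases h : x.mem 12 i < 1
        · rw [Nat.lt_one_iff] at h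
          simpa [Prog.out, NExp.val, Test.Holds, Store.put, hxi, x0, h, hvi] using hx v hv
        · rw [Nat.lt_one_iff] at h
          simpa [Prog.out, NExp.val, Test.Holds, Store.put, hxi, x0, h, hvi] using hx v hv
    · intro x hux hx
      refine ⟨(hux.reg 14 rfl).trans u14, fun v hv => ?_, ?_⟩
      · rw [(hx v hv).1, if_pos (Or.inl hv)]
        exact one_ne_zero
      · have h1 : ∀ v < n, x.mem 12 v = 1 := fun v hv => by rw [(hx v hv).1, if_pos (Or.inl hv)]
        exact classes_readPos hσ hJ h1 fun v hv => (hx v hv).2 (by rw [h1 v hv]; exact one_ne_zero)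

/-- Register `13` gets the logarithm of twice the number in register `0`, rounded up. -/
def logProg : Prog :=
  (.setReg 13 (.lit 0) ;; .setReg 56 (.lit 1)) ;;
  .loop (.lt (.var 56) (.add (.var 0) (.var 0)))
    (.setReg 56 (.add (.var 56) (.var 56)) ;; .setReg 13 (.add (.var 13) (.lit 1)))

theorem logProg_spec {F : Type*} [Field F] (enum : ℕ → F) {X : ℕ} [Fact (16 ≤ X)] (s : Store F)
    (h0 : 1 ≤ s.reg 0) (hX : 2 * s.reg 0 ≤ X) :
    Tri enum X logProg s 6 fun t => 2 * s.reg 0 ≤ 2 ^ t.reg 13 ∧ 2 ^ t.reg 13 ≤ 4 * s.reg 0 := by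
  refine Tri.seq (m₁ := 2) (m₂ := 5) (Q₁ := fun t => t.reg 13 = 0 ∧ t.reg 56 = 1)
    (Tri.flat rfl (by decide) (by simp [Prog.out, NExp.val]) le_rfl) ?_ (by omega) (by omega)
  intro t hst ⟨h1, h2⟩
  refine Tri.loop (m' := 2) (fun u => u.reg 56 = 2 ^ u.reg 13 ∧ u.reg 56 ≤ 4 * s.reg 0)
    (fun u => 2 * s.reg 0 - u.reg 56) (by decide) ?_ (by omega) ?_ ?_ le_rfl
  · rw [h1, h2]
    exact ⟨rfl, by omega⟩
  · intro u htu ⟨hu1, hu2⟩ hb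
    have u0 : u.reg 0 = s.reg 0 := (htu.reg 0 rfl).trans (hst.reg 0 rfl)
    simp only [Test.Holds, NExp.val, u0] at hb
    have hp : 0 < u.reg 56 := by rw [hu1]; positivity
    refine Tri.flat rfl (by decide) ?_ le_rfl
    simp [Prog.out, NExp.val]
    refine ⟨⟨?_, by omega⟩, by omega⟩
    rw [pow_succ, ← hu1]
    ring
  · intro u htu ⟨hu1, hu2⟩ hb
    have u0 : u.reg 0 = s.reg 0 := (htu.reg 0 rfl).trans (hst.reg 0 rfl)
    simp only [Test.Holds, NExp.val, u0] at hb
    rw [← hu1]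
    exact ⟨by omega, hu2⟩

/-- Register `9` gets the square root of the number in register `0`, rounded up. -/
def sqrtProg : Prog :=
  (.setReg 9 (.lit 0) ;; .setReg 57 (.lit 0)) ;;
  .loop (.lt (.var 57) (.var 0))
    -- Register `57` holds the square of register `9`, updated by `(m + 1) ^ 2 = m ^ 2 + 1 + 2 * m`.
    (.setReg 57 (.add (.add (.var 57) (.lit 1)) (.add (.var 9) (.var 9))) ;;
     .setReg 9 (.add (.var 9) (.lit 1)))

theorem sqrtProg_spec {F : Type*} [Field F] (enum : ℕ → F) {X : ℕ} [Fact (16 ≤ X)] (s : Store F)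
    (hX : s.reg 0 ≤ X) :
    Tri enum X sqrtProg s 6 fun t => s.reg 0 ≤ t.reg 9 * t.reg 9 ∧ t.reg 9 ≤ s.reg 0 ∧
      t.reg 9 ≤ Nat.sqrt (s.reg 0) + 1 := by
  refine Tri.seq (m₁ := 2) (m₂ := 5) (Q₁ := fun t => t.reg 9 = 0 ∧ t.reg 57 = 0)
    (Tri.flat rfl (by decide) (by simp [Prog.out, NExp.val]) le_rfl) ?_ (by omega) (by omega)
  intro t hst ⟨h1, h2⟩
  refine Tri.loop (m' := 2) (fun u => u.reg 57 = u.reg 9 * u.reg 9 ∧ u.reg 9 ≤ s.reg 0 ∧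
      u.reg 9 ≤ Nat.sqrt (s.reg 0) + 1)
    (fun u => s.reg 0 - u.reg 57) (by decide) ?_ (by omega) ?_ ?_ le_rfl
  · simp [h1, h2]
  · intro u htu ⟨hu1, hu2, hu3⟩ hb
    have u0 : u.reg 0 = s.reg 0 := (htu.reg 0 rfl).trans (hst.reg 0 rfl)
    simp only [Test.Holds, NExp.val, u0] at hb
    have h3 : u.reg 9 ≤ Nat.sqrt (s.reg 0) := Nat.le_sqrt.mpr (by omega)
    have h4 : u.reg 9 ≤ u.reg 57 := by rw [hu1]; exact Nat.le_mul_self _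
    refine Tri.flat rfl (by decide) ?_ le_rfl
    simp [Prog.out, NExp.val]
    refine ⟨⟨?_, by omega, h3⟩, by omega⟩
    rw [hu1]
    ring
  · intro u htu ⟨hu1, hu2⟩ hb
    have u0 : u.reg 0 = s.reg 0 := (htu.reg 0 rfl).trans (hst.reg 0 rfl)
    simp only [Test.Holds, NExp.val, u0] at hb
    exact ⟨by omega, hu2⟩


/-- The computation of the parameters of the generator: the numbers `R` and `E` in registers `6` and
`7`, the square of `R` in register `10`, and the logarithm `J` of the size of a class
in register `13`. -/
def paramProg : Prog :=
  (.setReg 5 (.add (.add (.var 0) (.var 1)) (.add (.var 2) (.lit 2))) ;;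
   .setReg 11 (.add (.add (.var 3) (.var 3)) (.lit 2)) ;;
   .setReg 12 (.add (.var 0) (.lit 1)) ;;
   .setReg 19 (.add (.var 2) (.lit 1)) ;;
   -- Register `55` becomes `8 * k`. With `b = n + w + d + 2` in register `5`, the exponents `8 * k`
   -- and five times that give `R = b ^ (8 * k)` and `E = b ^ (40 * k)`.
   .setReg 55 (.add (.add (.var 3) (.var 3)) (.add (.var 3) (.var 3))) ;;
   .setReg 55 (.add (.var 55) (.var 55)) ;;
   .setReg 20 (.var 5) ;; .setReg 21 (.var 55)) ;;
  powProg ;;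
  (.setReg 6 (.var 22) ;;
   .setReg 21 (.add (.var 55) (.add (.add (.var 55) (.var 55)) (.add (.var 55) (.var 55))))) ;;
  powProg ;;
  (.setReg 7 (.var 22) ;; .setReg 20 (.var 6) ;; .setReg 21 (.lit 2)) ;;
  powProg ;;
  .setReg 10 (.var 22) ;;
  logProg ;;
  .setReg 8 (.add (.var 13) (.lit 1))

theorem paramProg_spec {F : Type*} [Field F] (enum : ℕ → F) {X : ℕ} [Fact (16 ≤ X)] (s : Store F)
    {n w d k : ℕ} (hn1 : 1 ≤ n) (hk : 1 ≤ k)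
    (h0 : s.reg 0 = n) (h1 : s.reg 1 = w) (h2 : s.reg 2 = d) (h3 : s.reg 3 = k)
    (hE : (n + w + d + 2) ^ (40 * k) ≤ X) :
    Tri enum X paramProg s 24 fun t =>
      t.reg 6 = (n + w + d + 2) ^ (8 * k) ∧ t.reg 7 = (n + w + d + 2) ^ (40 * k) ∧
      t.reg 10 = t.reg 6 * t.reg 6 ∧ t.reg 8 = t.reg 13 + 1 ∧ 2 * n ≤ 2 ^ t.reg 13 ∧
      2 ^ t.reg 13 ≤ 4 * n ∧ t.reg 11 = 2 * k + 2 ∧ t.reg 12 = n + 1 ∧ t.reg 19 = d + 1 := by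
  set b := n + w + d + 2 with hb
  have hpow : ∀ e, e ≤ 40 * k → b ^ e ≤ X := fun e he =>
    (Nat.pow_le_pow_right (by omega) he).trans hE
  have hkX : 40 * k ≤ X := (Nat.lt_pow_self (by omega : 1 < b)).le.trans hE
  have hbX : b ≤ X := by simpa using hpow 1 (by omega)
  have hnX : 2 * n ≤ X := by
    have h2 := hpow 2 (by omega)
    rw [sq] at h2
    nlinarith [Nat.mul_le_mul_right b (show 2 ≤ b by omega)]
  refine Tri.seq (m₁ := 2) (m₂ := 23) (Q₁ := fun t => t.reg 5 = b ∧ t.reg 11 = 2 * k + 2 ∧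
    t.reg 12 = n + 1 ∧ t.reg 19 = d + 1 ∧ t.reg 55 = 8 * k ∧ t.reg 20 = b ∧ t.reg 21 = 8 * k)
    (Tri.flat rfl (by decide) ?_ le_rfl) ?_ (by omega) (by omega)
  · simp [Prog.out, NExp.val, h0, h1, h2, h3]
    omega
  intro t hst ⟨t5, t11, t12, t19, t55, t20, t21⟩
  refine Tri.seq (m₁ := 15) (m₂ := 22) (powProg_spec enum t (by omega) (by omega)) ?_ (by omega)
    (by omega)
  rw [t20, t21]
  intro u htu u22
  have u55 : u.reg 55 = 8 * k := (htu.reg 55 rfl).trans t55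
  refine Tri.seq (m₁ := 2) (m₂ := 21) (Q₁ := fun t => t.reg 6 = b ^ (8 * k) ∧ t.reg 21 = 40 * k)
    (Tri.flat rfl (by decide) ?_ le_rfl) ?_ (by omega) (by omega)
  · simp [Prog.out, NExp.val, u22, u55]
    omega
  intro x hux ⟨x6, x21⟩
  have x20 : x.reg 20 = b := (hux.reg 20 rfl).trans ((htu.reg 20 rfl).trans t20)
  refine Tri.seq (m₁ := 15) (m₂ := 20) (powProg_spec enum x (by omega) (by omega)) ?_ (by omega)
    (by omega)
  rw [x20, x21]
  intro y hxy y22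
  have y6 : y.reg 6 = b ^ (8 * k) := (hxy.reg 6 rfl).trans x6
  refine Tri.seq (m₁ := 2) (m₂ := 19) (Q₁ := fun t => t.reg 7 = b ^ (40 * k) ∧
    t.reg 20 = b ^ (8 * k) ∧ t.reg 21 = 2)
    (Tri.flat rfl (by decide) ?_ le_rfl) ?_ (by omega) (by omega)
  · simp [Prog.out, NExp.val, y22, y6]
  intro z hyz ⟨z7, z20, z21⟩
  refine Tri.seq (m₁ := 15) (m₂ := 18) (powProg_spec enum z (by
    rw [z20]; exact hpow _ (by omega)) (by omega)) ?_ (by omega) (by omega)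
  rw [z20, z21]
  intro a hza a22
  refine Tri.seq (m₁ := 2) (m₂ := 17) (Q₁ := fun t => t.reg 10 = b ^ (8 * k) * b ^ (8 * k))
    (Tri.flat rfl (by decide) ?_ le_rfl) ?_ (by omega) (by omega)
  · simp [Prog.out, NExp.val, a22, sq]
  intro c hac c10
  have hc : ∀ r, r ∈ [0, 11, 12, 19] → c.reg r = t.reg r := by
    intro r hr
    fin_cases hr <;> rw [hac.reg _ rfl, hza.reg _ rfl, hyz.reg _ rfl, hxy.reg _ rfl, hux.reg _ rfl,
      htu.reg _ rfl]
  have c0 : c.reg 0 = n := by rw [hc 0 (by simp), hst.reg 0 rfl, h0]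
  have c6 : c.reg 6 = b ^ (8 * k) := by rw [hac.reg 6 rfl, hza.reg 6 rfl, hyz.reg 6 rfl, y6]
  have c7 : c.reg 7 = b ^ (40 * k) := by rw [hac.reg 7 rfl, hza.reg 7 rfl, z7]
  refine Tri.seq (m₁ := 6) (m₂ := 2) (logProg_spec enum c (by omega) (by omega)) ?_ (by omega)
    (by omega)
  rw [c0]
  intro e hce ⟨e1, e2⟩
  refine Tri.flat rfl (by decide) ?_ le_rfl
  simp [Prog.out, NExp.val, hce.reg 6 rfl, hce.reg 7 rfl, hce.reg 10 rfl, hce.reg 11 rfl,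
    hce.reg 12 rfl, hce.reg 19 rfl, c6, c7, c10, hc 11, hc 12, hc 19, t11, t12, t19, e1, e2]

/-- The distribution of the variables to classes. -/
def partitionProg : Prog :=
  -- For `k = 1` the power of `n` in the bound is `n ^ 0`, which leaves no room for a search through
  -- lists of length about `√n`.
  .ite (.lt (.var 3) (.lit 2)) singleProg
    (sqrtProg ;;
     (.setReg 18 (.add (.var 9) (.lit 1)) ;; .setReg 20 (.var 12) ;; .setReg 21 (.var 9)) ;;
     powProg ;; .setReg 17 (.var 22) ;; classProg)

theorem partitionProg_spec {F : Type*} [Field F] (enum : ℕ → F) {X : ℕ} [Fact (16 ≤ X)]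
    (s : Store F) {n L k J : ℕ} {σ : Fin L → Fin n} (hn1 : 1 ≤ n) (hk : 1 ≤ k) (hσ : IsReadK k σ)
    (hord : ∀ l (hl : l < L), s.mem 0 l = σ ⟨l, hl⟩)
    (h0 : s.reg 0 = n) (h3 : s.reg 3 = k) (h4 : s.reg 4 = L) (h11 : s.reg 11 = 2 * k + 2)
    (h12 : s.reg 12 = n + 1)
    (hn : n + 1 ≤ X) (hL : L ≤ X) (hNX : 2 ≤ k → (n + 1) ^ (Nat.sqrt n + 1) ≤ X)
    (hm : ∀ v < n, s.mem 12 v = 0) (hJ : 2 * n ≤ 2 ^ J) :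
    Tri enum X partitionProg s 40 fun t => (∀ v < n, t.mem 12 v ≠ 0) ∧
      Classes σ (2 * k + 2) J (t.reg 14) (t.mem 12) (t.mem 13) ∧
      (t.reg 14 : ℝ) ≤ 2 ^ (k * k + 1) * (n : ℝ) ^ (1 - 1 / (2 : ℝ) ^ (k - 1)) := by
  refine Tri.ite (m' := 39) (by decide) (fun hb => ?_) (fun hb => ?_) (by omega) (by omega)
  · simp only [Test.Holds, NExp.val, h3] at hb
    obtain rfl : k = 1 := by omega
    refine Tri.mono ((singleProg_spec enum s hσ hord h0 h4 (by omega) hL hm hJ).weaken (by omega)) ?_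
    intro t _ ⟨t14, t1, t2⟩
    rw [t14]
    exact ⟨t1, t2, by norm_num⟩
  · simp only [Test.Holds, NExp.val, h3, not_lt] at hb
    refine Tri.seq (m₁ := 6) (m₂ := 38) (sqrtProg_spec enum s (by omega)) ?_ (by omega) (by omega)
    rw [h0]
    intro t hst ⟨t1, t2, t3⟩
    have hNX' : (n + 1) ^ t.reg 9 ≤ X :=
      (Nat.pow_le_pow_right (by omega) t3).trans (hNX hb)
    refine Tri.seq (m₁ := 2) (m₂ := 37) (Q₁ := fun u => u.reg 18 = t.reg 9 + 1 ∧
      u.reg 20 = n + 1 ∧ u.reg 21 = t.reg 9) (Tri.flat rfl (by decide) ?_ le_rfl) ?_ (by omega)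
      (by omega)
    · simp [Prog.out, NExp.val, hst.reg 12 rfl, h12]
    intro u htu ⟨u18, u20, u21⟩
    refine Tri.seq (m₁ := 15) (m₂ := 36) (powProg_spec enum u (by omega) (by omega)) ?_ (by omega)
      (by omega)
    rw [u20, u21]
    intro x hux x22
    refine Tri.seq (m₁ := 2) (m₂ := 35) (Q₁ := fun y => y.reg 17 = (n + 1) ^ t.reg 9)
      (Tri.flat rfl (by decide) ?_ le_rfl) ?_ (by omega) (by omega)
    · simp [Prog.out, NExp.val, x22]
    intro y hxy y17
    have hr : ∀ r, r ∈ [0, 4, 11, 12] → y.reg r = s.reg r := by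
      intro r hr
      fin_cases hr <;> rw [hxy.reg _ rfl, hux.reg _ rfl, htu.reg _ rfl, hst.reg _ rfl]
    have ym0 : y.mem 0 = s.mem 0 := by
      rw [hxy.mem _ rfl, hux.mem _ rfl, htu.mem _ rfl, hst.mem _ rfl]
    have ym12 : y.mem 12 = s.mem 12 := by
      rw [hxy.mem _ rfl, hux.mem _ rfl, htu.mem _ rfl, hst.mem _ rfl]
    have y9 : y.reg 9 = t.reg 9 := by rw [hxy.reg _ rfl, hux.reg _ rfl, htu.reg _ rfl]
    have y18 : y.reg 18 = t.reg 9 + 1 := by rw [hxy.reg _ rfl, hux.reg _ rfl, u18]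
    exact classProg_spec enum y hb hσ (by rw [ym0]; exact hord) (by rw [hr 0 (by simp), h0])
      (by rw [hr 4 (by simp), h4]) y9 (by rw [hr 11 (by simp), h11]) (by rw [hr 12 (by simp), h12])
      y17 y18 (by omega) hL (by omega) hNX' (by rw [ym12]; exact hm) t1 (by omega)


/-! ### The evaluation of the generator -/

/-- Field register `2` gets the value at field register `1` of the Lagrange polynomial with the number
in register `70` for the first nodes of the listing, as many as register `10` says. -/
def lagrProg : Prog :=
  .setFReg 2 .one ;;
  .forLoop 71 10 (.ite (.lt (.lit 0) (.add (.sub (.var 71) (.var 70)) (.sub (.var 70) (.var 71))))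
    (.setFReg 2 (.mul (.var 2) (.mul (.sub (.var 1) (.elem (.var 71)))
      (.inv (.sub (.elem (.var 70)) (.elem (.var 71))))))) .skip)

theorem lagrProg_spec {F : Type*} [Field F] (enum : ℕ → F) {X : ℕ} [Fact (16 ≤ X)] (s : Store F)
    (hX : s.reg 10 ≤ X) :
    Tri enum X lagrProg s 8 fun t =>
      t.freg 2 = (lagr enum (s.reg 10) (s.reg 70)).eval (s.freg 1) := by
  refine Tri.seq (m₁ := 2) (m₂ := 7) (Q₁ := fun t => t.freg 2 = 1)
    (Tri.flat rfl (by decide) (by simp [Prog.out, FExp.val]) le_rfl) ?_ (by omega) (by omega)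
  intro t hst ht
  refine Tri.forLoop (m' := 2) (s.reg 10) (fun N u => u.freg 2 =
    ∏ j ∈ (Finset.range N).erase (s.reg 70), (s.freg 1 - enum j) * (enum (s.reg 70) - enum j)⁻¹)
    (hst.reg 10 rfl) hX (by decide) rfl rfl ?_ ?_ ?_ le_rfl le_rfl
  · simp [Store.put, ht]
  · intro j hj u htu huj hu
    have u70 : u.reg 70 = s.reg 70 := (htu.reg 70 rfl).trans (hst.reg 70 rfl)
    have f1 : u.freg 1 = s.freg 1 := (htu.freg 1 rfl).trans (hst.freg 1 rfl)
    refine Tri.flat rfl (by decide) ?_ le_rfl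
    rw [Finset.range_add_one]
    by_cases hji : j = s.reg 70
    · rw [← hji, Finset.erase_insert (by simp)]
      rw [← hji, Finset.erase_eq_of_notMem (by simp)] at hu
      simp [Prog.out, NExp.val, Test.Holds, Store.put, huj, u70, hji, hu]
    · have h0 : 0 < (j - s.reg 70) + (s.reg 70 - j) := by omega
      rw [Finset.erase_insert_of_ne hji, Finset.prod_insert (by simp)]
      have hout : (Prog.ite (.lt (.lit 0) (.add (.sub (.var 71) (.var 70)) (.sub (.var 70) (.var 71))))
          (.setFReg 2 (.mul (.var 2) (.mul (.sub (.var 1) (.elem (.var 71)))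
            (.inv (.sub (.elem (.var 70)) (.elem (.var 71))))))) .skip).out enum u =
          { u with
            freg := Function.update u.freg 2
              (u.freg 2 * ((s.freg 1 - enum j) * (enum (s.reg 70) - enum j)⁻¹)) } := by
        rw [Prog.out, if_pos (by simpa [Test.Holds, NExp.val, huj, u70] using h0)]
        simp [Prog.out, FExp.val, NExp.val, huj, u70, f1]
      rw [hout]
      simp only [Store.put, Function.update_self]
      rw [hu, mul_comm]
  · intro u _ hu
    rw [hu, eval_lagr]

/-- The next table of values of a curve: array `1` gets the values at the powers of field
register `3`; register `72` tells which half of a class is used. -/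
def levelProg : Prog :=
  .setFReg 1 .one ;;
  .forLoop 73 6
    ((.setFReg 1 (.mul (.var 1) (.var 3)) ;; .setFReg 4 .zero ;; .setReg 70 (.lit 0)) ;;
     .forLoop 74 6
      (.forLoop 75 6
        (lagrProg ;;
         .ite (.lt (.lit 0) (.var 72))
           (.setFReg 4 (.add (.var 4) (.mul (.var 2) (.get 1 (.var 75)))))
           (.setFReg 4 (.add (.var 4) (.mul (.var 2) (.get 1 (.var 74))))) ;;
         .setReg 70 (.add (.var 70) (.lit 1)))) ;;
     .setFMem 2 (.var 73) (.var 4)) ;;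
  .forLoop 76 6 (.setFMem 1 (.var 76) (.get 2 (.var 76)))

/-- The `R` values of one curve at the powers of its seed determine the corresponding values of the
next curve, so the curves are never expanded into coefficients. Array `2` keeps the new values apart
until the old ones are no longer needed. -/
theorem levelProg_spec {F : Type*} [Field F] (enum : ℕ → F) {X : ℕ} [Fact (16 ≤ X)] (s : Store F)
    {R : ℕ} (h6 : s.reg 6 = R) (h10 : s.reg 10 = R * R) (hX : R ≤ X) (hX' : R * R ≤ X) :
    Tri enum X levelProg s 30 fun t => ∀ i < R, t.fmem 1 i = ∑ j ∈ Finset.range (R * R),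
      (lagr enum (R * R) j).eval (s.freg 3 ^ (i + 1)) *
        s.fmem 1 (if s.reg 72 = 0 then j / R else j % R) := by
  set f : ℕ → ℕ → F := fun i j => (lagr enum (R * R) j).eval (s.freg 3 ^ (i + 1)) *
        s.fmem 1 (if s.reg 72 = 0 then j / R else j % R) with hf
  refine Tri.seq (m₁ := 2) (m₂ := 29) (Q₁ := fun t => t.freg 1 = 1)
    (Tri.flat rfl (by decide) (by simp [Prog.out, FExp.val]) le_rfl) ?_ (by omega) (by omega)
  intro t hst ht
  refine Tri.seq (m₁ := 28) (m₂ := 7) (Q₁ := fun t => ∀ i < R, t.fmem 2 i =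
      ∑ j ∈ Finset.range (R * R), f i j)
    (Tri.forLoop (m' := 23) R (fun N u => u.freg 1 = s.freg 3 ^ N ∧ ∀ i < N, u.fmem 2 i =
      ∑ j ∈ Finset.range (R * R), f i j) ((hst.reg 6 rfl).trans h6) hX (by decide) rfl rfl ?_ ?_
      (fun u _ hu => hu.2) (by omega) (by omega)) ?_ (by omega) (by omega)
  · simp [Store.put, ht]
  · intro i hi u htu hui ⟨u1, hu⟩
    have u3 : u.freg 3 = s.freg 3 := (htu.freg 3 rfl).trans (hst.freg 3 rfl)
    refine Tri.seq (m₁ := 2) (m₂ := 22) (Q₁ := fun x => x.freg 1 = s.freg 3 ^ (i + 1) ∧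
        x.freg 4 = 0 ∧ x.reg 70 = 0)
      (Tri.flat rfl (by decide) ?_ le_rfl) ?_ (by omega) (by omega)
    · simp [Prog.out, FExp.val, NExp.val, u1, u3, pow_succ]
    intro x hux ⟨x1, x4, x70⟩
    have x6 : x.reg 6 = R := by rw [hux.reg _ rfl, htu.reg _ rfl, hst.reg _ rfl, h6]
    have x10 : x.reg 10 = R * R := by rw [hux.reg _ rfl, htu.reg _ rfl, hst.reg _ rfl, h10]
    have x72 : x.reg 72 = s.reg 72 := by rw [hux.reg _ rfl, htu.reg _ rfl, hst.reg _ rfl]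
    have xf1 : x.fmem 1 = s.fmem 1 := by rw [hux.fmem _ rfl, htu.fmem _ rfl, hst.fmem _ rfl]
    refine Tri.seq (m₁ := 21) (m₂ := 2) (Q₁ := fun y => y.freg 4 =
        ∑ j ∈ Finset.range (R * R), f i j)
      (Tri.forLoop (m' := 16) R (fun a y => y.reg 70 = a * R ∧ y.freg 4 =
        ∑ j ∈ Finset.range (a * R), f i j) x6 hX (by decide) rfl rfl ?_ ?_
      (fun u _ hu => hu.2) (by omega) (by omega)) ?_ (by omega) (by omega)
    · simp [Store.put, x4, x70]
    · intro a ha y hxy hya ⟨y70, y4⟩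
      refine Tri.forLoop (m' := 11) R (fun b z => z.reg 70 = a * R + b ∧ z.freg 4 =
        ∑ j ∈ Finset.range (a * R + b), f i j) ((hxy.reg 6 rfl).trans x6) hX (by decide) rfl rfl ?_ ?_
        ?_ (by omega) (by omega)
      · simp [Store.put, y4, y70]
      · intro b hb z hyz hzb ⟨z70, z4⟩
        have z10 : z.reg 10 = R * R := by rw [hyz.reg _ rfl, hxy.reg _ rfl, x10]
        have z74 : z.reg 74 = a := by rw [hyz.reg _ rfl, hya]
        have z72 : z.reg 72 = s.reg 72 := by rw [hyz.reg _ rfl, hxy.reg _ rfl, x72]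
        have z1 : z.freg 1 = s.freg 3 ^ (i + 1) := by rw [hyz.freg _ rfl, hxy.freg _ rfl, x1]
        have zf1 : z.fmem 1 = s.fmem 1 := by rw [hyz.fmem _ rfl, hxy.fmem _ rfl, xf1]
        refine Tri.seq (m₁ := 8) (m₂ := 3) (lagrProg_spec enum z (by omega)) ?_ (by omega) (by omega)
        rw [z10, z70, z1]
        intro c hzc c2
        have c70 : c.reg 70 = a * R + b := (hzc.reg _ rfl).trans z70
        have c72 : c.reg 72 = s.reg 72 := (hzc.reg _ rfl).trans z72
        have c74 : c.reg 74 = a := (hzc.reg _ rfl).trans z74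
        have c75 : c.reg 75 = b := (hzc.reg _ rfl).trans hzb
        have c4 := (hzc.freg 4 rfl).trans z4
        have cf1 : c.fmem 1 = s.fmem 1 := (hzc.fmem _ rfl).trans zf1
        have hR : 0 < R := by omega
        have e1 : (a * R + b) / R = a := by
          rw [mul_comm, Nat.mul_add_div hR, Nat.div_eq_of_lt hb, add_zero]
        have e2 : (a * R + b) % R = b := by
          rw [mul_comm, Nat.mul_add_mod, Nat.mod_eq_of_lt hb]
        refine Tri.flat rfl (by decide) ?_ (by omega)
        rw [← add_assoc, Finset.sum_range_succ, ← c4]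
        simp only [hf, e1, e2]
        by_cases hbit : s.reg 72 = 0
        · simp [Prog.out, FExp.val, NExp.val, Test.Holds, Store.put, c70, c72, hbit, c2, cf1, c74]
        · simp [Prog.out, FExp.val, NExp.val, Test.Holds, Store.put, c70, c72, hbit, c2, cf1, c75,
            Nat.pos_of_ne_zero hbit]
      · intro z _ hz
        rw [Nat.add_mul, one_mul]
        simpa [Store.put] using hz
    · intro y hxy y4
      have y73 : y.reg 73 = i := by rw [hxy.reg _ rfl, hux.reg _ rfl, hui]
      have y1 : y.freg 1 = s.freg 3 ^ (i + 1) := by rw [hxy.freg _ rfl, x1]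
      have yf2 : y.fmem 2 = u.fmem 2 := by rw [hxy.fmem _ rfl, hux.fmem _ rfl]
      refine Tri.flat rfl (by decide) ?_ (by omega)
      refine ⟨by simpa [Prog.out, Store.put] using y1, fun i' hi' => ?_⟩
      by_cases h : i' = i
      · simp [Prog.out, FExp.val, NExp.val, Store.put, h, y73, y4]
      · simpa [Prog.out, FExp.val, NExp.val, Store.put, h, y73, yf2] using hu i' (by omega)
  · intro u htu hu
    refine Tri.forLoop (m' := 2) R (fun N x => ∀ i < N, x.fmem 1 i =
      ∑ j ∈ Finset.range (R * R), f i j) (by rw [htu.reg _ rfl, hst.reg _ rfl, h6]) hX (by decide)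
      rfl rfl (by simp) ?_ (fun u _ hu => hu) le_rfl le_rfl
    intro i hi x hux hxi hx
    have xf2 := hux.fmem 2 rfl
    refine Tri.flat rfl (by decide) ?_ le_rfl
    intro i' hi'
    by_cases h : i' = i
    · simp [Prog.out, FExp.val, NExp.val, Store.put, h, hxi, xf2, hu i hi]
    · simpa [Prog.out, FExp.val, NExp.val, Store.put, h, hxi] using hx i' (by omega)

/-- The coordinate with the number in register `64` of the point whose seeds are the digits in array `10`
is put into array `3`. -/
def pointProg : Prog :=
  (.setReg 66 (.lit 0) ;; .setReg 65 (.sub (.get 12 (.var 64)) (.lit 1))) ;;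
  .forLoop 67 65 (.setReg 66 (.add (.var 66) (.var 8))) ;;
  (.setFReg 3 (.elem (.get 10 (.var 66))) ;; .setFReg 1 .one) ;;
  .forLoop 68 6 (.setFReg 1 (.mul (.var 1) (.var 3)) ;; .setFMem 1 (.var 68) (.var 1)) ;;
  (.setReg 30 (.get 13 (.var 64)) ;; .setReg 31 (.lit 2)) ;;
  .forLoop 69 13
    (divProg ;;
     (.setReg 72 (.var 30) ;; .setReg 30 (.var 34) ;; .setReg 66 (.add (.var 66) (.lit 1)) ;;
      .setFReg 3 (.elem (.get 10 (.var 66)))) ;;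
     levelProg) ;;
  .setFMem 3 (.var 64) (.get 1 (.lit 0))

theorem pointProg_spec {F : Type*} [Field F] (enum : ℕ → F) {X : ℕ} [Fact (16 ≤ X)] (s : Store F)
    {R J v : ℕ} (h6 : s.reg 6 = R) (h10 : s.reg 10 = R * R) (h8 : s.reg 8 = J + 1)
    (h13 : s.reg 13 = J) (h64 : s.reg 64 = v) (hR : 0 < R) (hX' : R * R ≤ X) (hJ : J ≤ X)
    (hrd : s.mem 12 v ≤ X) (hps : s.mem 13 v ≤ X) :
    Tri enum X pointProg s 45 fun t => t.fmem 3 = Function.update (s.fmem 3) v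
      (genPoint enum R J (fun v => s.mem 12 v - 1) (s.mem 13) (fun r i => s.mem 10 (r * (J + 1) + i))
        v) := by
  have hX : R ≤ X := (Nat.le_mul_self R).trans hX'
  set r := s.mem 12 v - 1 with hr
  set α : ℕ → F := fun i => enum (s.mem 10 (r * (J + 1) + i)) with hα
  refine Tri.seq (m₁ := 2) (m₂ := 44) (Q₁ := fun t => t.reg 66 = 0 ∧ t.reg 65 = r)
    (Tri.flat rfl (by decide) (by simp [Prog.out, NExp.val, h64, hr]) le_rfl) ?_ (by omega)
    (by omega)
  intro t hst ⟨t66, t65⟩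
  refine Tri.seq (m₁ := 7) (m₂ := 43) (Q₁ := fun t => t.reg 66 = r * (J + 1))
    (Tri.forLoop (m' := 2) r (fun i t => t.reg 66 = i * (J + 1)) t65 (by omega) (by decide) rfl rfl
      (by simp [Store.put, t66]) ?_ (fun u _ hu => hu) le_rfl le_rfl) ?_ (by omega) (by omega)
  · intro i hi u htu hui hu
    have u8 : u.reg 8 = J + 1 := by rw [htu.reg _ rfl, hst.reg _ rfl, h8]
    refine Tri.flat rfl (by decide) ?_ le_rfl
    simp [Prog.out, NExp.val, Store.put, hu, u8]
    ring
  intro u htu u66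
  have um10 : u.mem 10 = s.mem 10 := by rw [htu.mem _ rfl, hst.mem _ rfl]
  refine Tri.seq (m₁ := 2) (m₂ := 42) (Q₁ := fun x => x.freg 3 = α 0 ∧ x.freg 1 = 1)
    (Tri.flat rfl (by decide) ?_ le_rfl) ?_ (by omega) (by omega)
  · simp [Prog.out, FExp.val, NExp.val, u66, um10, hα]
  intro x hux ⟨x3, x1⟩
  refine Tri.seq (m₁ := 7) (m₂ := 41) (Q₁ := fun y => ∀ i < R, y.fmem 1 i = α 0 ^ (i + 1))
    (Tri.forLoop (m' := 2) R (fun N y => y.freg 1 = α 0 ^ N ∧ ∀ i < N, y.fmem 1 i = α 0 ^ (i + 1))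
      (by rw [hux.reg _ rfl, htu.reg _ rfl, hst.reg _ rfl, h6]) hX (by decide) rfl rfl
      (by simp [Store.put, x1]) ?_ (fun u _ hu => hu.2) le_rfl le_rfl) ?_ (by omega) (by omega)
  · intro i hi y hxy hyi ⟨y1, hy⟩
    have y3 : y.freg 3 = α 0 := (hxy.freg 3 rfl).trans x3
    refine Tri.flat rfl (by decide) ?_ le_rfl
    refine ⟨by simp [Prog.out, FExp.val, Store.put, y1, y3, pow_succ], fun i' hi' => ?_⟩
    by_cases h : i' = i
    · simp [Prog.out, FExp.val, NExp.val, Store.put, h, hyi, y1, y3, pow_succ]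
    · simpa [Prog.out, FExp.val, NExp.val, Store.put, h, hyi] using hy i' (by omega)
  intro y hxy hy
  have y64 : y.reg 64 = v := by
    rw [hxy.reg _ rfl, hux.reg _ rfl, htu.reg _ rfl, hst.reg _ rfl, h64]
  have ym13 : y.mem 13 = s.mem 13 := by
    rw [hxy.mem _ rfl, hux.mem _ rfl, htu.mem _ rfl, hst.mem _ rfl]
  refine Tri.seq (m₁ := 2) (m₂ := 40) (Q₁ := fun z => z.reg 30 = s.mem 13 v ∧ z.reg 31 = 2)
    (Tri.flat rfl (by decide) (by simp [Prog.out, NExp.val, y64, ym13]) le_rfl) ?_ (by omega)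
    (by omega)
  intro z hyz ⟨z30, z31⟩
  have zr : ∀ r, r ∈ [6, 8, 10, 13, 64] → z.reg r = s.reg r := by
    intro r hr
    fin_cases hr <;> rw [hyz.reg _ rfl, hxy.reg _ rfl, hux.reg _ rfl, htu.reg _ rfl, hst.reg _ rfl]
  have z66 : z.reg 66 = r * (J + 1) := by rw [hyz.reg _ rfl, hxy.reg _ rfl, hux.reg _ rfl, u66]
  have zm10 : z.mem 10 = s.mem 10 := by
    rw [hyz.mem _ rfl, hxy.mem _ rfl, hux.mem _ rfl, um10]
  have zf1 : z.fmem 1 = y.fmem 1 := hyz.fmem _ rfl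
  have zf3 : z.fmem 3 = s.fmem 3 := by
    rw [hyz.fmem _ rfl, hxy.fmem _ rfl, hux.fmem _ rfl, htu.fmem _ rfl, hst.fmem _ rfl]
  -- After `j` levels, array `1` holds the values of the curve of level `j` at the powers of seed
  -- `j`, register `30` the unused bits of the position and register `66` the index of that seed. At
  -- the end, entry `0` is the value at seed `J` itself.
  refine Tri.seq (m₁ := 39) (m₂ := 2) (Q₁ := fun a =>
      a.fmem 1 0 = (curve enum R α J (s.mem 13 v)).eval (α J))
    (Tri.forLoop (m' := 34) J (fun j a => a.reg 30 = s.mem 13 v / 2 ^ j ∧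
      a.reg 66 = r * (J + 1) + j ∧
      ∀ i < R, a.fmem 1 i = (curve enum R α j (s.mem 13 v)).eval (α j ^ (i + 1)))
      (by rw [zr 13 (by simp), h13]) hJ (by decide) rfl rfl ?_ ?_ ?_ (by omega) (by omega)) ?_
    (by omega) (by omega)
  · refine ⟨by simp [Store.put, z30], by simp [Store.put, z66], fun i hi => ?_⟩
    simp [Store.put, zf1, hy i hi, curve]
  · intro j hj a hza haj ⟨a30, a66, ha⟩
    have a31 : a.reg 31 = 2 := (hza.reg 31 rfl).trans z31
    refine Tri.seq (m₁ := 6) (m₂ := 33) (divProg_spec enum a (by omega) (by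
      rw [a30]; exact (Nat.div_le_self _ _).trans hps)) ?_ (by omega) (by omega)
    rw [a30, a31]
    intro b hab ⟨b30, b34⟩
    have b66 : b.reg 66 = r * (J + 1) + j := (hab.reg 66 rfl).trans a66
    have bm10 : b.mem 10 = s.mem 10 := by rw [hab.mem _ rfl, hza.mem _ rfl, zm10]
    refine Tri.seq (m₁ := 2) (m₂ := 32) (Q₁ := fun c => c.reg 72 = s.mem 13 v / 2 ^ j % 2 ∧
        c.reg 30 = s.mem 13 v / 2 ^ (j + 1) ∧ c.reg 66 = r * (J + 1) + (j + 1) ∧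
        c.freg 3 = α (j + 1))
      (Tri.flat rfl (by decide) ?_ le_rfl) ?_ (by omega) (by omega)
    · simp [Prog.out, FExp.val, NExp.val, b30, b34, b66, bm10, hα, add_assoc,
        Nat.div_div_eq_div_mul, pow_succ]
    intro c hbc ⟨c72, c30, c66, c3⟩
    have c6 : c.reg 6 = R := by
      rw [hbc.reg _ rfl, hab.reg _ rfl, hza.reg _ rfl, zr 6 (by simp), h6]
    have c10 : c.reg 10 = R * R := by
      rw [hbc.reg _ rfl, hab.reg _ rfl, hza.reg _ rfl, zr 10 (by simp), h10]
    have cf1 : c.fmem 1 = a.fmem 1 := by rw [hbc.fmem _ rfl, hab.fmem _ rfl]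
    refine Tri.mono ((levelProg_spec enum c c6 c10 hX hX').weaken (by omega)) ?_
    intro e hce he
    refine ⟨?_, ?_, fun i hi => ?_⟩
    · simpa [Store.put] using (hce.reg 30 rfl).trans c30
    · simpa [Store.put] using (hce.reg 66 rfl).trans c66
    · simp only [Store.put]
      rw [he i hi, curve, Polynomial.eval_finsetSum, c3, c72, cf1]
      refine Finset.sum_congr rfl fun m hm => ?_
      rw [Finset.mem_range] at hm
      rw [Polynomial.eval_mul, Polynomial.eval_C, ha]
      split_ifs
      · exact Nat.div_lt_of_lt_mul hm
      · exact Nat.mod_lt _ hR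
  · intro a _ ⟨_, _, ha⟩
    rw [ha 0 hR, zero_add, pow_one]
  · intro a hza ha
    have a64 : a.reg 64 = v := by rw [hza.reg _ rfl, zr 64 (by simp), h64]
    have af3 : a.fmem 3 = s.fmem 3 := (hza.fmem 3 rfl).trans zf3
    refine Tri.flat rfl (by decide) ?_ le_rfl
    simp only [Prog.out, FExp.val, NExp.val, Function.update_self, a64, af3, ha]
    rfl


theorem genPoint_congr {F : Type*} [Field F] {β : ℕ → F} {R J : ℕ} {rd ps : ℕ → ℕ}
    {e e' : ℕ → ℕ → ℕ} {v : ℕ} (h : ∀ i ≤ J, e (rd v) i = e' (rd v) i) :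
    genPoint β R J rd ps e v = genPoint β R J rd ps e' v := by
  rw [genPoint, genPoint, h J le_rfl, curve_congr β R J (ps v) fun i hi => by rw [h i hi.le]]

/-- The seeds that are the digits of a number to the base `E`. -/
def digitSeeds (E J c r i : ℕ) : ℕ := c / E ^ (r * (J + 1) + i) % E

/-- Array `3` gets the point whose seeds are the digits of register `80`. -/
def pointsProg : Prog :=
  (.setReg 30 (.var 80) ;; .setReg 31 (.var 7) ;; .setReg 32 (.var 59)) ;;
  decodeProg ;; .forLoop 64 0 pointProg

theorem pointsProg_spec {F : Type*} [Field F] (enum : ℕ → F) {X : ℕ} [Fact (16 ≤ X)] (s : Store F)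
    {n R E J ρ c : ℕ} (h0 : s.reg 0 = n) (h6 : s.reg 6 = R) (h7 : s.reg 7 = E)
    (h10 : s.reg 10 = R * R) (h8 : s.reg 8 = J + 1) (h13 : s.reg 13 = J)
    (h59 : s.reg 59 = ρ * (J + 1)) (h80 : s.reg 80 = c) (hR : 0 < R) (hE : 0 < E) (hn : n ≤ X)
    (hX' : R * R ≤ X) (hJ : J ≤ X) (hT : ρ * (J + 1) ≤ X) (hc : c ≤ X)
    (hrd : ∀ v < n, 0 < s.mem 12 v ∧ s.mem 12 v ≤ ρ) (hps : ∀ v < n, s.mem 13 v ≤ X) :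
    Tri enum X pointsProg s 52 fun t => ∀ v < n, t.fmem 3 v =
      genPoint enum R J (fun v => s.mem 12 v - 1) (s.mem 13) (digitSeeds E J c) v := by
  refine Tri.seq (m₁ := 2) (m₂ := 51) (Q₁ := fun t => t.reg 30 = c ∧ t.reg 31 = E ∧
      t.reg 32 = ρ * (J + 1))
    (Tri.flat rfl (by decide) (by simp [Prog.out, NExp.val, h80, h7, h59]) le_rfl) ?_ (by omega)
    (by omega)
  intro t hst ⟨t30, t31, t32⟩
  refine Tri.seq (m₁ := 12) (m₂ := 50) (decodeProg_spec enum t (by omega) (by omega) (by omega)) ?_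
    (by omega) (by omega)
  rw [t30, t31, t32]
  intro u htu hu
  have ur : ∀ r, r ∈ [0, 6, 8, 10, 13] → u.reg r = s.reg r := by
    intro r hr
    fin_cases hr <;> rw [htu.reg _ rfl, hst.reg _ rfl]
  have um : ∀ a, a ∈ [12, 13] → u.mem a = s.mem a := by
    intro a ha
    fin_cases ha <;> rw [htu.mem _ rfl, hst.mem _ rfl]
  have hρ : ρ ≤ X := (Nat.le_mul_of_pos_right _ (by omega)).trans hT
  refine Tri.forLoop (m' := 45) n (fun i x => ∀ v < i, x.fmem 3 v =
      genPoint enum R J (fun v => s.mem 12 v - 1) (s.mem 13) (digitSeeds E J c) v)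
    (by rw [ur 0 (by simp), h0]) hn (by decide) rfl rfl (by simp) ?_ (fun u _ hu => hu) (by omega)
    (by omega)
  intro i hi x hux hxi hx
  have xr : ∀ r, r ∈ [6, 8, 10, 13] → x.reg r = s.reg r := by
    intro r hr
    fin_cases hr <;> rw [hux.reg _ rfl, ur _ (by simp)]
  have xm12 : x.mem 12 = s.mem 12 := by rw [hux.mem _ rfl, um _ (by simp)]
  have xm13 : x.mem 13 = s.mem 13 := by rw [hux.mem _ rfl, um _ (by simp)]
  have xm10 : x.mem 10 = u.mem 10 := hux.mem _ rfl
  obtain ⟨hrd1, hrd2⟩ := hrd i hi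
  refine Tri.mono (pointProg_spec enum x (by rw [xr 6 (by simp), h6]) (by rw [xr 10 (by simp), h10])
    (by rw [xr 8 (by simp), h8]) (by rw [xr 13 (by simp), h13]) hxi hR hX' hJ
    (by rw [xm12]; omega) (by rw [xm13]; exact hps i hi)) ?_
  intro y _ hy v hv
  simp only [Store.put]
  rw [hy]
  by_cases h : v = i
  · rw [h, Function.update_self, xm12, xm13, xm10]
    refine genPoint_congr fun j hj => hu _ ?_
    calc (s.mem 12 i - 1) * (J + 1) + j < (s.mem 12 i - 1) * (J + 1) + (J + 1) := by omega
      _ = (s.mem 12 i - 1 + 1) * (J + 1) := by ring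
      _ ≤ ρ * (J + 1) := Nat.mul_le_mul_right _ (by omega)
  · rw [Function.update_of_ne h]
    exact hx v (by omega)

/-- The number of points of the generator, in register `58`. -/
def countProg : Prog :=
  .setReg 21 (.lit 0) ;;
  .forLoop 63 14 (.setReg 21 (.add (.var 21) (.var 8))) ;;
  (.setReg 59 (.var 21) ;; .setReg 20 (.var 7)) ;;
  powProg ;; .setReg 58 (.var 22)

theorem countProg_spec {F : Type*} [Field F] (enum : ℕ → F) {X : ℕ} [Fact (16 ≤ X)] (s : Store F)
    {E J ρ : ℕ} (h7 : s.reg 7 = E) (h8 : s.reg 8 = J + 1) (h14 : s.reg 14 = ρ)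
    (hE : E ≤ X) (hT : ρ * (J + 1) ≤ X) :
    Tri enum X countProg s 19 fun t => t.reg 59 = ρ * (J + 1) ∧ t.reg 58 = E ^ (ρ * (J + 1)) := by
  have hρ : ρ ≤ X := (Nat.le_mul_of_pos_right _ (by omega)).trans hT
  refine Tri.seq (m₁ := 2) (m₂ := 18) (Q₁ := fun t => t.reg 21 = 0)
    (Tri.flat rfl (by decide) (by simp [Prog.out, NExp.val]) le_rfl) ?_ (by omega) (by omega)
  intro t hst t21
  refine Tri.seq (m₁ := 7) (m₂ := 17) (Q₁ := fun u => u.reg 21 = ρ * (J + 1))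
    (Tri.forLoop (m' := 2) ρ (fun i u => u.reg 21 = i * (J + 1)) (by rw [hst.reg _ rfl, h14]) hρ
      (by decide) rfl rfl (by simp [Store.put, t21]) ?_ (fun u _ hu => hu) le_rfl le_rfl) ?_
    (by omega) (by omega)
  · intro i hi u htu hui hu
    have u8 : u.reg 8 = J + 1 := by rw [htu.reg _ rfl, hst.reg _ rfl, h8]
    refine Tri.flat rfl (by decide) ?_ le_rfl
    simp [Prog.out, NExp.val, Store.put, hu, u8]
    ring
  intro u htu u21
  have u7 : u.reg 7 = E := by rw [htu.reg _ rfl, hst.reg _ rfl, h7]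
  refine Tri.seq (m₁ := 2) (m₂ := 16) (Q₁ := fun x => x.reg 59 = ρ * (J + 1) ∧
      x.reg 21 = ρ * (J + 1) ∧ x.reg 20 = E)
    (Tri.flat rfl (by decide) (by simp [Prog.out, NExp.val, u21, u7]) le_rfl) ?_ (by omega)
    (by omega)
  intro x _ ⟨x59, x21, x20⟩
  refine Tri.seq (m₁ := 15) (m₂ := 2) (powProg_spec enum x (by omega) (by omega)) ?_ (by omega)
    (by omega)
  rw [x20, x21]
  intro y hxy y22
  have y59 : y.reg 59 = ρ * (J + 1) := by rw [hxy.reg _ rfl, x59]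
  exact Tri.flat rfl (by decide) (by simp [Prog.out, NExp.val, y59, y22]) le_rfl

/-- The enumeration of all points of the generator: for each of them, `emit` is executed. -/
def sweepProg (emit : Prog) : Prog := .forLoop 80 58 (pointsProg ;; emit)

/-- Both final programs are instances. Since `emit` writes no array of numbers and no register up to
`80`, the prepared data survive; its own invariant only has to survive the computation of a point.
-/
theorem sweepProg_spec {F : Type*} [Field F] (enum : ℕ → F) {X : ℕ} [Fact (16 ≤ X)] (s : Store F)
    {n R E J ρ : ℕ} (h0 : s.reg 0 = n) (h6 : s.reg 6 = R) (h7 : s.reg 7 = E)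
    (h10 : s.reg 10 = R * R) (h8 : s.reg 8 = J + 1) (h13 : s.reg 13 = J)
    (h59 : s.reg 59 = ρ * (J + 1)) (h58 : s.reg 58 = E ^ (ρ * (J + 1)))
    (hR : 0 < R) (hE : 0 < E) (hn : n ≤ X)
    (hX' : R * R ≤ X) (hJ : J ≤ X) (hT : ρ * (J + 1) ≤ X) (hET : E ^ (ρ * (J + 1)) ≤ X)
    (hrd : ∀ v < n, 0 < s.mem 12 v ∧ s.mem 12 v ≤ ρ) (hps : ∀ v < n, s.mem 13 v ≤ X)
    {emit : Prog} (hreg : ∀ r ≤ 80, emit.wReg r = false) (hmem : ∀ a, emit.wMem a = false)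
    (I : ℕ → Store F → Prop) (hI0 : I 0 (s.put 80 0))
    (hI : ∀ i t u, pointsProg.Same t u → I i t → I i u)
    (hemit : ∀ i < E ^ (ρ * (J + 1)), ∀ t, (sweepProg emit).Same s t → t.reg 80 = i →
      (∀ v < n, t.fmem 3 v =
        genPoint enum R J (fun v => s.mem 12 v - 1) (s.mem 13) (digitSeeds E J i) v) →
      I i t → Tri enum X emit t 52 fun u => I (i + 1) (u.put 80 (i + 1)))
    {Q : Store F → Prop}
    (hQ : ∀ t, (sweepProg emit).Same s t → I (E ^ (ρ * (J + 1))) t → Q t) :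
    Tri enum X (sweepProg emit) s 58 Q := by
  refine Tri.forLoop (m' := 53) (E ^ (ρ * (J + 1))) I h58 hET (by decide) ?_ ?_ hI0 ?_ hQ (by omega)
    (by omega)
  · exact hreg 80 le_rfl
  · exact hreg 58 (by omega)
  intro i hi t hst hti hIt
  have hw : ∀ r < 80, pointsProg.wReg r = false → (sweepProg emit).wReg r = false := by
    intro r hr h
    simp [sweepProg, Prog.forLoop, Prog.wReg, hreg r hr.le, h]
    omega
  have hm : ∀ a, pointsProg.wMem a = false → (sweepProg emit).wMem a = false := by
    intro a h
    simp [sweepProg, Prog.forLoop, Prog.wMem, hmem a, h]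
  have tr : ∀ r, r ∈ [0, 6, 7, 8, 10, 13, 59] → t.reg r = s.reg r := by
    intro r hr
    fin_cases hr <;> exact hst.reg _ (hw _ (by decide) rfl)
  have tm12 : t.mem 12 = s.mem 12 := hst.mem _ (hm _ rfl)
  have tm13 : t.mem 13 = s.mem 13 := hst.mem _ (hm _ rfl)
  refine Tri.seq (m₁ := 52) (m₂ := 52) (pointsProg_spec enum t (n := n) (R := R) (E := E) (J := J)
    (ρ := ρ) (c := i) (by rw [tr 0 (by simp), h0])
    (by rw [tr 6 (by simp), h6]) (by rw [tr 7 (by simp), h7]) (by rw [tr 10 (by simp), h10])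
    (by rw [tr 8 (by simp), h8]) (by rw [tr 13 (by simp), h13]) (by rw [tr 59 (by simp), h59]) hti
    hR hE hn hX' hJ hT (by omega) (by rw [tm12]; exact hrd) (by rw [tm13]; exact hps)) ?_ (by omega)
    (by omega)
  rw [tm12, tm13]
  intro u htu hu
  refine hemit i hi u (hst.trans (htu.of_le ?_ ?_ ?_ ?_)) ((htu.reg 80 rfl).trans hti) hu
    (hI i t u htu hIt)
  all_goals intro r hr
  all_goals simp only [Prog.forLoop, Prog.wReg, Prog.wMem, Prog.wFReg, Prog.wFMem,
    Bool.or_eq_false_iff] at hr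
  all_goals tauto


/-! ### The two complete programs -/

/-- The computation of everything that the generator needs. -/
def prepProg : Prog := paramProg ;; partitionProg ;; countProg

/-- The results of `prepProg`. -/
structure Prepared {F : Type*} {n L : ℕ} (w d k : ℕ) (σ : Fin L → Fin n) (J ρ : ℕ) (t : Store F) :
    Prop where
  reg6 : t.reg 6 = (n + w + d + 2) ^ (8 * k)
  reg7 : t.reg 7 = (n + w + d + 2) ^ (40 * k)
  reg8 : t.reg 8 = J + 1
  reg10 : t.reg 10 = (n + w + d + 2) ^ (8 * k) * (n + w + d + 2) ^ (8 * k)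
  reg13 : t.reg 13 = J
  reg19 : t.reg 19 = d + 1
  reg58 : t.reg 58 = ((n + w + d + 2) ^ (40 * k)) ^ (ρ * (J + 1))
  reg59 : t.reg 59 = ρ * (J + 1)
  le_pow : 2 * n ≤ 2 ^ J
  pow_le : 2 ^ J ≤ 4 * n
  ne_zero : ∀ v < n, t.mem 12 v ≠ 0
  classes : Classes σ (2 * k + 2) J ρ (t.mem 12) (t.mem 13)

/-- A bound for the number of seeds. -/
noncomputable def seedBound (n k : ℕ) : ℕ :=
  ⌊(2 : ℝ) ^ (k * k + 1) * (n : ℝ) ^ (1 - 1 / (2 : ℝ) ^ (k - 1))⌋₊ * (Nat.log 2 (4 * n) + 1)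

/-- All the numbers that occur in the computation are at most `X`. -/
structure SizeBound (n w d k X : ℕ) : Prop where
  pow_le : (n + w + d + 2) ^ (40 * k) ≤ X
  sqrt_le : 2 ≤ k → (n + 1) ^ (Nat.sqrt n + 1) ≤ X
  seed_le : ((n + w + d + 2) ^ (40 * k)) ^ seedBound n k ≤ X

theorem four_mul_le (n w d k : ℕ) (hk : 1 ≤ k) : 4 * n ≤ (n + w + d + 2) ^ (2 * k) :=
  calc 4 * n ≤ (n + 2) ^ 2 := by nlinarith
    _ ≤ (n + w + d + 2) ^ 2 := Nat.pow_le_pow_left (by omega) 2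
    _ ≤ _ := Nat.pow_le_pow_right (by omega) (by omega)

theorem length_mul_lt {n L k : ℕ} {σ : Fin L → Fin n} (hσ : IsReadK k σ) (w d : ℕ) :
    L * (d + 1) ≤ (n + w + d + 2) ^ (k + 2) := by
  have h1 := hσ.length_le
  have h2 : k ≤ (n + w + d + 2) ^ k := (Nat.lt_pow_self (by omega)).le
  calc L * (d + 1) ≤ n * k * (d + 1) := Nat.mul_le_mul_right _ h1
    _ ≤ (n + w + d + 2) * (n + w + d + 2) ^ k * (n + w + d + 2) := by
        gcongr <;> omega
    _ = _ := by ring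

theorem prepProg_spec {F : Type*} [Field F] (enum : ℕ → F) {X : ℕ} [Fact (16 ≤ X)] (s : Store F)
    {n L w d k : ℕ} {σ : Fin L → Fin n} (hn1 : 1 ≤ n) (hk : 1 ≤ k) (hσ : IsReadK k σ)
    (hX : SizeBound n w d k X) (hord : ∀ l (hl : l < L), s.mem 0 l = σ ⟨l, hl⟩)
    (h0 : s.reg 0 = n) (h1 : s.reg 1 = w) (h2 : s.reg 2 = d) (h3 : s.reg 3 = k) (h4 : s.reg 4 = L)
    (hm : ∀ v < n, s.mem 12 v = 0) :
    Tri enum X prepProg s 42 fun t => ∃ J ρ, Prepared w d k σ J ρ t ∧ ρ * (J + 1) ≤ seedBound n k := by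
  have hb : n + 1 ≤ X := by
    refine le_trans ?_ hX.pow_le
    calc n + 1 ≤ (n + w + d + 2) ^ 1 := by rw [pow_one]; omega
      _ ≤ _ := Nat.pow_le_pow_right (by omega) (by omega)
  have hL : L ≤ X := by
    refine le_trans ?_ hX.pow_le
    calc L ≤ L * (d + 1) := Nat.le_mul_of_pos_right _ (by omega)
      _ ≤ (n + w + d + 2) ^ (k + 2) := length_mul_lt hσ w d
      _ ≤ _ := Nat.pow_le_pow_right (by omega) (by omega)
  refine Tri.seq (m₁ := 24) (m₂ := 41) (paramProg_spec enum s hn1 hk h0 h1 h2 h3 hX.pow_le) ?_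
    (by omega) (by omega)
  intro t hst ⟨t6, t7, t10, t8, tJ, tJ', t11, t12, t19⟩
  have tm0 : t.mem 0 = s.mem 0 := hst.mem 0 rfl
  have tm12 : t.mem 12 = s.mem 12 := hst.mem 12 rfl
  refine Tri.seq (m₁ := 40) (m₂ := 19) (partitionProg_spec enum t hn1 hk hσ (by rw [tm0]; exact hord)
    (by rw [hst.reg _ rfl, h0]) (by rw [hst.reg _ rfl, h3]) (by rw [hst.reg _ rfl, h4]) t11 t12
    hb hL hX.sqrt_le (by rw [tm12]; exact hm) tJ) ?_ (by omega) (by omega)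
  intro u htu ⟨u1, u2, u3⟩
  -- The real bound on the number of classes may be rounded down, and `2 ^ J ≤ 4 * n` bounds `J` by
  -- a logarithm.
  have hseed : u.reg 14 * (t.reg 13 + 1) ≤ seedBound n k :=
    Nat.mul_le_mul (Nat.le_floor u3) (by
      have := Nat.le_log_of_pow_le (by omega) tJ'
      omega)
  have hET : ((n + w + d + 2) ^ (40 * k)) ^ (u.reg 14 * (t.reg 13 + 1)) ≤ X :=
    (Nat.pow_le_pow_right (by positivity) hseed).trans hX.seed_le
  have hTX : u.reg 14 * (t.reg 13 + 1) ≤ X :=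
    (Nat.lt_pow_self (Nat.one_lt_pow (by omega) (by omega))).le.trans hET
  have ur : ∀ r, r ∈ [6, 7, 8, 10, 13, 19] → u.reg r = t.reg r := by
    intro r hr
    fin_cases hr <;> rw [htu.reg _ rfl]
  refine Tri.mono (countProg_spec enum u (E := (n + w + d + 2) ^ (40 * k)) (J := t.reg 13)
    (ρ := u.reg 14) (by rw [ur 7 (by simp), t7]) (by rw [ur 8 (by simp), t8]) rfl hX.pow_le hTX) ?_
  intro x hux ⟨x59, x58⟩
  have xr : ∀ r, r ∈ [6, 7, 8, 10, 13, 19] → x.reg r = t.reg r := by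
    intro r hr
    rw [← ur r hr]
    fin_cases hr <;> rw [hux.reg _ rfl]
  have xm12 : x.mem 12 = u.mem 12 := hux.mem _ rfl
  have xm13 : x.mem 13 = u.mem 13 := hux.mem _ rfl
  refine ⟨t.reg 13, u.reg 14, ⟨?_, ?_, ?_, ?_, ?_, ?_, x58, x59, tJ, tJ', ?_, ?_⟩, hseed⟩
  · rw [xr 6 (by simp), t6]
  · rw [xr 7 (by simp), t7]
  · rw [xr 8 (by simp), t8]
  · rw [xr 10 (by simp), t10, t6]
  · rw [xr 13 (by simp)]
  · rw [xr 19 (by simp), t19]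
  · rw [xm12]
    exact u1
  · rw [xm12, xm13]
    exact u2

namespace Prepared

variable {F : Type*} [Field F] {n L w d k J ρ : ℕ} {σ : Fin L → Fin n} {t : Store F}

/-- The point number `c` of the generator. -/
noncomputable def point (enum : ℕ → F) (n w d k J : ℕ) (t : Store F) (c v : ℕ) : F :=
  genPoint enum ((n + w + d + 2) ^ (8 * k)) J (fun v => t.mem 12 v - 1) (t.mem 13)
    (digitSeeds ((n + w + d + 2) ^ (40 * k)) J c) v

theorem exists_point {enum : ℕ → F} (h : Prepared w d k σ J ρ t) (hk : 1 ≤ k) (hσ : IsReadK k σ)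
    (hinj : Set.InjOn enum (Set.Iio ((n + w + d + 2) ^ (40 * k)))) (A : ObliviousABP F w d σ)
    (hA : A.poly ≠ 0) :
    ∃ c < ((n + w + d + 2) ^ (40 * k)) ^ (ρ * (J + 1)),
      MvPolynomial.eval (fun v : Fin n => point enum n w d k J t c v) A.poly ≠ 0 := by
  set b := n + w + d + 2 with hb
  have hpow : ∀ {i j}, i ≤ j → b ^ i ≤ b ^ j := fun hij => Nat.pow_le_pow_right (by omega) hij
  have hlen := length_mul_lt hσ w d
  rw [← hb] at hlen
  have hLd : L * d ≤ b ^ (k + 2) := (Nat.mul_le_mul_left _ (by omega)).trans hlen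
  -- The choice of `R` covers `w ^ (2 * K)` with `K = 2 * k + 2`, because `4 * k + 4 ≤ 8 * k`.
  have h1 : w ^ (2 * (2 * k + 2)) ≤ b ^ (8 * k) :=
    (Nat.pow_le_pow_left (by omega) _).trans (hpow (by omega))
  have h2 : b ^ (8 * k) * b ^ (8 * k) ≤ b ^ (40 * k) := by
    rw [← pow_add]
    exact hpow (by omega)
  have h0 : 2 ^ J ≤ b ^ (2 * k) := h.pow_le.trans (four_mul_le n w d k hk)
  -- The exponents of `b` add up to `2 * k + 4 * (8 * k) + (k + 2) = 35 * k + 2`, which is less than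
  -- `40 * k`.
  have h3 : 2 ^ J * (b ^ (8 * k) * (b ^ (8 * k) * (L * d * (b ^ (8 * k) * b ^ (8 * k))))) <
      b ^ (40 * k) :=
    calc 2 ^ J * (b ^ (8 * k) * (b ^ (8 * k) * (L * d * (b ^ (8 * k) * b ^ (8 * k)))))
        ≤ b ^ (2 * k) * (b ^ (8 * k) * (b ^ (8 * k) * (b ^ (k + 2) * (b ^ (8 * k) * b ^ (8 * k))))) := by
          gcongr
      _ = b ^ (35 * k + 2) := by ring
      _ < b ^ (40 * k) := Nat.pow_lt_pow_right (by omega) (by omega)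
  have h4 : L * d < b ^ (40 * k) := hLd.trans_lt (Nat.pow_lt_pow_right (by omega) (by omega))
  obtain ⟨e, heE, he⟩ := exists_seeds_genPoint A (R := b ^ (8 * k)) (J := J) (K := 2 * k + 2) (ρ := ρ)
    hinj h1 h2 h3 h4 (rd := fun v => t.mem 12 v - 1) (ps := t.mem 13)
    (fun v hv => h.classes.2.1 v hv (h.ne_zero v hv)) (fun v hv => by
    have := h.classes.1 v hv
    have := h.ne_zero v hv
    omega) (fun r hr => (h.classes.2.2 r hr).congr fun v hv => by
    have := h.ne_zero v hv
    simp only [classPos]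
    split_ifs <;> omega) hA
  -- Each class owns `J + 1` consecutive digits of the code.
  obtain ⟨c, hc, hci⟩ := exists_code (ρ * (J + 1)) (fun i => e (i / (J + 1)) (i % (J + 1)))
    (fun i => heE _ _)
  refine ⟨c, hc, ?_⟩
  convert he using 4 with v
  refine genPoint_congr fun i hi => ?_
  have hv1 := h.classes.1 v v.2
  have hv2 := h.ne_zero v v.2
  have hlt : (t.mem 12 v - 1) * (J + 1) + i < ρ * (J + 1) :=
    calc (t.mem 12 v - 1) * (J + 1) + i < (t.mem 12 v - 1) * (J + 1) + (J + 1) := by omega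
      _ = (t.mem 12 v - 1 + 1) * (J + 1) := by ring
      _ ≤ ρ * (J + 1) := Nat.mul_le_mul_right _ (by omega)
  rw [digitSeeds, hci _ hlt, mul_comm, Nat.mul_add_div (by omega), Nat.div_eq_of_lt (by omega),
    Nat.mul_add_mod, Nat.mod_eq_of_lt (by omega), add_zero]

end Prepared


/-- The point in array `3` is appended to the output. -/
def appendProg : Prog :=
  .forLoop 84 0 (.setFMem 0 (.var 82) (.get 3 (.var 84)) ;; .setReg 82 (.add (.var 82) (.lit 1)))

/-- The construction of the hitting set. -/
def hittingProg : Prog :=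
  prepProg ;; .setReg 82 (.lit 0) ;; sweepProg appendProg ;; .setReg 0 (.var 58)

/-- The conditions on the numbers that the generator needs, apart from the order. -/
theorem Prepared.bounds {F : Type*} {n L w d k J ρ X : ℕ} {σ : Fin L → Fin n} {t : Store F}
    (h : Prepared w d k σ J ρ t) (hn1 : 1 ≤ n) (hk : 1 ≤ k) (hX : SizeBound n w d k X)
    (hs : ρ * (J + 1) ≤ seedBound n k) :
    0 < (n + w + d + 2) ^ (8 * k) ∧ 0 < (n + w + d + 2) ^ (40 * k) ∧ n ≤ X ∧
    (n + w + d + 2) ^ (8 * k) * (n + w + d + 2) ^ (8 * k) ≤ X ∧ J ≤ X ∧ ρ * (J + 1) ≤ X ∧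
    ((n + w + d + 2) ^ (40 * k)) ^ (ρ * (J + 1)) ≤ X ∧
    (∀ v < n, 0 < t.mem 12 v ∧ t.mem 12 v ≤ ρ) ∧ ∀ v < n, t.mem 13 v ≤ X := by
  have hET : ((n + w + d + 2) ^ (40 * k)) ^ (ρ * (J + 1)) ≤ X :=
    (Nat.pow_le_pow_right (by positivity) hs).trans hX.seed_le
  have hJ : 2 ^ J ≤ X := (h.pow_le.trans (four_mul_le n w d k hk)).trans
    ((Nat.pow_le_pow_right (by omega) (by omega)).trans hX.pow_le)
  refine ⟨by positivity, by positivity, by have := h.le_pow; omega, ?_,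
    (Nat.lt_two_pow_self).le.trans hJ, ?_, hET, fun v hv => ?_, fun v hv => ?_⟩
  · rw [← pow_add]
    exact (Nat.pow_le_pow_right (by omega) (by omega)).trans hX.pow_le
  · exact (Nat.lt_pow_self (Nat.one_lt_pow (by omega) (by omega))).le.trans hET
  · exact ⟨Nat.pos_of_ne_zero (h.ne_zero v hv), h.classes.1 v hv⟩
  · exact (h.classes.2.1 v hv (h.ne_zero v hv)).le.trans hJ

/-- The classes and the seed ranges depend on the order and the parameters only, so one run serves
all programs `A` at once. -/
theorem hittingProg_spec {F : Type*} [Field F] (enum : ℕ → F) {X : ℕ} [Fact (16 ≤ X)] (s : Store F)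
    {n L w d k : ℕ} {σ : Fin L → Fin n} (hn1 : 1 ≤ n) (hk : 1 ≤ k) (hσ : IsReadK k σ)
    (hX : SizeBound n w d k X) (hord : ∀ l (hl : l < L), s.mem 0 l = σ ⟨l, hl⟩)
    (h0 : s.reg 0 = n) (h1 : s.reg 1 = w) (h2 : s.reg 2 = d) (h3 : s.reg 3 = k) (h4 : s.reg 4 = L)
    (hm : ∀ v < n, s.mem 12 v = 0)
    (hinj : Set.InjOn enum (Set.Iio ((n + w + d + 2) ^ (40 * k)))) :
    Tri enum X hittingProg s 61 fun t => t.reg 0 ≤ X ∧ ∀ A : ObliviousABP F w d σ, A.poly ≠ 0 →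
      ∃ j < t.reg 0, MvPolynomial.eval (outputPoint n t j) A.poly ≠ 0 := by
  refine Tri.seq (m₁ := 42) (m₂ := 60) (prepProg_spec enum s hn1 hk hσ hX hord h0 h1 h2 h3 h4 hm) ?_
    (by omega) (by omega)
  intro t hst ⟨J, ρ, ht, hs⟩
  obtain ⟨b1, b2, b3, b4, b5, b6, b7, b8, b9⟩ := ht.bounds hn1 hk hX hs
  refine Tri.seq (m₁ := 2) (m₂ := 59) (Q₁ := fun u => u.reg 82 = 0)
    (Tri.flat rfl (by decide) (by simp [Prog.out, NExp.val]) le_rfl) ?_ (by omega) (by omega)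
  intro u htu u82
  have um12 : u.mem 12 = t.mem 12 := htu.mem _ rfl
  have um13 : u.mem 13 = t.mem 13 := htu.mem _ rfl
  have u0 : u.reg 0 = n := by rw [htu.reg _ rfl, hst.reg _ rfl, h0]
  refine Tri.seq (m₁ := 58) (m₂ := 2) (Q₁ := fun x =>
      ∀ j < ((n + w + d + 2) ^ (40 * k)) ^ (ρ * (J + 1)), ∀ v < n,
        x.fmem 0 (j * n + v) = Prepared.point enum n w d k J t j v)
    (sweepProg_spec enum u (n := n) (R := (n + w + d + 2) ^ (8 * k))
      (E := (n + w + d + 2) ^ (40 * k)) (J := J) (ρ := ρ)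
      u0 (by rw [htu.reg _ rfl, ht.reg6])
      (by rw [htu.reg _ rfl, ht.reg7]) (by rw [htu.reg _ rfl, ht.reg10])
      (by rw [htu.reg _ rfl, ht.reg8]) (by rw [htu.reg _ rfl, ht.reg13])
      (by rw [htu.reg _ rfl, ht.reg59]) (by rw [htu.reg _ rfl, ht.reg58]) b1 b2 b3 b4 b5 b6 b7
      (by rw [um12]; exact b8) (by rw [um13]; exact b9) (by decide) (fun _ => rfl)
      (fun c x => x.reg 82 = c * n ∧ ∀ j < c, ∀ v < n,
        x.fmem 0 (j * n + v) = Prepared.point enum n w d k J t j v)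
      (by simp [Store.put, u82]) ?_ ?_ ?_) ?_ (by omega) (by omega)
  · intro c x y hxy hx
    rw [hxy.reg 82 rfl, hxy.fmem 0 rfl]
    exact hx
  · intro c _ x hux _ hx3 ⟨x82, hx⟩
    refine Tri.forLoop (m' := 2) n (fun i y => y.reg 82 = c * n + i ∧
      (∀ v < i, y.fmem 0 (c * n + v) = Prepared.point enum n w d k J t c v) ∧
      ∀ j < c, ∀ v < n, y.fmem 0 (j * n + v) = Prepared.point enum n w d k J t j v)
      (by rw [hux.reg _ rfl, u0]) b3 (by decide) rfl rfl ?_ ?_ ?_ le_rfl (by omega)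
    · exact ⟨by simp [Store.put, x82], by simp, hx⟩
    · intro i hi y hxy hyi ⟨y82, hy1, hy2⟩
      have yf3 : y.fmem 3 i = Prepared.point enum n w d k J t c i := by
        rw [hxy.fmem 3 rfl, hx3 i hi, um12, um13]
        rfl
      refine Tri.flat rfl (by decide) ⟨?_, fun v hv => ?_, fun j hj v hv => ?_⟩ le_rfl
      · simp [Prog.out, NExp.val, Store.put, y82, add_assoc]
      · by_cases h : v = i
        · simp [Prog.out, NExp.val, FExp.val, Store.put, y82, h, hyi, yf3]
        · simpa [Prog.out, NExp.val, FExp.val, Store.put, y82, h, hyi] using hy1 v (by omega)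
      · have h : j * n + v ≠ c * n + i := by
          have : (j + 1) * n ≤ c * n := Nat.mul_le_mul_right _ hj
          rw [Nat.add_mul, one_mul] at this
          omega
        simpa [Prog.out, NExp.val, FExp.val, Store.put, y82, h, hyi] using hy2 j hj v hv
    · intro y _ ⟨y82, hy1, hy2⟩
      refine ⟨by simp [Store.put, y82, Nat.add_mul], fun j hj v hv => ?_⟩
      rcases Nat.lt_succ_iff_lt_or_eq.mp hj with h | rfl
      · exact hy2 j h v hv
      · exact hy1 v hv
  · intro x _ hx
    exact hx.2
  · intro x hux hx
    have x58 : x.reg 58 = ((n + w + d + 2) ^ (40 * k)) ^ (ρ * (J + 1)) := by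
      rw [hux.reg _ rfl, htu.reg _ rfl, ht.reg58]
    refine Tri.flat rfl (by decide) ?_ le_rfl
    simp only [Prog.out, NExp.val, Function.update_self, x58]
    refine ⟨b7, fun A hA => ?_⟩
    obtain ⟨c, hc, hcA⟩ := ht.exists_point hk hσ hinj A hA
    refine ⟨c, hc, ?_⟩
    convert hcA using 4 with v
    exact hx c hc v v.2

/-- The label of an edge of a branching program is evaluated at field register `5`: the value is put
into field register `7`. -/
def labelProg : Prog :=
  (.setFReg 6 .one ;; .setFReg 7 .zero) ;;
  .forLoop 91 19
    (.setFReg 7 (.add (.var 7) (.mul (.get 0 (.var 85)) (.var 6))) ;;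
     .setFReg 6 (.mul (.var 6) (.var 5)) ;; .setReg 85 (.add (.var 85) (.lit 1)))

theorem labelProg_spec {F : Type*} [Field F] (enum : ℕ → F) {X : ℕ} [Fact (16 ≤ X)] (s : Store F)
    (hX : s.reg 19 ≤ X) :
    Tri enum X labelProg s 8 fun t => t.reg 85 = s.reg 85 + s.reg 19 ∧
      t.freg 7 = ∑ j ∈ Finset.range (s.reg 19), s.fmem 0 (s.reg 85 + j) * s.freg 5 ^ j := by
  refine Tri.seq (m₁ := 2) (m₂ := 7) (Q₁ := fun t => t.freg 6 = 1 ∧ t.freg 7 = 0)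
    (Tri.flat rfl (by decide) (by simp [Prog.out, FExp.val]) le_rfl) ?_ (by omega) (by omega)
  intro t hst ⟨t6, t7⟩
  refine Tri.forLoop (m' := 2) (s.reg 19) (fun i u => u.freg 6 = s.freg 5 ^ i ∧
    u.reg 85 = s.reg 85 + i ∧
    u.freg 7 = ∑ j ∈ Finset.range i, s.fmem 0 (s.reg 85 + j) * s.freg 5 ^ j) (hst.reg 19 rfl) hX
    (by decide) rfl rfl ?_ ?_ (fun u _ hu => hu.2) le_rfl le_rfl
  · have := hst.reg 85 rfl
    simp [Store.put, t6, t7, this]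
  · intro i _ u htu _ ⟨u6, u85, u7⟩
    have uf0 : u.fmem 0 = s.fmem 0 := by rw [htu.fmem _ rfl, hst.fmem _ rfl]
    have u5 : u.freg 5 = s.freg 5 := by rw [htu.freg _ rfl, hst.freg _ rfl]
    refine Tri.flat rfl (by decide) ?_ le_rfl
    rw [Finset.sum_range_succ, ← u7]
    simp [Prog.out, FExp.val, NExp.val, Store.put, u6, u85, uf0, u5, pow_succ, add_assoc]

/-- The branching program whose coefficients are in array `0` is evaluated at the point in array `3`:
the value is put into array `4` at the position `0`. -/
def evalProg : Prog :=
  .setReg 85 (.lit 0) ;;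
  .forLoop 86 1 (.setFMem 4 (.var 86) .zero) ;;
  .setFMem 4 (.lit 0) .one ;;
  .forLoop 87 4
    (.setFReg 5 (.get 3 (.get 0 (.var 87))) ;;
     .forLoop 88 1 (.setFMem 5 (.var 88) .zero) ;;
     .forLoop 89 1
      (.forLoop 90 1 (labelProg ;;
        .setFMem 5 (.var 90) (.add (.get 5 (.var 90)) (.mul (.get 4 (.var 89)) (.var 7))))) ;;
     .forLoop 92 1 (.setFMem 4 (.var 92) (.get 5 (.var 92))))

/-- The recursion for row vectors is executed layer by layer. The loops visit `(l, a, b, j)` in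
lexicographic order, which is the order of storage, so register `85` only has to be incremented and
no address is ever computed by multiplication. -/
theorem evalProg_spec {F : Type*} [Field F] (enum : ℕ → F) {X : ℕ} [Fact (16 ≤ X)] (s : Store F)
    {n L w d : ℕ} {σ : Fin L → Fin n} (A : ObliviousABP F w d σ)
    (hord : ∀ l (hl : l < L), s.mem 0 l = σ ⟨l, hl⟩) (h1 : s.reg 1 = w) (h4 : s.reg 4 = L)
    (h19 : s.reg 19 = d + 1) (hw : w ≤ X) (hL : L ≤ X) (hd : d + 1 ≤ X)
    (hA : ∀ m, s.fmem 0 m = A.coeffAt (m / (d + 1) / w / w) (m / (d + 1) / w % w)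
      (m / (d + 1) % w) (m % (d + 1))) :
    Tri enum X evalProg s 32 fun t =>
      t.fmem 4 0 = MvPolynomial.eval (fun v : Fin n => s.fmem 3 v) A.poly := by
  have hw0 : 0 < w := by
    have := A.size_le 0
    rw [A.size_first] at this
    omega
  set x : Fin n → F := fun v => s.fmem 3 v with hx
  have hcoeff : ∀ l a b j, a < w → b < w → j < d + 1 →
      s.fmem 0 (((l * w + a) * w + b) * (d + 1) + j) = A.coeffAt l a b j := by
    intro l a b j ha hb hj
    have e1 : (((l * w + a) * w + b) * (d + 1) + j) / (d + 1) = (l * w + a) * w + b := by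
      rw [mul_comm _ (d + 1), Nat.mul_add_div (by omega), Nat.div_eq_of_lt hj, add_zero]
    have e2 : ((l * w + a) * w + b) / w = l * w + a := by
      rw [mul_comm _ w, Nat.mul_add_div hw0, Nat.div_eq_of_lt hb, add_zero]
    have e3 : (l * w + a) / w = l := by
      rw [mul_comm _ w, Nat.mul_add_div hw0, Nat.div_eq_of_lt ha, add_zero]
    rw [hA, e1, e2, e3, mul_comm _ (d + 1), Nat.mul_add_mod, Nat.mod_eq_of_lt hj, mul_comm l w,
      Nat.mul_add_mod, Nat.mod_eq_of_lt ha, mul_comm _ w, Nat.mul_add_mod, Nat.mod_eq_of_lt hb]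
  refine Tri.seq (m₁ := 2) (m₂ := 31) (Q₁ := fun t => t.reg 85 = 0)
    (Tri.flat rfl (by decide) (by simp [Prog.out, NExp.val]) le_rfl) ?_ (by omega) (by omega)
  intro t hst t85
  refine Tri.seq (m₁ := 7) (m₂ := 30) (Q₁ := fun t => ∀ b < w, t.fmem 4 b = 0)
    (Tri.forLoop (m' := 2) w (fun i t => ∀ b < i, t.fmem 4 b = 0) (by rw [hst.reg _ rfl, h1]) hw
      (by decide) rfl rfl (by simp) ?_ (fun u _ hu => hu) le_rfl le_rfl) ?_ (by omega) (by omega)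
  · intro i hi u _ hui hu
    refine Tri.flat rfl (by decide) (fun b hb => ?_) le_rfl
    by_cases h : b = i
    · simp [Prog.out, NExp.val, FExp.val, Store.put, h, hui]
    · simpa [Prog.out, NExp.val, FExp.val, Store.put, h, hui] using hu b (by omega)
  intro u htu hu
  refine Tri.seq (m₁ := 2) (m₂ := 29) (Q₁ := fun y => ∀ b < w, y.fmem 4 b = A.rowvec x 0 b)
    (Tri.flat rfl (by decide) (fun b hb => ?_) le_rfl) ?_ (by omega) (by omega)
  · by_cases h : b = 0
    · simp [Prog.out, NExp.val, FExp.val, ObliviousABP.rowvec, h]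
    · simpa [Prog.out, NExp.val, FExp.val, ObliviousABP.rowvec, h] using hu b hb
  intro y huy hy
  have y85 : y.reg 85 = 0 := by rw [huy.reg _ rfl, htu.reg _ rfl, t85]
  have yr : ∀ r, r ∈ [1, 4, 19] → y.reg r = s.reg r := by
    intro r hr
    fin_cases hr <;> rw [huy.reg _ rfl, htu.reg _ rfl, hst.reg _ rfl]
  have ym0 : y.mem 0 = s.mem 0 := by rw [huy.mem _ rfl, htu.mem _ rfl, hst.mem _ rfl]
  have yf : ∀ a, a ∈ [0, 3] → y.fmem a = s.fmem a := by
    intro a ha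
    fin_cases ha <;> rw [huy.fmem _ rfl, htu.fmem _ rfl, hst.fmem _ rfl]
  refine Tri.forLoop (m' := 24) L (fun l z => z.reg 85 = l * w * w * (d + 1) ∧
      ∀ b < w, z.fmem 4 b = A.rowvec x l b) (by rw [yr 4 (by simp), h4]) hL (by decide) rfl rfl ?_ ?_
    ?_ (by omega) (by omega)
  · exact ⟨by simp [Store.put, y85], hy⟩
  · intro l hl z hyz hzl ⟨z85, hz⟩
    have zr : ∀ r, r ∈ [1, 19] → z.reg r = s.reg r := by
      intro r hr
      fin_cases hr <;> rw [hyz.reg _ rfl, yr _ (by simp)]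
    have zf : ∀ a, a ∈ [0, 3] → z.fmem a = s.fmem a := by
      intro a ha
      fin_cases ha <;> rw [hyz.fmem _ rfl, yf _ (by simp)]
    have zm0 : z.mem 0 = s.mem 0 := by rw [hyz.mem _ rfl, ym0]
    refine Tri.seq (m₁ := 2) (m₂ := 23) (Q₁ := fun a => a.freg 5 = x (σ ⟨l, hl⟩))
      (Tri.flat rfl (by decide) ?_ le_rfl) ?_ (by omega) (by omega)
    · simp [Prog.out, FExp.val, NExp.val, hzl, zm0, zf 3, hord l hl, hx]
    intro e hze e5
    refine Tri.seq (m₁ := 7) (m₂ := 22) (Q₁ := fun t => ∀ b < w, t.fmem 5 b = 0)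
      (Tri.forLoop (m' := 2) w (fun i t => ∀ b < i, t.fmem 5 b = 0)
        (by rw [hze.reg _ rfl, zr 1 (by simp), h1]) hw
        (by decide) rfl rfl (by simp) ?_ (fun u _ hu => hu) le_rfl le_rfl) ?_ (by omega) (by omega)
    · intro i hi u _ hui hu
      refine Tri.flat rfl (by decide) (fun b hb => ?_) le_rfl
      by_cases h : b = i
      · simp [Prog.out, NExp.val, FExp.val, Store.put, h, hui]
      · simpa [Prog.out, NExp.val, FExp.val, Store.put, h, hui] using hu b (by omega)
    intro g heg hg
    have g5 : g.freg 5 = x (σ ⟨l, hl⟩) := (heg.freg _ rfl).trans e5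
    have gr : ∀ r, r ∈ [1, 19] → g.reg r = s.reg r := by
      intro r hr
      fin_cases hr <;> rw [heg.reg _ rfl, hze.reg _ rfl, zr _ (by simp)]
    have gf0 : g.fmem 0 = s.fmem 0 := by rw [heg.fmem _ rfl, hze.fmem _ rfl, zf 0 (by simp)]
    have gf4 : g.fmem 4 = z.fmem 4 := by rw [heg.fmem _ rfl, hze.fmem _ rfl]
    have g85 : g.reg 85 = l * w * w * (d + 1) := by rw [heg.reg _ rfl, hze.reg _ rfl, z85]
    refine Tri.seq (m₁ := 20) (m₂ := 7) (Q₁ := fun p => p.reg 85 = (l + 1) * w * w * (d + 1) ∧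
        ∀ b < w, p.fmem 5 b = A.rowvec x (l + 1) b)
      (Tri.forLoop (m' := 15) w (fun a p => p.reg 85 = (l * w + a) * w * (d + 1) ∧
        ∀ b < w, p.fmem 5 b = ∑ a' ∈ Finset.range a, A.rowvec x l a' * A.entry x l a' b)
        (by rw [gr 1 (by simp), h1]) hw (by decide) rfl rfl ?_ ?_ ?_ (by omega) (by omega)) ?_
      (by omega) (by omega)
    · simpa [Store.put, g85] using hg
    · intro a ha p hgp hpa ⟨p85, hp⟩
      -- Within row `a`, the columns before `b` already contain the contribution of `a`, the others
      -- do not yet.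
      refine Tri.forLoop (m' := 10) w (fun b q => q.reg 85 = ((l * w + a) * w + b) * (d + 1) ∧
        ∀ b' < w, q.fmem 5 b' = ∑ a' ∈ Finset.range (if b' < b then a + 1 else a),
          A.rowvec x l a' * A.entry x l a' b') (by rw [hgp.reg _ rfl, gr 1 (by simp), h1]) hw
        (by decide) rfl rfl ?_ ?_ ?_ (by omega) (by omega)
      · simpa [Store.put, p85] using hp
      · intro b hb q hpq hqb ⟨q85, hq⟩
        have q19 : q.reg 19 = d + 1 := by rw [hpq.reg _ rfl, hgp.reg _ rfl, gr 19 (by simp), h19]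
        have q5 : q.freg 5 = x (σ ⟨l, hl⟩) := by rw [hpq.freg _ rfl, hgp.freg _ rfl, g5]
        have qf0 : q.fmem 0 = s.fmem 0 := by rw [hpq.fmem _ rfl, hgp.fmem _ rfl, gf0]
        have q89 : q.reg 89 = a := by rw [hpq.reg _ rfl, hpa]
        have qf4 : q.fmem 4 a = A.rowvec x l a := by
          rw [hpq.fmem _ rfl, hgp.fmem _ rfl, gf4, hz a ha]
        refine Tri.seq (m₁ := 8) (m₂ := 3) (labelProg_spec enum q (by omega)) ?_ (by omega) (by omega)
        rw [q85, q19, q5, qf0]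
        intro c hqc ⟨c85, c7⟩
        have hent : c.freg 7 = A.entry x l a b := by
          rw [c7, ObliviousABP.entry, dif_pos hl]
          refine Finset.sum_congr rfl fun j hj => ?_
          rw [hcoeff l a b j ha hb (Finset.mem_range.mp hj)]
          rfl
        have c89 : c.reg 89 = a := (hqc.reg _ rfl).trans q89
        have c90 : c.reg 90 = b := (hqc.reg _ rfl).trans hqb
        have cf4 : c.fmem 4 a = A.rowvec x l a := by rw [hqc.fmem _ rfl, qf4]
        have cf5 : c.fmem 5 = q.fmem 5 := hqc.fmem _ rfl
        refine Tri.flat rfl (by decide) ⟨?_, fun b' hb' => ?_⟩ (by omega)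
        · simp [Prog.out, Store.put, c85]
          ring
        · by_cases h : b' = b
          · subst h
            rw [if_pos (by omega), Finset.sum_range_succ]
            have := hq b' hb'
            rw [if_neg (lt_irrefl _)] at this
            simp [Prog.out, NExp.val, FExp.val, Store.put, c89, c90, cf4, cf5, this, hent]
          · have h' : b' < b + 1 ↔ b' < b := by omega
            simp only [h']
            simpa [Prog.out, NExp.val, FExp.val, Store.put, h, c90, cf5] using hq b' hb'
      · intro q _ ⟨q85, hq⟩
        refine ⟨?_, fun b' hb' => ?_⟩
        · simp only [Store.put]
          rw [Function.update_of_ne (by decide), q85]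
          ring
        · simp only [Store.put]
          rw [hq b' hb', if_pos hb']
    · intro p _ ⟨p85, hp⟩
      refine ⟨?_, hp⟩
      rw [p85]
      ring
    · intro p hgp ⟨p85, hp⟩
      refine Tri.forLoop (m' := 2) w (fun i q => ∀ b < i, q.fmem 4 b = p.fmem 5 b)
        (by rw [hgp.reg _ rfl, gr 1 (by simp), h1]) hw (by decide) rfl rfl (by simp) ?_ ?_ le_rfl
        le_rfl
      · intro i hi q hpq hqi hq
        have qf5 : q.fmem 5 = p.fmem 5 := hpq.fmem _ rfl
        refine Tri.flat rfl (by decide) (fun b hb => ?_) le_rfl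
        by_cases h : b = i
        · simp [Prog.out, NExp.val, FExp.val, Store.put, h, hqi, qf5]
        · simpa [Prog.out, NExp.val, FExp.val, Store.put, h, hqi] using hq b (by omega)
      · intro q hpq hq
        refine ⟨?_, fun b hb => ?_⟩
        · simp only [Store.put]
          rw [Function.update_of_ne (by decide), hpq.reg _ rfl, p85]
        · simp only [Store.put]
          rw [hq b hb, hp b hb]
  · intro z _ hz
    rw [hz.2 0 hw0, ObliviousABP.eval_poly]


/-- Register `83` is set if the branching program does not vanish at the point in array `3`. -/
def probeProg : Prog := evalProg ;; .ite (.isZero (.get 4 (.lit 0))) .skip (.setReg 83 (.lit 1))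

/-- The identity test. -/
def identityProg : Prog :=
  prepProg ;; .setReg 83 (.lit 0) ;; sweepProg probeProg ;;
  .setReg 0 (.sub (.lit 1) (.var 83))

theorem identityProg_spec {F : Type*} [Field F] (enum : ℕ → F) {X : ℕ} [Fact (16 ≤ X)] (s : Store F)
    {n L w d k : ℕ} {σ : Fin L → Fin n} (hn1 : 1 ≤ n) (hk : 1 ≤ k) (hσ : IsReadK k σ)
    (hX : SizeBound n w d k X) (hord : ∀ l (hl : l < L), s.mem 0 l = σ ⟨l, hl⟩)
    (h0 : s.reg 0 = n) (h1 : s.reg 1 = w) (h2 : s.reg 2 = d) (h3 : s.reg 3 = k) (h4 : s.reg 4 = L)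
    (hm : ∀ v < n, s.mem 12 v = 0)
    (hinj : Set.InjOn enum (Set.Iio ((n + w + d + 2) ^ (40 * k)))) (A : ObliviousABP F w d σ)
    (hA : ∀ m, s.fmem 0 m = A.coeffAt (m / (d + 1) / w / w) (m / (d + 1) / w % w)
      (m / (d + 1) % w) (m % (d + 1))) :
    Tri enum X identityProg s 61 fun t => t.reg 0 = 1 ↔ A.poly = 0 := by
  classical
  have hb : n + w + d + 2 ≤ X := by
    refine le_trans ?_ hX.pow_le
    calc n + w + d + 2 = (n + w + d + 2) ^ 1 := by rw [pow_one]
      _ ≤ _ := Nat.pow_le_pow_right (by omega) (by omega)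
  have hL : L ≤ X := by
    refine le_trans ?_ hX.pow_le
    calc L ≤ L * (d + 1) := Nat.le_mul_of_pos_right _ (by omega)
      _ ≤ (n + w + d + 2) ^ (k + 2) := length_mul_lt hσ w d
      _ ≤ _ := Nat.pow_le_pow_right (by omega) (by omega)
  refine Tri.seq (m₁ := 42) (m₂ := 60) (prepProg_spec enum s hn1 hk hσ hX hord h0 h1 h2 h3 h4 hm) ?_
    (by omega) (by omega)
  intro t hst ⟨J, ρ, ht, hs⟩
  obtain ⟨b1, b2, b3, b4, b5, b6, b7, b8, b9⟩ := ht.bounds hn1 hk hX hs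
  refine Tri.seq (m₁ := 2) (m₂ := 59) (Q₁ := fun u => u.reg 83 = 0)
    (Tri.flat rfl (by decide) (by simp [Prog.out, NExp.val]) le_rfl) ?_ (by omega) (by omega)
  intro u htu u83
  have um12 : u.mem 12 = t.mem 12 := htu.mem _ rfl
  have um13 : u.mem 13 = t.mem 13 := htu.mem _ rfl
  have um0 : u.mem 0 = s.mem 0 := (htu.mem _ rfl).trans (hst.mem _ rfl)
  have uf0 : u.fmem 0 = s.fmem 0 := (htu.fmem _ rfl).trans (hst.fmem _ rfl)
  have u0 : u.reg 0 = n := by rw [htu.reg _ rfl, hst.reg _ rfl, h0]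
  have u1 : u.reg 1 = w := by rw [htu.reg _ rfl, hst.reg _ rfl, h1]
  have u4 : u.reg 4 = L := by rw [htu.reg _ rfl, hst.reg _ rfl, h4]
  have u19 : u.reg 19 = d + 1 := by rw [htu.reg _ rfl, ht.reg19]
  set N := ((n + w + d + 2) ^ (40 * k)) ^ (ρ * (J + 1)) with hN
  refine Tri.seq (m₁ := 58) (m₂ := 2) (Q₁ := fun x => x.reg 83 =
      if ∃ c < N, MvPolynomial.eval
        (fun v : Fin n => Prepared.point enum n w d k J t c v) A.poly ≠ 0 then 1 else 0)
    (sweepProg_spec enum u (n := n) (R := (n + w + d + 2) ^ (8 * k))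
      (E := (n + w + d + 2) ^ (40 * k)) (J := J) (ρ := ρ)
      u0 (by rw [htu.reg _ rfl, ht.reg6])
      (by rw [htu.reg _ rfl, ht.reg7]) (by rw [htu.reg _ rfl, ht.reg10])
      (by rw [htu.reg _ rfl, ht.reg8]) (by rw [htu.reg _ rfl, ht.reg13])
      (by rw [htu.reg _ rfl, ht.reg59]) (by rw [htu.reg _ rfl, ht.reg58]) b1 b2 b3 b4 b5 b6 b7
      (by rw [um12]; exact b8) (by rw [um13]; exact b9) (by decide) (fun _ => rfl)
      (fun i x => x.reg 83 = if ∃ c < i, MvPolynomial.eval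
        (fun v : Fin n => Prepared.point enum n w d k J t c v) A.poly ≠ 0 then 1 else 0)
      (by simp [Store.put, u83]) ?_ ?_ ?_) ?_ (by omega) (by omega)
  · intro c x y hxy hx
    rw [hxy.reg 83 rfl]
    exact hx
  · intro c _ x hux _ hx3 hx
    refine Tri.seq (m₁ := 32) (m₂ := 3) (evalProg_spec enum x A
      (by rw [hux.mem 0 rfl, um0]; exact hord) (by rw [hux.reg 1 rfl, u1])
      (by rw [hux.reg 4 rfl, u4]) (by rw [hux.reg 19 rfl, u19]) (by omega) hL (by omega)
      (by rw [hux.fmem 0 rfl, uf0]; exact hA)) ?_ (by omega) (by omega)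
    intro y hxy hy
    have y83 : y.reg 83 = x.reg 83 := hxy.reg _ rfl
    have hpt : (fun v : Fin n => x.fmem 3 v) =
        fun v : Fin n => Prepared.point enum n w d k J t c v := by
      ext v
      rw [hx3 v v.2, um12, um13]
      rfl
    rw [hpt] at hy
    refine Tri.flat rfl (by decide) ?_ (by omega)
    by_cases h : MvPolynomial.eval
        (fun v : Fin n => Prepared.point enum n w d k J t c v) A.poly = 0
    · have hiff : (∃ c' < c + 1, MvPolynomial.eval
          (fun v : Fin n => Prepared.point enum n w d k J t c' v) A.poly ≠ 0) ↔
          ∃ c' < c, MvPolynomial.eval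
          (fun v : Fin n => Prepared.point enum n w d k J t c' v) A.poly ≠ 0 := by
        refine exists_congr fun c' => ⟨fun ⟨h1, h2⟩ => ⟨?_, h2⟩, fun ⟨h1, h2⟩ => ⟨by omega, h2⟩⟩
        rcases Nat.lt_succ_iff_lt_or_eq.mp h1 with h' | rfl
        · exact h'
        · exact absurd h h2
      rw [h] at hy
      simp only [hiff]
      rw [← hx, ← y83]
      simp [Prog.out, NExp.val, FExp.val, Test.Holds, Store.put, hy]
    · rw [if_pos ⟨c, by omega, h⟩]
      rw [← hy] at h
      simp [Prog.out, NExp.val, FExp.val, Test.Holds, Store.put, h]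
  · intro x _ hx
    exact hx
  · intro x _ hx
    refine Tri.flat rfl (by decide) ?_ le_rfl
    simp only [Prog.out, NExp.val, Function.update_self, hx]
    constructor
    · intro h
      by_contra hcon
      rw [if_pos (ht.exists_point hk hσ hinj A hcon)] at h
      omega
    · intro h
      rw [if_neg]
      rintro ⟨c, _, hc⟩
      rw [h, map_zero] at hc
      exact hc rfl

/-! ### The bounds -/

/-- The gap between `2` and `e` absorbs the factor `k`: one has `e ≥ 2 * 1.35`, and Bernoulli's
inequality gives `k ≤ 3 * 1.35 ^ (k * k)`. -/
theorem mul_two_pow_le_exp (k : ℕ) : (k : ℝ) * 2 ^ (k * k) ≤ 3 * Real.exp ((k : ℝ) ^ 2) := by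
  have h1 : (1.35 : ℝ) * 2 ≤ Real.exp 1 := by
    have := Real.exp_one_gt_d9
    norm_num
    linarith
  have h2 : Real.exp ((k : ℝ) ^ 2) = Real.exp 1 ^ (k * k) := by
    rw [← Real.exp_nat_mul]
    push_cast
    ring_nf
  have h3 : (k : ℝ) ≤ 3 * 1.35 ^ (k * k) := by
    have := one_add_mul_le_pow (show (-2 : ℝ) ≤ 0.35 by norm_num) (k * k)
    norm_num at this ⊢
    have hkk : (k : ℝ) ≤ k * k := by
      rcases Nat.eq_zero_or_pos k with rfl | h
      · simp
      · have : (1 : ℝ) ≤ k := by exact_mod_cast h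
        nlinarith
    linarith
  calc (k : ℝ) * 2 ^ (k * k) ≤ 3 * 1.35 ^ (k * k) * 2 ^ (k * k) := by gcongr
    _ = 3 * (1.35 * 2) ^ (k * k) := by rw [mul_pow]; ring
    _ ≤ 3 * Real.exp 1 ^ (k * k) := by gcongr
    _ = _ := by rw [h2]

/-- The exponent in the bound for the numbers that occur in the computation. -/
noncomputable def sizeExponent (n k : ℕ) : ℕ :=
  40 * k + 40 * k * seedBound n k + if 2 ≤ k then Nat.sqrt n + 1 else 0

theorem sizeBound_sizeExponent (n w d k : ℕ) :
    SizeBound n w d k ((n + w + d + 2) ^ sizeExponent n k) := by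
  refine ⟨Nat.pow_le_pow_right (by omega) ?_, fun hk => ?_, ?_⟩
  · rw [sizeExponent]
    omega
  · refine (Nat.pow_le_pow_left (by omega) _).trans (Nat.pow_le_pow_right (by omega) ?_)
    rw [sizeExponent, if_pos hk]
    omega
  · rw [← pow_mul]
    refine Nat.pow_le_pow_right (by omega) ?_
    rw [sizeExponent]
    omega

theorem one_le_log_add_two {n : ℕ} (hn : 1 ≤ n) : 1 ≤ Real.log ((n : ℝ) + 2) := by
  rw [Real.le_log_iff_exp_le (by positivity)]
  have h1 := Real.exp_one_lt_d9
  have h2 : (1 : ℝ) ≤ n := by exact_mod_cast hn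
  linarith

/-- This rests on `4 * n ≤ (n + 2) ^ 2` and on a numerical lower bound for `log 2`. -/
theorem natLog_le {n : ℕ} (hn : 1 ≤ n) :
    ((Nat.log 2 (4 * n) + 1 : ℕ) : ℝ) ≤ 4 * Real.log ((n : ℝ) + 2) := by
  have hn' : (1 : ℝ) ≤ n := by exact_mod_cast hn
  have h1 := one_le_log_add_two hn
  have h2 : (2 : ℝ) ^ Nat.log 2 (4 * n) ≤ ((n : ℝ) + 2) ^ 2 := by
    have : 2 ^ Nat.log 2 (4 * n) ≤ 4 * n := Nat.pow_log_le_self 2 (by omega)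
    calc (2 : ℝ) ^ Nat.log 2 (4 * n) ≤ 4 * n := by exact_mod_cast this
      _ ≤ _ := by nlinarith
  have h3 := Real.log_le_log (by positivity) h2
  rw [Real.log_pow, Real.log_pow] at h3
  have h4 := Real.log_two_gt_d9
  push_cast at h3 ⊢
  have h5 : (0 : ℝ) ≤ Nat.log 2 (4 * n) := by positivity
  nlinarith

/-- The three summands are at most `120`, `960` and `2` times the product on the right. The square
root from the search occurs only for `k ≥ 2`, when the exponent of `n` is at least `1 / 2`. -/
theorem sizeExponent_le {n k : ℕ} (hn : 1 ≤ n) (hk : 1 ≤ k) :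
    (sizeExponent n k : ℝ) ≤ 1100 * ((n : ℝ) ^ (1 - 1 / (2 : ℝ) ^ (k - 1)) *
      Real.exp ((k : ℝ) ^ 2) * Real.log ((n : ℝ) + 2)) := by
  have hn' : (1 : ℝ) ≤ n := by exact_mod_cast hn
  have hβ : (0 : ℝ) ≤ 1 - 1 / (2 : ℝ) ^ (k - 1) := by
    rw [sub_nonneg]
    exact (div_le_one (by positivity)).mpr (one_le_pow₀ (by norm_num))
  have hlog := one_le_log_add_two hn
  have hlog' := natLog_le hn
  have hexp := mul_two_pow_le_exp k
  have hexp1 : (1 : ℝ) ≤ Real.exp ((k : ℝ) ^ 2) := Real.one_le_exp (by positivity)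
  have hpow : (1 : ℝ) ≤ (n : ℝ) ^ (1 - 1 / (2 : ℝ) ^ (k - 1)) := Real.one_le_rpow hn' hβ
  have hsqrt : ((if 2 ≤ k then Nat.sqrt n + 1 else 0 : ℕ) : ℝ) ≤
      2 * (n : ℝ) ^ (1 - 1 / (2 : ℝ) ^ (k - 1)) := by
    split_ifs with h2
    · have h3 : ((Nat.sqrt n : ℕ) : ℝ) ≤ (n : ℝ) ^ (1 - 1 / (2 : ℝ) ^ (k - 1)) := by
        calc ((Nat.sqrt n : ℕ) : ℝ) ≤ Real.sqrt n := Real.nat_sqrt_le_real_sqrt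
          _ = (n : ℝ) ^ (1 / 2 : ℝ) := Real.sqrt_eq_rpow _
          _ ≤ _ := by
            refine Real.rpow_le_rpow_of_exponent_le hn' ?_
            have : (1 : ℝ) / 2 ^ (k - 1) ≤ 1 / 2 := by
              refine one_div_le_one_div_of_le (by norm_num) ?_
              calc (2 : ℝ) = 2 ^ 1 := by norm_num
                _ ≤ 2 ^ (k - 1) := pow_le_pow_right₀ (by norm_num) (by omega)
            linarith
      push_cast
      linarith
    · push_cast
      positivity
  have hseed : (seedBound n k : ℝ) ≤ 2 ^ (k * k + 1) * (n : ℝ) ^ (1 - 1 / (2 : ℝ) ^ (k - 1)) *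
      (4 * Real.log ((n : ℝ) + 2)) := by
    rw [seedBound, Nat.cast_mul]
    exact mul_le_mul (Nat.floor_le (by positivity)) hlog' (by positivity) (by positivity)
  have hk1 : (k : ℝ) ≤ 3 * Real.exp ((k : ℝ) ^ 2) := by
    refine le_trans (le_mul_of_one_le_right (by positivity) ?_) hexp
    exact one_le_pow₀ (by norm_num)
  rw [sizeExponent, Nat.cast_add, Nat.cast_add, Nat.cast_mul (40 * k), Nat.cast_mul 40 k]
  set P := (n : ℝ) ^ (1 - 1 / (2 : ℝ) ^ (k - 1))
  set Y := Real.exp ((k : ℝ) ^ 2)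
  set l := Real.log ((n : ℝ) + 2)
  have e1 : Y ≤ P * Y * l := by
    calc Y = 1 * Y * 1 := by ring
      _ ≤ P * Y * l := by gcongr
  have e2 : P ≤ P * Y * l := by
    calc P = P * 1 * 1 := by ring
      _ ≤ P * Y * l := by gcongr
  have e3 : (k : ℝ) * (seedBound n k : ℝ) ≤ 24 * (P * Y * l) :=
    calc (k : ℝ) * (seedBound n k : ℝ) ≤ k * (2 ^ (k * k + 1) * P * (4 * l)) := by gcongr
      _ = (k * 2 ^ (k * k)) * (8 * (P * l)) := by ring
      _ ≤ (3 * Y) * (8 * (P * l)) := by gcongr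
      _ = _ := by ring
  push_cast at hsqrt ⊢
  linarith

/-- The exponent `61` is the one proved for both programs, and `1100 * 61 ≤ 70000`. Only one power
of the logarithm is needed; the others are slack, since the logarithm is at least `1`. -/
theorem pow_sizeExponent_le {n w d k m : ℕ} (hn : 1 ≤ n) (hk : 1 ≤ k) (hm : m ≤ 61) :
    ((((n + w + d + 2) ^ sizeExponent n k) ^ m : ℕ) : ℝ) ≤ readKBound 70000 k n w d := by
  have hb : (1 : ℝ) ≤ (n : ℝ) + w + d + 2 := by
    have h1 : (0 : ℝ) ≤ (n : ℝ) + w + d := by positivity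
    linarith
  have hlog := one_le_log_add_two hn
  have hexp := sizeExponent_le hn hk
  rw [readKBound, ← Real.rpow_natCast, ← Real.rpow_mul (by linarith)]
  push_cast
  rw [← pow_mul, ← Real.rpow_natCast]
  refine Real.rpow_le_rpow_of_exponent_le hb ?_
  push_cast
  set S := (n : ℝ) ^ (1 - 1 / (2 : ℝ) ^ (k - 1)) * Real.exp ((k : ℝ) ^ 2) with hS
  have hS0 : 0 ≤ S := by positivity
  have h1 : S * Real.log ((n : ℝ) + 2) ≤ S * Real.log ((n : ℝ) + 2) ^ 70000 :=
    mul_le_mul_of_nonneg_left (le_self_pow₀ hlog (by norm_num)) hS0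
  have h2 : (m : ℝ) ≤ 61 := by exact_mod_cast hm
  have h3 : 0 ≤ S * Real.log ((n : ℝ) + 2) := by positivity
  calc (sizeExponent n k : ℝ) * m ≤ 1100 * (S * Real.log ((n : ℝ) + 2)) * 61 := by gcongr
    _ ≤ 70000 * (S * Real.log ((n : ℝ) + 2)) := by linarith
    _ ≤ _ := by linarith

theorem sixteen_le_pow_sizeExponent {n k : ℕ} (w d : ℕ) (hn : 1 ≤ n) (hk : 1 ≤ k) :
    16 ≤ (n + w + d + 2) ^ sizeExponent n k :=
  calc 16 ≤ 3 ^ 40 := by norm_num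
    _ ≤ (n + w + d + 2) ^ 40 := Nat.pow_le_pow_left (by omega) _
    _ ≤ _ := Nat.pow_le_pow_right (by omega) (by rw [sizeExponent]; omega)

theorem mainTheorem4 :
    ∃ (C : ℕ) (test build : Prog),
      ∀ (F : Type*) [Field F] (enum : ℕ → F) (n w d k L : ℕ) (σ : Fin L → Fin n),
        1 ≤ n → 1 ≤ k → IsReadK k σ →
        Set.InjOn enum (Set.Iio (fieldBound C k n w d)) →
          -- the white-box identity test
          (∀ A : ObliviousABP F w d σ,
            ∃ (t : Store F) (time : ℕ),
              Runs enum test (abpStore k A) t time ∧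
              (time : ℝ) ≤ readKBound C k n w d ∧
              (t.reg 0 = 1 ↔ A.poly = 0)) ∧
          -- the construction of a hitting set from the order alone
          (∃ (t : Store F) (time : ℕ),
              Runs enum build (orderStore F w d k σ) t time ∧
              (time : ℝ) ≤ readKBound C k n w d ∧
              (t.reg 0 : ℝ) ≤ readKBound C k n w d ∧
              ∀ A : ObliviousABP F w d σ, A.poly ≠ 0 →
                ∃ j < t.reg 0, MvPolynomial.eval (outputPoint n t j) A.poly ≠ 0) := by
  -- The constant is dictated by the running time. For the number of field elements `40` would be
  -- enough.
  refine ⟨70000, identityProg, hittingProg, ?_⟩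
  intro F _ enum n w d k L σ hn hk hσ hinj
  have hX := sizeBound_sizeExponent n w d k
  have hinj' : Set.InjOn enum (Set.Iio ((n + w + d + 2) ^ (40 * k))) :=
    hinj.mono (Set.Iio_subset_Iio (Nat.pow_le_pow_right (by omega) (by omega)))
  have : Fact (16 ≤ (n + w + d + 2) ^ sizeExponent n k) := ⟨sixteen_le_pow_sizeExponent w d hn hk⟩
  constructor
  · intro A
    obtain ⟨t, c, h1, h2, h3⟩ := identityProg_spec enum (abpStore k A) hn hk hσ hX
      (fun l hl => by simp [abpStore, orderStore, hl]) rfl rfl rfl rfl rfl (fun v _ => rfl) hinj' A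
      (fun m => rfl)
    exact ⟨t, c, h1, le_trans (by exact_mod_cast h2) (pow_sizeExponent_le hn hk le_rfl), h3⟩
  · obtain ⟨t, c, h1, h2, h3, h4⟩ := hittingProg_spec enum (orderStore F w d k σ) hn hk hσ hX
      (fun l hl => by simp [orderStore, hl]) rfl rfl rfl rfl rfl (fun v _ => rfl) hinj'
    refine ⟨t, c, h1, le_trans (by exact_mod_cast h2) (pow_sizeExponent_le hn hk le_rfl),
      le_trans ?_ (pow_sizeExponent_le (m := 1) hn hk (by norm_num)), h4⟩
    rw [pow_one]
    exact_mod_cast h3
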